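/- **Corollary (A Littlewood–Richardson rule).** *Conventions.* Diagrams are in English notation; $\lambda'$ is the conjugate of the partition $\lambda$ and $\ell(\lambda)$ its length. $\mathrm{SSYT}(\nu,\alpha)$ is the set of semistandard Young tableaux of shape $\nu$ (rows weakly, columns strictly increasing) in which each letter $i$ occurs $\alpha_i$ times, $K_{\nu\alpha}=|\mathrm{SSYT}(\nu,\alpha)|$ is the Kostka number, and $\mathrm{s}_\nu$ is the Schur function. The Littlewood–Richardson coefficients are the integers uniquely determined by $\mathrm{s}_\mu\mathrm{s}_\nu=\sum_\kappa c^{\kappa}_{\mu\nu}\mathrm{s}_\kappa$. *Charge.* For a permutation $\sigma\in S_k$ let $\mathrm{charge}(\sigma)=\sum (k-i)$, summed over those $1\le i<k$ for which $i+1$ stands to the right of $i$ in $\sigma$. Let $w$ be a word whose content is a partition. Its first standard subword is obtained by marking the first $1$ from the right end of $w$, then, going to the left, the first $2$, then the first $3$, and so on, wrapping around to the right end when necessary, until every letter occurring in $w$ has been marked once. Remove this subword and repeat to get all standard subwords; $\mathrm{charge}(w)$ is the sum of their charges. For a partition $\mu$ put $\mathrm{charge}_\mu(w)=\mathrm{charge}(w\cdot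 \ell^{\mu_\ell}\cdots 2^{\mu_2}1^{\mu_1})$ with $\ell=\ell(\mu)$, defined when the word on the right has partition content. For a tableau $T$, $\mathrm{charge}_\mu(T)=\mathrm{charge}_\mu(\mathrm{rw}(T))$, where $\mathrm{rw}(T)$ reads the rows of $T$ from bottom to top, each from left to right. *The polynomials $\mathrm{E}_\lambda$.* A filling $F$ of $\lambda$ with entries in $[m]=\{1,\dots,m\}$ is coinversion-free if its first column is strictly decreasing from top to bottom, and for all boxes $a,b,c$ of $\lambda$ with $a$ immediately to the left of $b$, and $c$ below $b$ in the same column, one of $F(a)<F(c)<F(b)$, $F(c)<F(b)\le F(a)$, $F(b)\le F(a)<F(c)$ holds. Let $\mathrm{maj}(F)=\sum_{(i,j)}(\lambda_i-j+1)$ over the boxes $(i,j)$ with $j\geq 2$ and $F(i,j-1)<F(i,j)$, and $$\mathrm{E}_\lambda(x_1,\dots,x_m;q,0)=\sum_F q^{\mathrm{maj}(F)}\prod_{b\in\lambda}x_{F(b)},$$ summed over all coinversion-free fillings $F$ of $\lambda$ with entries in $[m]$. *Statement.* For a skew shape $\lambda/\mu$, let $\alpha_i=\lambda'_i-\mu'_i$,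 and for every partition $\nu$ let $$K^{\nu}_{\lambda/\mu}(q)=\sum_{T\in \mathrm{SSYT}(\nu,\alpha)}q^{\mathrm{charge}_{\mu'}(T)}.$$ Then, for all skew shapes $\lambda/\mu$ and all partitions $\nu$, (a) $K^{\nu}_{\lambda/\mu}(0)=c^{\lambda}_{\mu\nu'}$; (b) $K^{\nu}_{\lambda/\mu}(1)=K_{\nu\alpha}$; (c) for any two partitions $\lambda$ and $\mu$, $$\mathrm{E}_\lambda(\mathbf{x};q,0)\,\mathrm{E}_\mu(\mathbf{x};q,0)=\sum_{\nu\vdash|\lambda|+|\mu|}K^{\nu}_{\kappa/c^r}(q)\,\mathrm{s}_{\nu'}(\mathbf{x})$$ in every finite number of variables $\mathbf{x}=(x_1,\dots,x_m)$, $m\ge 0$, where $c=\mu_1$ (with $c=0$ if $\mu=\emptyset$), $r=\ell(\lambda)$, $c^r$ is the rectangle with $r$ rows of length $c$, and $\kappa=(c+\lambda_1,\dots,c+\lambda_{\ell(\lambda)},\mu_1,\mu_2,\dots,\mu_{\ell(\mu)})$. -/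

import Mathlib

/-! Partitions are `YoungDiagram`s (English notation, matrix coordinates, rows and columns indexed
from `0`); `μ.rowLen i` and `μ.colLen j` are the row and column lengths, `μ.transpose` is the
conjugate, and `μ ≤ lam` is containment of diagrams.  Letters are natural numbers starting at `0`,
as the entries of Mathlib's `SemistandardYoungTableau` do: the letter `k` here is the letter `k + 1`
of the usual alphabet `{1, 2, 3, …}`. -/

noncomputable section

namespace LRCharge

open Polynomial

/-! ### Semistandard tableaux, Kostka numbers, Schur polynomials -/

/-- The number of entries of `T` equal to `k`. -/
def content {ν : YoungDiagram} (T : SemistandardYoungTableau ν) (k : ℕ) : ℕ :=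
  (ν.cells.filter fun c => T c.1 c.2 = k).card

theorem finite_ssyt_lt (ν : YoungDiagram) (m : ℕ) :
    {T : SemistandardYoungTableau ν | ∀ c ∈ ν.cells, T c.1 c.2 < m}.Finite := by
  let f : SemistandardYoungTableau ν → (ν.cells → ℕ) := fun T c => T c.1.1 c.1.2
  have hf : Function.Injective f := by
    intro T T' h
    ext i j
    by_cases hc : (i, j) ∈ ν
    · exact congrFun h ⟨(i, j), hc⟩
    · rw [T.zeros hc, T'.zeros hc]
  refine Set.Finite.of_finite_image ?_ hf.injOn
  refine (Set.Finite.pi' (fun _ : ν.cells => Set.finite_lt_nat m)).subset ?_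
  rintro _ ⟨T, hT, rfl⟩ c
  exact hT c.1 c.2

theorem finite_ssyt_content (ν : YoungDiagram) (α : ℕ → ℕ) :
    {T : SemistandardYoungTableau ν | ∀ k, content T k = α k}.Finite := by
  rcases Set.eq_empty_or_nonempty
    {T : SemistandardYoungTableau ν | ∀ k, content T k = α k} with h | ⟨T₀, h₀⟩
  · rw [h]; exact Set.finite_empty
  · refine (finite_ssyt_lt ν ((ν.cells.sup fun c => T₀ c.1 c.2) + 1)).subset ?_
    intro T hT c hc
    have h1 : 0 < content T₀ (T c.1 c.2) := by
      rw [h₀, ← hT]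
      exact Finset.card_pos.mpr ⟨c, Finset.mem_filter.mpr ⟨hc, rfl⟩⟩
    obtain ⟨d, hd⟩ := Finset.card_pos.mp h1
    obtain ⟨hd1, hd2⟩ := Finset.mem_filter.mp hd
    rw [← hd2]
    exact Nat.lt_succ_of_le (Finset.le_sup (f := fun c : ℕ × ℕ => T₀ c.1 c.2) hd1)

/-- The semistandard Young tableaux of shape `ν` with entries in an alphabet of `m` letters. -/
def ssytLT (ν : YoungDiagram) (m : ℕ) : Finset (SemistandardYoungTableau ν) :=
  (finite_ssyt_lt ν m).toFinset

/-- `SSYT(ν, α)`: the semistandard Young tableaux of shape `ν` and content `α`. -/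
def ssyt (ν : YoungDiagram) (α : ℕ → ℕ) : Finset (SemistandardYoungTableau ν) :=
  (finite_ssyt_content ν α).toFinset

/-- The Kostka number `K_{να}`. -/
def kostka (ν : YoungDiagram) (α : ℕ → ℕ) : ℕ := (ssyt ν α).card

/-- The Schur polynomial `s_ν(x_1, …, x_m) = ∑_T x^T`, with `x^T` the monomial whose exponent at the
`k`-th variable is the number of entries of `T` equal to `k`. -/
def schur (R : Type*) [CommRing R] (m : ℕ) (ν : YoungDiagram) : MvPolynomial (Fin m) R :=
  ∑ T ∈ ssytLT ν m,
    MvPolynomial.monomial (Finsupp.equivFunOnFinite.symm fun k : Fin m => content T k) 1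

/-! ### Littlewood–Richardson coefficients -/

/-- `c` is the family of coefficients in `s_μ s_ν = ∑_κ c_κ s_κ`, an identity of symmetric
functions, that is, of polynomials in every number of variables. -/
def IsSchurProductExpansion (μ ν : YoungDiagram) (c : YoungDiagram →₀ ℤ) : Prop :=
  ∀ m : ℕ, schur ℤ m μ * schur ℤ m ν = c.sum fun κ a => a • schur ℤ m κ

open Classical in
/-- The Littlewood–Richardson coefficient `c_{μν}^κ`. -/
def lrCoeff (μ ν κ : YoungDiagram) : ℤ :=
  if h : ∃ c, IsSchurProductExpansion μ ν c then h.choose κ else 0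

/-! ### Charge -/

/-- The position at which the letter `a` is marked in `w`, when the position `p` was marked before:
the first occurrence of `a` when reading from `p` to the left, wrapping around to the right end of
`w` if there is none. -/
def markNext (w : List ℕ) (a p : ℕ) : ℕ :=
  let occ := (Finset.range w.length).filter fun i => w[i]? = some a
  let left := occ.filter fun i => i < p
  if left.Nonempty then left.sup id else occ.sup id

/-- The position of the letter `a` in the first standard subword of `w`. The marking starts
at the right end of `w`. -/
def markPos (w : List ℕ) : ℕ → ℕ
  | 0 => markNext w 0 w.length
  | a + 1 => markNext w (a + 1) (markPos w a)

/-- The charge of a permutation of `k` letters given by the positions of the letters, that is, by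
its inverse: `k - i` is added for all `1 ≤ i < k` such that `i + 1` stands to the right of `i`.
The letter written `i` here is the `(i + 1)`-st one. -/
def permCharge (k : ℕ) (pos : ℕ → ℕ) : ℕ :=
  ∑ i ∈ (Finset.range (k - 1)).filter (fun i => pos i < pos (i + 1)), (k - (i + 1))

/-- The length of the first standard subword: the number of distinct letters of `w`. -/
def subwordLength (w : List ℕ) : ℕ := w.toFinset.card

/-- The word `w` with its first standard subword removed. -/
def removeSubword (w : List ℕ) : List ℕ :=
  (w.zipIdx.filter fun p => ∀ a < subwordLength w, p.2 ≠ markPos w a).map Prod.fst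

/-- The sum of the charges of the first `n` standard subwords of `w`. -/
def chargeAux : ℕ → List ℕ → ℕ
  | 0, _ => 0
  | n + 1, w => permCharge (subwordLength w) (markPos w) + chargeAux n (removeSubword w)

/-- The charge of a word with partition content: the sum of the charges of its standard subwords,
each of which contains the first letter of the alphabet exactly once. -/
def charge (w : List ℕ) : ℕ := chargeAux (w.count 0) w

/-- The word `ℓ^{μ_ℓ} ⋯ 2^{μ_2} 1^{μ_1}`. -/
def postfixWord (μ : YoungDiagram) : List ℕ :=
  (List.range (μ.colLen 0)).reverse.flatMap fun i => List.replicate (μ.rowLen i) i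

/-- The postfix charge `charge_μ(w)`. -/
def postfixCharge (μ : YoungDiagram) (w : List ℕ) : ℕ := charge (w ++ postfixWord μ)

/-- The reading word: rows from bottom to top, each from left to right. -/
def readingWord {ν : YoungDiagram} (T : SemistandardYoungTableau ν) : List ℕ :=
  (List.range (ν.colLen 0)).reverse.flatMap fun i => (List.range (ν.rowLen i)).map fun j => T i j

/-! ### The polynomials `K^ν_{λ/μ}(q)` -/

/-- The weak composition `α_j = λ'_j - μ'_j` (used for `μ ≤ lam`). -/
def skewCols (lam μ : YoungDiagram) (j : ℕ) : ℕ := lam.colLen j - μ.colLen j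

/-- `K^ν_{λ/μ}(q) = ∑_{T ∈ SSYT(ν, α)} q^{charge_{μ'}(T)}`. -/
def skewK (lam μ ν : YoungDiagram) : ℤ[X] :=
  ∑ T ∈ ssyt ν (skewCols lam μ), X ^ postfixCharge μ.transpose (readingWord T)

/-! ### The specialized Macdonald polynomials `E_λ(x; q, 0)` -/

/-- The entries `a`, `b`, `c` of a triple (`a` just left of `b`, and `c` below `b`) increase in
counter-clockwise orientation, i.e. `a < c < b` up to cyclic rotation, where equal entries are
compared by the subscripts in `a_3, b_1, c_2`. -/
def IsInversionTriple (a b c : ℕ) : Prop := (a < c ∧ c < b) ∨ (c < b ∧ b ≤ a) ∨ (b ≤ a ∧ a < c)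

/-- A coinversion-free filling: every triple is an inversion triple and the first column is
strictly decreasing from top to bottom. -/
def IsCOF {lam : YoungDiagram} {m : ℕ} (F : lam.cells → Fin m) : Prop :=
  (∀ a b c : lam.cells, a.1.1 = b.1.1 → a.1.2 + 1 = b.1.2 → c.1.2 = b.1.2 → b.1.1 < c.1.1 →
    IsInversionTriple (F a) (F b) (F c)) ∧
  (∀ a c : lam.cells, a.1.2 = 0 → c.1.2 = 0 → a.1.1 < c.1.1 → F c < F a)

/-- The box `b` is a descent: the box just left of `b` exists and has a smaller entry. -/
def IsDescent {lam : YoungDiagram} {m : ℕ} (F : lam.cells → Fin m) (b : lam.cells) : Prop :=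
  ∃ a : lam.cells, a.1.1 = b.1.1 ∧ a.1.2 + 1 = b.1.2 ∧ F a < F b

/-- The number of boxes strictly to the right of `b`. -/
def leg {lam : YoungDiagram} (b : lam.cells) : ℕ := lam.rowLen b.1.1 - (b.1.2 + 1)

open Classical in
/-- The major index. -/
def maj {lam : YoungDiagram} {m : ℕ} (F : lam.cells → Fin m) : ℕ :=
  ∑ b ∈ Finset.univ.filter (IsDescent F), (leg b + 1)

open Classical in
/-- `E_λ(x_1, …, x_m; q, 0) = ∑_{F ∈ COF(λ, m)} q^{maj F} x^F`. -/
def macdonaldE (m : ℕ) (lam : YoungDiagram) : MvPolynomial (Fin m) ℤ[X] :=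
  ∑ F ∈ Finset.univ.filter (fun F : lam.cells → Fin m => IsCOF F),
    MvPolynomial.C (X ^ maj F) * ∏ b : lam.cells, MvPolynomial.X (F b)

/-! ### The skew shape of the product -/

theorem kappa_sortedGE (lam μ : YoungDiagram) :
    (lam.rowLens.map (fun x => μ.rowLen 0 + x) ++ μ.rowLens).SortedGE := by
  have h1 := (YoungDiagram.rowLens_sorted lam).pairwise
  have h2 := (YoungDiagram.rowLens_sorted μ).pairwise
  refine List.Pairwise.sortedGE (List.pairwise_append.mpr ⟨?_, h2, ?_⟩)
  · exact List.pairwise_map.mpr (h1.imp fun h => by omega)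
  · intro a ha b hb
    obtain ⟨x, _, rfl⟩ := List.mem_map.mp ha
    obtain ⟨i, _, rfl⟩ := List.mem_map.mp hb
    have := μ.rowLen_anti 0 i (Nat.zero_le i)
    omega

/-- `κ = (c + λ_1, …, c + λ_{ℓ(λ)}, μ_1, …, μ_{ℓ(μ)})` with `c = μ_1`. -/
def kappa (lam μ : YoungDiagram) : YoungDiagram :=
  YoungDiagram.ofRowLens (lam.rowLens.map (fun x => μ.rowLen 0 + x) ++ μ.rowLens)
    (kappa_sortedGE lam μ)

/-- The rectangle `c^r` with `r` rows of length `c`. -/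
def rect (c r : ℕ) : YoungDiagram :=
  YoungDiagram.ofRowLens (List.replicate r c)
    (List.Pairwise.sortedGE (List.pairwise_replicate.mpr (Or.inr le_rfl)))

theorem rect_le_kappa (lam μ : YoungDiagram) :
    rect (μ.rowLen 0) (lam.colLen 0) ≤ kappa lam μ := by
  rintro ⟨i, j⟩ h
  obtain ⟨h1, h2⟩ := YoungDiagram.mem_ofRowLens.mp h
  simp only [List.length_replicate] at h1
  simp only [List.getElem_replicate] at h2
  refine YoungDiagram.mem_ofRowLens.mpr ⟨?_, ?_⟩
  · simp only [List.length_append, List.length_map, YoungDiagram.length_rowLens]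
    omega
  · have h3 : i < (lam.rowLens.map (fun x => μ.rowLen 0 + x)).length := by
      simpa only [List.length_map, YoungDiagram.length_rowLens] using h1
    simp only [List.getElem_append_left h3, List.getElem_map]
    omega

theorem finite_card_eq (n : ℕ) : {ν : YoungDiagram | ν.card = n}.Finite := by
  refine Set.Finite.of_finite_image (f := YoungDiagram.cells) ?_ ?_
  · refine ((Finset.range n ×ˢ Finset.range n).powerset.finite_toSet).subset ?_
    rintro _ ⟨ν, hν, rfl⟩
    simp only [Set.mem_ofPred_eq] at hν
    simp only [Finset.coe_powerset, Set.mem_preimage, Set.mem_powerset_iff, Finset.coe_subset]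
    rintro ⟨i, j⟩ h
    rw [YoungDiagram.mem_cells] at h
    have h1 := YoungDiagram.mem_iff_lt_rowLen.mp h
    have h2 := YoungDiagram.mem_iff_lt_colLen.mp h
    rw [YoungDiagram.rowLen_eq_card] at h1
    rw [YoungDiagram.colLen_eq_card] at h2
    have h3 : (ν.row i).card ≤ ν.card := Finset.card_le_card (Finset.filter_subset _ _)
    have h4 : (ν.col j).card ≤ ν.card := Finset.card_le_card (Finset.filter_subset _ _)
    simp only [Finset.mem_product, Finset.mem_range]
    omega
  · intro ν _ ν' _ h
    exact YoungDiagram.ext h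

/-- The partitions of `n`. -/
def partitionsOf (n : ℕ) : Finset YoungDiagram := (finite_card_eq n).toFinset

end LRCharge

end

noncomputable section

namespace LRCharge

open Polynomial

section

/-! ### Block words and chains -/

/-! All objects are encoded as block words: lists of finite sets of letters, taken up to crystal
raising moves between neighbouring blocks and deletion of empty blocks (`BlockEquiv`). A word is a
block word of singletons, a tableau is the list of its columns, and a coinversion-free filling is
the list that records, for each entry, the columns in which it occurs. A tableau and its reading
word are equivalent (`colList_equiv_readingWord`).

Charge is an invariant of this equivalence. Consider families of disjoint paths on a circle which go
from letters `0` to letters `1`, and so on up to letters `t`, always moving weakly left, with one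
path for each letter `t`. Their existence with at most `w` windings is a system of inequalities on
suffix counts of a sub-block word (`HasChain`), and this system survives each raising move in both
directions (`HasChain.raise`, `HasChain.of_raise`). Hence the minimal number of windings, summed
over `t`, is invariant (`BlockEquiv.chargeSum_eq`). The minimum is reached by the greedy choice of
paths (`greedy_tight`, `RowSystem.hasChain_iff`). Standard subwords of a word and rows of a
coinversion-free filling are both greedy choices, so the same quantity is the charge of a word
(`charge_eq_chargeSum`) and, for two fillings placed in front of the word of a rectangle, the sum of
their major indices (`chargeSum_join`).

Invariants have Schur expansions. If `G` is invariant, the sum of `G(B) x^B` over all families `B`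
of blocks with given letter multiplicities is symmetric, by crystal reflections. After
multiplication by the Vandermonde alternant, Stembridge's sign-reversing involution `cancel` leaves
only the families that are the columns of a semistandard tableau. With the bialternant formula
`alt_mul_schur` this gives `genFun_eq_sum_schur`. Taking `G` to be `q` to the charge of the block
word followed by the rectangle word proves (c), since coinversion-free fillings correspond
bijectively to families of blocks (`sum_isCOF`). Taking `G` to be the indicator of two lattice
conditions expands a product of Schur polynomials, and so counts Littlewood–Richardson coefficients
by tableaux (`schur_mul_schur`, `lrCoeff_eq`).

For (a), only tableaux of charge zero survive at `q = 0`; no winding means that the word is a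
lattice word (`chargeSum_eq_zero_iff`), and companion tableaux match these with the tableaux counted
before. For (b), every tableau contributes `1` at `q = 1`. -/

theorem suffix_append_iff' {α : Type*} {D A B : List α} :
    D <:+ A ++ B ↔ D <:+ B ∨ ∃ A', A' <:+ A ∧ D = A' ++ B := by
  induction A with
  | nil =>
    simp only [List.nil_append, List.suffix_nil, exists_eq_left, iff_self_or]
    rintro rfl; exact List.suffix_rfl
  | cons a A ih =>
    rw [List.cons_append, List.suffix_cons_iff, ih]
    constructor
    · rintro (h | h | ⟨A', h, rfl⟩)
      · exact Or.inr ⟨a :: A, List.suffix_rfl, h⟩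
      · exact Or.inl h
      · exact Or.inr ⟨A', h.trans (List.suffix_cons _ _), rfl⟩
    · rintro (h | ⟨A', h, rfl⟩)
      · exact Or.inr (Or.inl h)
      · rcases List.suffix_cons_iff.mp h with rfl | h
        · exact Or.inl rfl
        · exact Or.inr (Or.inr ⟨A', h, rfl⟩)

/-- The number of blocks of `L` which contain the letter `j`. -/
def cnt (L : List (Finset ℕ)) (j : ℕ) : ℕ := L.countP fun b => j ∈ b

@[simp] theorem cnt_nil (j : ℕ) : cnt [] j = 0 := rfl

@[simp] theorem cnt_cons (b : Finset ℕ) (L : List (Finset ℕ)) (j : ℕ) :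
    cnt (b :: L) j = (if j ∈ b then 1 else 0) + cnt L j := by
  unfold cnt
  rw [List.countP_cons]
  simp [add_comm]

@[simp] theorem cnt_append (A B : List (Finset ℕ)) (j : ℕ) :
    cnt (A ++ B) j = cnt A j + cnt B j := by
  unfold cnt
  rw [List.countP_append]

/-- `D`, with `d j` windings up to the level `j`, moves weakly to the left from each level in
`[s, t)` to the next one. -/
def IsChain (s t : ℕ) (d : ℕ → ℤ) (D : List (Finset ℕ)) : Prop :=
  ∀ D2, D2 <:+ D → ∀ j, s ≤ j → j < t → (cnt D2 (j + 1) : ℤ) - d (j + 1) ≤ cnt D2 j - d j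

/-- There are `n` disjoint lattice paths through the levels `s, …, t` of the block word `L` with at
most `w` windings. -/
def HasChain (L : List (Finset ℕ)) (s t n : ℕ) (w : ℤ) : Prop :=
  ∃ (D : List (Finset ℕ)) (d : ℕ → ℤ), List.Forall₂ (· ⊆ ·) D L ∧ d s = 0 ∧ d t ≤ w ∧
    (∀ j, s ≤ j → j ≤ t → cnt D j = n) ∧ IsChain s t d D

/-- A suffix which contains both modified blocks, or neither, keeps its counts. Only the suffix that
starts at the second of them has to be checked again. -/
theorem IsChain.replace {s t : ℕ} {d : ℕ → ℤ} {A Z : List (Finset ℕ)} {P Q P' Q' : Finset ℕ}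
    (h : IsChain s t d (A ++ P :: Q :: Z))
    (hc : ∀ j, cnt [P', Q'] j = cnt [P, Q] j)
    (hm : ∀ j, s ≤ j → j < t →
      (cnt (Q' :: Z) (j + 1) : ℤ) - d (j + 1) ≤ cnt (Q' :: Z) j - d j) :
    IsChain s t d (A ++ P' :: Q' :: Z) := by
  have hc' : ∀ j, cnt (P' :: Q' :: Z) j = cnt (P :: Q :: Z) j := by
    intro j; have := hc j; simp only [cnt_cons, cnt_nil] at this ⊢; omega
  intro D2 hD j hs ht
  rcases suffix_append_iff'.mp hD with hD | ⟨A', hA, rfl⟩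
  · rcases List.suffix_cons_iff.mp hD with rfl | hD
    · rw [hc', hc']
      exact h _ (List.suffix_append _ _) j hs ht
    · rcases List.suffix_cons_iff.mp hD with rfl | hD
      · exact hm j hs ht
      · exact h _ (hD.trans (((List.suffix_cons _ _).trans (List.suffix_cons _ _)).trans
          (List.suffix_append _ _))) j hs ht
  · have := h (A' ++ P :: Q :: Z) (suffix_append_iff'.mpr (Or.inr ⟨A', hA, rfl⟩)) j hs ht
    rw [cnt_append, cnt_append, hc', hc']
    rw [cnt_append, cnt_append] at this
    exact this

/-- The letter `k` of the block `V` can be moved to the block `U` on its left: it is the last letter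
of `V` which is not bracketed with a smaller letter of `U`. -/
structure CanRaise (U V : Finset ℕ) (k : ℕ) : Prop where
  mem : k ∈ V
  notMem : k ∉ U
  left : ∀ i ≤ k, (U ∩ Finset.Icc i k).card < (V ∩ Finset.Icc i k).card
  right : ∀ j, k < j → (V ∩ Finset.Ioc k j).card ≤ (U ∩ Finset.Ioc k j).card

/-- If `V` fills the whole interval above `k`, the inequality `right` leaves `U` no choice but to
fill it too. So a sub-block word can shift an entire run of letters starting at `k` from `V` to the
enlarged `U`. -/
theorem CanRaise.mem_of_gt {U V : Finset ℕ} {k j : ℕ} (h : CanRaise U V k) (hj : k < j)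
    (hV : ∀ i, k < i → i ≤ j → i ∈ V) : j ∈ U := by
  have h1 : V ∩ Finset.Ioc k j = Finset.Ioc k j :=
    Finset.inter_eq_right.mpr fun i hi => hV i (Finset.mem_Ioc.mp hi).1 (Finset.mem_Ioc.mp hi).2
  have h2 := h.right j hj
  rw [h1] at h2
  have h3 := Finset.eq_of_subset_of_card_le Finset.inter_subset_right h2
  exact (Finset.mem_inter.mp (h3 ▸ Finset.mem_Ioc.mpr ⟨hj, le_rfl⟩)).1

/-- The mirror image of `CanRaise.mem_of_gt`, used to shift a run of letters ending at `k` back from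
left to right. -/
theorem CanRaise.mem_of_lt {U V : Finset ℕ} {k j : ℕ} (h : CanRaise U V k) (hj : j < k)
    (hU : ∀ i, j ≤ i → i < k → i ∈ U) : j ∈ V := by
  have h1 : Finset.Icc j k \ {k} ⊆ U ∩ Finset.Icc j k := by
    intro i hi
    simp only [Finset.mem_sdiff, Finset.mem_Icc, Finset.mem_singleton] at hi
    exact Finset.mem_inter.mpr ⟨hU i hi.1.1 (by omega), Finset.mem_Icc.mpr hi.1⟩
  have h2 := h.left j hj.le
  have h3 := Finset.card_le_card h1
  rw [Finset.card_sdiff_of_subset (by simp [hj.le])] at h3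
  rw [Finset.card_singleton] at h3
  have h4 := Finset.eq_of_subset_of_card_le (s := V ∩ Finset.Icc j k) (t := Finset.Icc j k)
    Finset.inter_subset_right (by omega)
  exact (Finset.mem_inter.mp (h4 ▸ Finset.mem_Icc.mpr ⟨le_rfl, hj.le⟩)).1

/-- Elementary transformations of block words. -/
inductive BlockStep : List (Finset ℕ) → List (Finset ℕ) → Prop
  | raise (A Z : List (Finset ℕ)) (U V : Finset ℕ) (k : ℕ) (h : CanRaise U V k) :
      BlockStep (A ++ U :: V :: Z) (A ++ insert k U :: V.erase k :: Z)
  | dropEmpty (A Z : List (Finset ℕ)) : BlockStep (A ++ ∅ :: Z) (A ++ Z)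

/-! ### Invariance of chains under the elementary transformations -/

theorem forall₂_subset_append_cons_cons {D A Z : List (Finset ℕ)} {U V : Finset ℕ}
    (h : List.Forall₂ (· ⊆ ·) D (A ++ U :: V :: Z)) :
    ∃ A' P Q Z', D = A' ++ P :: Q :: Z' ∧ List.Forall₂ (· ⊆ ·) A' A ∧ P ⊆ U ∧ Q ⊆ V ∧
      List.Forall₂ (· ⊆ ·) Z' Z := by
  have h1 := List.forall₂_take_append _ _ _ h
  have h2 := List.forall₂_drop_append _ _ _ h
  rw [← List.take_append_drop A.length D]
  generalize List.drop A.length D = E at h2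
  cases h2 with
  | cons hP h2 =>
    cases h2 with
    | cons hQ h2 => exact ⟨_, _, _, _, rfl, h1, hP, hQ, h2⟩

/-- If the chain does not use the moved letter `k` of `V`, it survives unchanged. Otherwise moving
`k` alone could break the inequality between the levels `k` and `k + 1`, so the chain moves with `k`
the longest run of consecutive higher levels for which that inequality would be violated in turn. -/
theorem HasChain.raise {A Z : List (Finset ℕ)} {U V : Finset ℕ} {k : ℕ} (hk : CanRaise U V k)
    {s t n : ℕ} {w : ℤ} (h : HasChain (A ++ U :: V :: Z) s t n w) :
    HasChain (A ++ insert k U :: V.erase k :: Z) s t n w := by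
  classical
  obtain ⟨D, d, hD, h0, hw, hn, hch⟩ := h
  obtain ⟨A', P, Q, Z', rfl, hA, hP, hQ, hZ⟩ := forall₂_subset_append_cons_cons hD
  by_cases hkQ : k ∈ Q
  swap
  · refine ⟨A' ++ P :: Q :: Z', d, List.rel_append hA (List.Forall₂.cons ?_
      (List.Forall₂.cons ?_ hZ)), h0, hw, hn, hch⟩
    · exact hP.trans (Finset.subset_insert _ _)
    · exact Finset.subset_erase.mpr ⟨hQ, hkQ⟩
  set R : ℕ → ℤ := fun j => cnt Z' j - d j with hR
  -- The levels that are dragged along: they are used on the right but not on the left, and are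
  -- tight with the level `k` on the suffix `Z'`.
  set K : Finset ℕ := Q.filter fun j => k ≤ j ∧
    ∀ i, k < i → i ≤ j → i ∈ Q ∧ i ∉ P ∧ R i = R k with hKdef
  have hK : ∀ j, j ∈ K ↔ j ∈ Q ∧ k ≤ j ∧ ∀ i, k < i → i ≤ j → i ∈ Q ∧ i ∉ P ∧ R i = R k := by
    intro j; rw [hKdef, Finset.mem_filter]
  have hkK : k ∈ K := (hK k).mpr ⟨hkQ, le_rfl, fun i h1 h2 => by omega⟩
  have hKP : ∀ j ∈ K, j ∉ P := by
    intro j hj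
    obtain ⟨h1, h2, h3⟩ := (hK j).mp hj
    rcases h2.eq_or_lt with rfl | h2
    · exact fun h => hk.notMem (hP h)
    · exact (h3 j h2 le_rfl).2.1
  have hKR : ∀ j ∈ K, R j = R k := by
    intro j hj
    obtain ⟨h1, h2, h3⟩ := (hK j).mp hj
    rcases h2.eq_or_lt with rfl | h2
    · rfl
    · exact (h3 j h2 le_rfl).2.2
  have hKQ : K ⊆ Q := Finset.filter_subset _ _
  have hKU : K ⊆ insert k U := by
    intro j hj
    obtain ⟨h1, h2, h3⟩ := (hK j).mp hj
    rcases h2.eq_or_lt with rfl | h2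
    · exact Finset.mem_insert_self _ _
    · exact Finset.mem_insert_of_mem
        (hk.mem_of_gt h2 fun i hi1 hi2 => hQ (h3 i hi1 hi2).1)
  have hcnt : ∀ j, cnt [P ∪ K, Q \ K] j = cnt [P, Q] j := by
    intro j
    simp only [cnt_cons, cnt_nil, Finset.mem_union, Finset.mem_sdiff]
    by_cases hj : j ∈ K
    · simp [hj, hKQ hj, hKP j hj]
    · simp [hj]
  refine ⟨A' ++ (P ∪ K) :: (Q \ K) :: Z', d, List.rel_append hA (List.Forall₂.cons ?_
      (List.Forall₂.cons ?_ hZ)), h0, hw, ?_, hch.replace hcnt ?_⟩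
  · exact Finset.union_subset (hP.trans (Finset.subset_insert _ _)) hKU
  · intro j hj
    obtain ⟨h1, h2⟩ := Finset.mem_sdiff.mp hj
    exact Finset.mem_erase.mpr ⟨fun h => h2 (h ▸ hkK), hQ h1⟩
  · intro j h1 h2
    rw [← hn j h1 h2]
    have := hcnt j
    simp only [cnt_append, cnt_cons, cnt_nil] at this ⊢
    omega
  · intro j h1 h2
    have e1 := hch Z' (((List.suffix_cons _ _).trans (List.suffix_cons _ _)).trans
      (List.suffix_append _ _)) j h1 h2
    have e2 := hch (Q :: Z') ((List.suffix_cons _ _).trans (List.suffix_append _ _)) j h1 h2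
    have e3 := hch (P :: Q :: Z') (List.suffix_append _ _) j h1 h2
    simp only [cnt_cons, Finset.mem_sdiff] at e1 e2 e3 ⊢
    by_cases hj : j ∈ K
    · have r1 := hKR j hj
      by_cases hj' : j + 1 ∈ K
      · simp only [hj, hj', hKQ hj, hKQ hj', hKP j hj, hKP _ hj', not_true, and_false, if_true,
          if_false] at e2 e3 ⊢
        push_cast at e2 e3 ⊢
        omega
      · have hP1 := hKP j hj
        have hQ1 := hKQ hj
        -- The run stops at `j` for one of three reasons: `j + 1` is not in `Q`, or it is also in
        -- `P`, or the suffix `Z'` has slack. Each of them yields the inequality after `j` has been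
        -- moved away.
        have : ¬ (j + 1 ∈ Q ∧ j + 1 ∉ P ∧ R (j + 1) = R k) := by
          intro hh
          obtain ⟨g1, g2, g3⟩ := (hK j).mp hj
          refine hj' ((hK _).mpr ⟨hh.1, by omega, fun i hi1 hi2 => ?_⟩)
          rcases hi2.eq_or_lt with rfl | hi2
          · exact hh
          · exact g3 i hi1 (by omega)
        simp only [hR] at this r1
        by_cases q1 : j + 1 ∈ Q
        · by_cases p1 : j + 1 ∈ P
          · simp only [hj, hj', q1, p1, hP1, hQ1, not_true, not_false_eq_true, and_false, and_true,
              if_true, if_false] at e2 e3 ⊢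
            push_cast at e2 e3 ⊢
            omega
          · simp only [q1, p1, not_false_eq_true, true_and] at this
            simp only [hj, hj', q1, p1, hP1, hQ1, not_true, not_false_eq_true, and_false, and_true,
              if_true, if_false] at e2 e3 ⊢
            push_cast at e2 e3 ⊢
            omega
        · simp only [hj, hj', q1, hP1, hQ1, not_true, not_false_eq_true, and_false, and_true,
              if_true, if_false] at e2 e3 ⊢
          push_cast at e2 e3 ⊢
          omega
    · by_cases hj' : j + 1 ∈ K
      · simp only [hj, hj', hKQ hj', not_true, not_false_eq_true, and_false, and_true,
              if_true, if_false] at e2 e3 ⊢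
        push_cast at e2 e3 ⊢
        omega
      · simpa only [hj, hj', not_false_eq_true, and_true] using e2

/-- The same argument in the opposite direction: the returning letter `k` takes with it a run of
consecutive lower levels, and `CanRaise.mem_of_lt` guarantees that these levels are available in
`V`. -/
theorem HasChain.of_raise {A Z : List (Finset ℕ)} {U V : Finset ℕ} {k : ℕ} (hk : CanRaise U V k)
    {s t n : ℕ} {w : ℤ} (h : HasChain (A ++ insert k U :: V.erase k :: Z) s t n w) :
    HasChain (A ++ U :: V :: Z) s t n w := by
  classical
  obtain ⟨D, d, hD, h0, hw, hn, hch⟩ := h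
  obtain ⟨A', P, Q, Z', rfl, hA, hP, hQ, hZ⟩ := forall₂_subset_append_cons_cons hD
  have hQ' : Q ⊆ V := hQ.trans (Finset.erase_subset _ _)
  have hkQ : k ∉ Q := fun h => Finset.notMem_erase k V (hQ h)
  by_cases hkP : k ∈ P
  swap
  · refine ⟨A' ++ P :: Q :: Z', d, List.rel_append hA (List.Forall₂.cons ?_
      (List.Forall₂.cons hQ' hZ)), h0, hw, hn, hch⟩
    exact (Finset.subset_insert_iff_of_notMem hkP).mp hP
  set R : ℕ → ℤ := fun j => cnt Z' j - d j with hR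
  -- The run now ends at `k`; a lower level has to follow exactly while it is tight with the level
  -- `k` on `Z'`.
  set K : Finset ℕ := P.filter fun j => j ≤ k ∧
    ∀ i, j ≤ i → i < k → i ∈ P ∧ i ∉ Q ∧ R i = R k with hKdef
  have hK : ∀ j, j ∈ K ↔ j ∈ P ∧ j ≤ k ∧ ∀ i, j ≤ i → i < k → i ∈ P ∧ i ∉ Q ∧ R i = R k := by
    intro j; rw [hKdef, Finset.mem_filter]
  have hkK : k ∈ K := (hK k).mpr ⟨hkP, le_rfl, fun i h1 h2 => by omega⟩
  have hKQ : ∀ j ∈ K, j ∉ Q := by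
    intro j hj
    obtain ⟨h1, h2, h3⟩ := (hK j).mp hj
    rcases h2.eq_or_lt with rfl | h2
    · exact hkQ
    · exact (h3 j le_rfl h2).2.1
  have hKR : ∀ j ∈ K, R j = R k := by
    intro j hj
    obtain ⟨h1, h2, h3⟩ := (hK j).mp hj
    rcases h2.eq_or_lt with rfl | h2
    · rfl
    · exact (h3 j le_rfl h2).2.2
  have hKP : K ⊆ P := Finset.filter_subset _ _
  have hKV : K ⊆ V := by
    intro j hj
    obtain ⟨h1, h2, h3⟩ := (hK j).mp hj
    rcases h2.eq_or_lt with rfl | h2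
    · exact hk.mem
    · refine hk.mem_of_lt h2 fun i hi1 hi2 => ?_
      exact (Finset.mem_insert.mp (hP (h3 i hi1 hi2).1)).resolve_left (by omega)
  have hcnt : ∀ j, cnt [P \ K, Q ∪ K] j = cnt [P, Q] j := by
    intro j
    simp only [cnt_cons, cnt_nil, Finset.mem_union, Finset.mem_sdiff]
    by_cases hj : j ∈ K
    · simp [hj, hKQ j hj, hKP hj]
    · simp [hj]
  refine ⟨A' ++ (P \ K) :: (Q ∪ K) :: Z', d, List.rel_append hA (List.Forall₂.cons ?_
      (List.Forall₂.cons (Finset.union_subset hQ' hKV) hZ)), h0, hw, ?_, hch.replace hcnt ?_⟩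
  · intro j hj
    obtain ⟨h1, h2⟩ := Finset.mem_sdiff.mp hj
    exact (Finset.mem_insert.mp (hP h1)).resolve_left fun h => h2 (h ▸ hkK)
  · intro j h1 h2
    rw [← hn j h1 h2]
    have := hcnt j
    simp only [cnt_append, cnt_cons, cnt_nil] at this ⊢
    omega
  · intro j h1 h2
    have e1 := hch Z' (((List.suffix_cons _ _).trans (List.suffix_cons _ _)).trans
      (List.suffix_append _ _)) j h1 h2
    have e2 := hch (Q :: Z') ((List.suffix_cons _ _).trans (List.suffix_append _ _)) j h1 h2
    have e3 := hch (P :: Q :: Z') (List.suffix_append _ _) j h1 h2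
    simp only [cnt_cons, Finset.mem_union] at e1 e2 e3 ⊢
    by_cases hj' : j + 1 ∈ K
    · have r1 := hKR _ hj'
      have q1 := hKQ _ hj'
      have p1 := hKP hj'
      by_cases hj : j ∈ K
      · simp only [hj, hj', q1, hKQ j hj, or_true, if_true, if_false] at e2 e3 ⊢
        push_cast at e2 e3 ⊢
        omega
      · have : ¬ (j ∈ P ∧ j ∉ Q ∧ R j = R k) := by
          intro hh
          obtain ⟨g1, g2, g3⟩ := (hK _).mp hj'
          refine hj ((hK _).mpr ⟨hh.1, by omega, fun i hi1 hi2 => ?_⟩)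
          rcases hi1.eq_or_lt with rfl | hi1
          · exact hh
          · exact g3 i (by omega) hi2
        simp only [hR] at this r1
        by_cases q2 : j ∈ Q
        · simp only [hj, hj', q1, q2, p1, or_true, or_false, if_true, if_false] at e2 e3 ⊢
          push_cast at e2 e3 ⊢
          omega
        · by_cases p2 : j ∈ P
          · simp only [p2, q2, not_false_eq_true, true_and] at this
            simp only [hj, hj', q1, q2, p1, p2, or_true, or_false, if_true, if_false] at e2 e3 ⊢
            push_cast at e2 e3 ⊢
            omega
          · simp only [hj, hj', q1, q2, p1, p2, or_true, or_false, if_true, if_false] at e2 e3 ⊢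
            push_cast at e2 e3 ⊢
            omega
    · by_cases hj : j ∈ K
      · simp only [hj, hj', hKQ j hj, or_true, or_false, if_true, if_false] at e2 e3 ⊢
        push_cast at e2 e3 ⊢
        omega
      · simpa only [hj, hj', or_false] using e2

theorem hasChain_append_empty_cons {A Z : List (Finset ℕ)} {s t n : ℕ} {w : ℤ} :
    HasChain (A ++ ∅ :: Z) s t n w ↔ HasChain (A ++ Z) s t n w := by
  have hcnt : ∀ X Y : List (Finset ℕ), ∀ j, cnt (X ++ ∅ :: Y) j = cnt (X ++ Y) j := by
    intro X Y j; simp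
  constructor
  · rintro ⟨D, d, hD, h0, hw, hn, hch⟩
    have h1 := List.forall₂_take_append _ _ _ hD
    have h2 := List.forall₂_drop_append _ _ _ hD
    rw [← List.take_append_drop A.length D] at hn hch
    generalize List.drop A.length D = E at h2 hn hch
    cases h2 with
    | @cons a b l₁ l₂ hP h2 =>
      obtain rfl : a = ∅ := Finset.subset_empty.mp hP
      refine ⟨_, d, List.rel_append h1 h2, h0, hw, fun j i1 i2 => ?_, fun D2 hD2 j i1 i2 => ?_⟩
      · rw [← hn j i1 i2, hcnt]
      · rcases suffix_append_iff'.mp hD2 with hD2 | ⟨A', hA, rfl⟩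
        · exact hch D2 (hD2.trans ((List.suffix_cons _ _).trans (List.suffix_append _ _))) j i1 i2
        · have := hch _ (suffix_append_iff'.mpr (Or.inr ⟨A', hA, rfl⟩)) j i1 i2
          rwa [hcnt, hcnt] at this
  · rintro ⟨D, d, hD, h0, hw, hn, hch⟩
    have h1 := List.forall₂_take_append _ _ _ hD
    have h2 := List.forall₂_drop_append _ _ _ hD
    rw [← List.take_append_drop A.length D] at hn hch
    refine ⟨_, d, List.rel_append h1 (List.Forall₂.cons (Finset.Subset.refl ∅) h2), h0, hw,
      fun j i1 i2 => ?_, fun D2 hD2 j i1 i2 => ?_⟩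
    · rw [← hn j i1 i2, hcnt]
    · rcases suffix_append_iff'.mp hD2 with hD2 | ⟨A', hA, rfl⟩
      · rcases List.suffix_cons_iff.mp hD2 with rfl | hD2
        · have := hch _ (List.suffix_append _ _) j i1 i2
          simpa using this
        · exact hch D2 (hD2.trans (List.suffix_append _ _)) j i1 i2
      · have := hch _ (suffix_append_iff'.mpr (Or.inr ⟨A', hA, rfl⟩)) j i1 i2
        rwa [hcnt, hcnt]

/-- Equivalence of block words. -/
def BlockEquiv : List (Finset ℕ) → List (Finset ℕ) → Prop := Relation.EqvGen BlockStep

theorem BlockStep.hasChain_iff {L L' : List (Finset ℕ)} (h : BlockStep L L') {s t n : ℕ} {w : ℤ} :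
    HasChain L s t n w ↔ HasChain L' s t n w := by
  cases h with
  | raise A Z U V k h => exact ⟨HasChain.raise h, HasChain.of_raise h⟩
  | dropEmpty A Z => exact hasChain_append_empty_cons

theorem BlockStep.cnt_eq {L L' : List (Finset ℕ)} (h : BlockStep L L') (j : ℕ) :
    cnt L j = cnt L' j := by
  cases h with
  | raise A Z U V k h =>
    have h1 := h.mem
    have h2 := h.notMem
    simp only [cnt_append, cnt_cons, Finset.mem_insert, Finset.mem_erase]
    by_cases hj : j = k
    · subst hj; simp [h1, h2]
    · simp [hj]
  | dropEmpty A Z => simp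

namespace BlockEquiv

theorem of_step {L L' : List (Finset ℕ)} (h : BlockStep L L') : BlockEquiv L L' :=
  Relation.EqvGen.rel _ _ h

theorem refl (L : List (Finset ℕ)) : BlockEquiv L L := Relation.EqvGen.refl _

theorem symm {L L' : List (Finset ℕ)} (h : BlockEquiv L L') : BlockEquiv L' L :=
  Relation.EqvGen.symm _ _ h

theorem trans {L L' L'' : List (Finset ℕ)} (h : BlockEquiv L L') (h' : BlockEquiv L' L'') :
    BlockEquiv L L'' := Relation.EqvGen.trans _ _ _ h h'

theorem lift {p : List (Finset ℕ) → Prop} (hp : ∀ L L', BlockStep L L' → (p L ↔ p L'))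
    {L L' : List (Finset ℕ)} (h : BlockEquiv L L') : p L ↔ p L' := by
  induction h with
  | rel _ _ h => exact hp _ _ h
  | refl => exact Iff.rfl
  | symm _ _ _ ih => exact ih.symm
  | trans _ _ _ _ _ ih1 ih2 => exact ih1.trans ih2

theorem hasChain_iff {L L' : List (Finset ℕ)} (h : BlockEquiv L L') {s t n : ℕ} {w : ℤ} :
    HasChain L s t n w ↔ HasChain L' s t n w :=
  h.lift (p := fun L => HasChain L s t n w) fun _ _ h => h.hasChain_iff

theorem cnt_eq {L L' : List (Finset ℕ)} (h : BlockEquiv L L') (j : ℕ) : cnt L j = cnt L' j := by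
  have := h.lift (p := fun M => cnt L j = cnt M j) fun _ _ h => by rw [h.cnt_eq]
  exact this.mp rfl

theorem append_left (A : List (Finset ℕ)) {L L' : List (Finset ℕ)} (h : BlockEquiv L L') :
    BlockEquiv (A ++ L) (A ++ L') := by
  induction h with
  | rel _ _ h =>
    cases h with
    | raise A' Z U V k h =>
      rw [← List.append_assoc, ← List.append_assoc]
      exact of_step (.raise _ _ _ _ _ h)
    | dropEmpty A' Z =>
      rw [← List.append_assoc, ← List.append_assoc]
      exact of_step (.dropEmpty _ _)
  | refl => exact refl _
  | symm _ _ _ ih => exact ih.symm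
  | trans _ _ _ _ _ ih1 ih2 => exact ih1.trans ih2

theorem append_right (Z : List (Finset ℕ)) {L L' : List (Finset ℕ)} (h : BlockEquiv L L') :
    BlockEquiv (L ++ Z) (L' ++ Z) := by
  induction h with
  | rel _ _ h =>
    cases h with
    | raise A Z' U V k h =>
      rw [List.append_assoc, List.append_assoc]
      exact of_step (.raise _ _ _ _ _ h)
    | dropEmpty A Z' =>
      rw [List.append_assoc, List.append_assoc]
      exact of_step (.dropEmpty _ _)
  | refl => exact refl _
  | symm _ _ _ ih => exact ih.symm
  | trans _ _ _ _ _ ih1 ih2 => exact ih1.trans ih2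

theorem cons (b : Finset ℕ) {L L' : List (Finset ℕ)} (h : BlockEquiv L L') :
    BlockEquiv (b :: L) (b :: L') := h.append_left [b]

end BlockEquiv

/-! ### The lattice condition -/

/-- Every suffix of `L` contains at least as many letters `j` as letters `j + 1`. -/
def LatticeAt (j : ℕ) (L : List (Finset ℕ)) : Prop := ∀ D, D <:+ L → cnt D (j + 1) ≤ cnt D j

/-- Only the suffix starting at the block that receives or loses `k` is in question, and only if `k`
is `j` or `j + 1`. The bracketing then shows that a second letter of the pair occurs in both blocks,
and the inequality for the longer suffix supplies the missing unit. -/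
theorem BlockStep.latticeAt_iff {L L' : List (Finset ℕ)} (h : BlockStep L L') (j : ℕ) :
    LatticeAt j L ↔ LatticeAt j L' := by
  have key : ∀ (A Z : List (Finset ℕ)) (P Q P' Q' : Finset ℕ)
      (_ : ∀ j, cnt [P', Q'] j = cnt [P, Q] j)
      (_ : cnt Z (j + 1) ≤ cnt Z j → cnt (P :: Q :: Z) (j + 1) ≤ cnt (P :: Q :: Z) j →
        cnt (Q :: Z) (j + 1) ≤ cnt (Q :: Z) j →  cnt (Q' :: Z) (j + 1) ≤ cnt (Q' :: Z) j),
      LatticeAt j (A ++ P :: Q :: Z) → LatticeAt j (A ++ P' :: Q' :: Z) := by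
    intro A Z P Q P' Q' hc hm h D hD
    have hc' : ∀ j, cnt (P' :: Q' :: Z) j = cnt (P :: Q :: Z) j := by
      intro j; have := hc j; simp only [cnt_cons, cnt_nil] at this ⊢; omega
    rcases suffix_append_iff'.mp hD with hD | ⟨A', hA, rfl⟩
    · rcases List.suffix_cons_iff.mp hD with rfl | hD
      · rw [hc', hc']
        exact h _ (List.suffix_append _ _)
      · rcases List.suffix_cons_iff.mp hD with rfl | hD
        · exact hm (h _ (((List.suffix_cons _ _).trans (List.suffix_cons _ _)).trans
            (List.suffix_append _ _))) (h _ (List.suffix_append _ _))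
            (h _ ((List.suffix_cons _ _).trans (List.suffix_append _ _)))
        · exact h _ (hD.trans (((List.suffix_cons _ _).trans (List.suffix_cons _ _)).trans
            (List.suffix_append _ _)))
    · have := h (A' ++ P :: Q :: Z) (suffix_append_iff'.mpr (Or.inr ⟨A', hA, rfl⟩))
      rw [cnt_append, cnt_append, hc', hc']
      rw [cnt_append, cnt_append] at this
      exact this
  cases h with
  | dropEmpty A Z =>
    have hcnt : ∀ X Y : List (Finset ℕ), ∀ j, cnt (X ++ ∅ :: Y) j = cnt (X ++ Y) j := by
      intro X Y j; simp
    constructor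
    · intro h D hD
      rcases suffix_append_iff'.mp hD with hD | ⟨A', hA, rfl⟩
      · exact h D (hD.trans ((List.suffix_cons _ _).trans (List.suffix_append _ _)))
      · have := h _ (suffix_append_iff'.mpr (Or.inr ⟨A', hA, rfl⟩))
        rwa [hcnt, hcnt] at this
    · intro h D hD
      rcases suffix_append_iff'.mp hD with hD | ⟨A', hA, rfl⟩
      · rcases List.suffix_cons_iff.mp hD with rfl | hD
        · have := h _ (List.suffix_append _ _)
          simpa using this
        · exact h D (hD.trans (List.suffix_append _ _))
      · have := h _ (suffix_append_iff'.mpr (Or.inr ⟨A', hA, rfl⟩))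
        rwa [hcnt, hcnt]
  | raise A Z U V k h =>
    have h1 := h.mem
    have h2 := h.notMem
    have hc : ∀ j, cnt [insert k U, V.erase k] j = cnt [U, V] j := by
      intro j
      simp only [cnt_cons, cnt_nil, Finset.mem_insert, Finset.mem_erase]
      by_cases hj : j = k
      · subst hj; simp [h1, h2]
      · simp [hj]
    -- This excludes the one dangerous case in which `j` leaves `V` while `j + 1` stays there
    -- without being present in `U`.
    have hr : k = j → (j + 1) ∈ V → (j + 1) ∈ U := by
      rintro rfl hV
      exact h.mem_of_gt (Nat.lt_succ_self _) fun i i1 i2 => (by omega : i = k + 1) ▸ hV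
    have hl : k = j + 1 → j ∈ U → j ∈ V := by
      rintro rfl hU
      exact h.mem_of_lt (Nat.lt_succ_self _) fun i i1 i2 => (by omega : i = j) ▸ hU
    have hkj : k = j ∨ k = j + 1 ∨ (j ≠ k ∧ j + 1 ≠ k) := by omega
    constructor
    · refine key _ _ _ _ _ _ hc fun e1 e2 e3 => ?_
      simp only [cnt_cons, Finset.mem_erase] at e1 e2 e3 ⊢
      rcases hkj with rfl | rfl | ⟨c1, c2⟩
      · simp only [h1, h2, if_true, if_false, ne_eq, not_true, false_and, Nat.succ_ne_self,
          not_false_eq_true, true_and] at e2 e3 ⊢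
        have := hr rfl
        split_ifs at * <;> first | omega | (exfalso; tauto)
      · simp only [h1, h2, if_true, if_false, ne_eq, not_true, false_and] at e2 e3 ⊢
        have : (j ≠ j + 1) := by omega
        simp only [this, not_false_eq_true, true_and]
        omega
      · simpa only [ne_eq, c1, c2, not_false_eq_true, true_and] using e3
    · refine key _ _ _ _ _ _ (fun j => (hc j).symm) fun e1 e2 e3 => ?_
      simp only [cnt_cons, Finset.mem_erase, Finset.mem_insert] at e1 e2 e3 ⊢
      rcases hkj with rfl | rfl | ⟨c1, c2⟩
      · simp only [h1, h2, if_true, if_false, ne_eq, not_true, false_and, Nat.succ_ne_self,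
          not_false_eq_true, true_and] at e2 e3 ⊢
        omega
      · have c : (j ≠ j + 1) := by omega
        simp only [h1, h2, if_true, if_false, ne_eq, not_true, false_and, c,
          not_false_eq_true, true_and, true_or, false_or] at e2 e3 ⊢
        have := hl rfl
        split_ifs at * <;> first | omega | (exfalso; tauto)
      · simpa only [ne_eq, c1, c2, not_false_eq_true, true_and] using e3

theorem BlockEquiv.latticeAt_iff {L L' : List (Finset ℕ)} (h : BlockEquiv L L') (j : ℕ) :
    LatticeAt j L ↔ LatticeAt j L' :=
  h.lift (p := LatticeAt j) fun _ _ h => h.latticeAt_iff j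

/-- The block word in which only the last `n` occurrences of each letter are kept. -/
def trim (n : ℕ) : List (Finset ℕ) → List (Finset ℕ)
  | [] => []
  | b :: L => b.filter (fun j => cnt L j < n) :: trim n L

theorem cnt_trim (n : ℕ) (L : List (Finset ℕ)) (j : ℕ) : cnt (trim n L) j = min n (cnt L j) := by
  induction L with
  | nil => simp [trim]
  | cons b L ih =>
    simp only [trim, cnt_cons, Finset.mem_filter, ih]
    by_cases h1 : j ∈ b <;> by_cases h2 : cnt L j < n <;>
      simp only [h1, h2, and_self, and_true, and_false, if_true, if_false] <;> omega

theorem trim_subset (n : ℕ) (L : List (Finset ℕ)) : List.Forall₂ (· ⊆ ·) (trim n L) L := by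
  induction L with
  | nil => exact List.Forall₂.nil
  | cons b L ih => exact List.Forall₂.cons (Finset.filter_subset _ _) ih

theorem exists_eq_trim_of_suffix {n : ℕ} {L D : List (Finset ℕ)} (h : D <:+ trim n L) :
    ∃ L', L' <:+ L ∧ D = trim n L' := by
  induction L with
  | nil => exact ⟨[], List.suffix_rfl, List.suffix_nil.mp h⟩
  | cons b L ih =>
    rcases List.suffix_cons_iff.mp h with rfl | h
    · exact ⟨b :: L, List.suffix_rfl, rfl⟩
    · obtain ⟨L', h1, h2⟩ := ih h
      exact ⟨L', h1.trans (List.suffix_cons _ _), h2⟩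

/-- Keeping the last `cnt L t` occurrences of every letter truncates all suffix counts at the same
value, and truncation preserves the lattice inequalities. -/
theorem hasChain_zero_of_latticeAt {L : List (Finset ℕ)} {t : ℕ} (h : ∀ j < t, LatticeAt j L) :
    HasChain L 0 t (cnt L t) 0 := by
  have hanti : ∀ i, ∀ j, j + i = t → cnt L t ≤ cnt L j := by
    intro i
    induction i with
    | zero => intro j hj; rw [← hj, add_zero]
    | succ i ih =>
      intro j hj
      exact (ih (j + 1) (by omega)).trans (h j (by omega) L List.suffix_rfl)
  refine ⟨trim (cnt L t) L, 0, trim_subset _ _, rfl, le_rfl, fun j _ hj => ?_, ?_⟩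
  · rw [cnt_trim]
    exact min_eq_left (hanti (t - j) j (by omega))
  · intro D hD j _ hj
    obtain ⟨L', h1, rfl⟩ := exists_eq_trim_of_suffix hD
    have := h j hj L' h1
    simp only [cnt_trim, Pi.zero_apply]
    omega

theorem forall₂_cnt_le {D L : List (Finset ℕ)} (h : List.Forall₂ (· ⊆ ·) D L) (j : ℕ) :
    cnt D j ≤ cnt L j := by
  induction h with
  | nil => exact le_rfl
  | cons h1 _ ih =>
    simp only [cnt_cons]
    split_ifs with c1 c2 c2
    · omega
    · exact absurd (h1 c1) c2
    · omega
    · omega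

/-- The chain has to use all letters `t + 1` of `L`, so its suffix counts at that level are those of
`L`, while at the level `t` they are at most those of `L`. Without windings the chain inequality is
the lattice inequality. -/
theorem latticeAt_of_hasChain_zero {L : List (Finset ℕ)} {t : ℕ}
    (h : HasChain L 0 (t + 1) (cnt L (t + 1)) 0) : LatticeAt t L := by
  obtain ⟨D, d, hD, h0, hw, hn, hch⟩ := h
  -- The empty suffix shows that `d` is weakly increasing on the levels concerned.
  have hmono : ∀ j, j ≤ t + 1 → 0 ≤ d j := by
    intro j
    induction j with
    | zero => intro _; exact h0.ge
    | succ j ih =>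
      intro hj
      have := hch [] (List.nil_suffix) j (Nat.zero_le _) (by omega)
      have := ih (by omega)
      simp at *
      omega
  intro L2 hL
  obtain ⟨L1, rfl⟩ := hL
  have h1 := List.forall₂_take_append _ _ _ hD
  have h2 := List.forall₂_drop_append _ _ _ hD
  have h3 := hch (D.drop L1.length) (List.drop_suffix _ _) t (Nat.zero_le _) (Nat.lt_succ_self _)
  have h4 := forall₂_cnt_le h2 t
  have h5 := forall₂_cnt_le h2 (t + 1)
  have h6 := forall₂_cnt_le h1 (t + 1)
  have h7 := hn (t + 1) (Nat.zero_le _) le_rfl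
  rw [← List.take_append_drop L1.length D] at h7
  simp only [cnt_append] at h7
  have := hmono t (Nat.le_succ _)
  omega

/-! ### Minimal winding numbers -/

/-- The least number of windings of `n` disjoint paths through the levels `0, …, t`, with `n` the
number of letters `t`. -/
def winding (L : List (Finset ℕ)) (t : ℕ) : ℕ := sInf {w : ℕ | HasChain L 0 t (cnt L t) w}

/-- The sum of the minimal winding numbers for the letters less than `N`. -/
def chargeSum (N : ℕ) (L : List (Finset ℕ)) : ℕ := ∑ t ∈ Finset.range N, winding L t

/-- The numbers `winding L t` depend only on letter counts and on the existence of chains, and both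
are invariant. -/
theorem BlockEquiv.chargeSum_eq {L L' : List (Finset ℕ)} (h : BlockEquiv L L') (N : ℕ) :
    chargeSum N L = chargeSum N L' := by
  refine Finset.sum_congr rfl fun t _ => ?_
  unfold winding
  simp only [h.cnt_eq, h.hasChain_iff]

end

section

/-! ### Row systems -/

/-- The number of elements of `S` which are at least `x`. -/
def up (S : Finset ℕ) (x : ℕ) : ℕ := (S.filter (x ≤ ·)).card

theorem up_zero (S : Finset ℕ) : up S 0 = S.card := by simp [up]

theorem up_mono {S C : Finset ℕ} (h : S ⊆ C) (x : ℕ) : up S x ≤ up C x :=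
  Finset.card_le_card (Finset.filter_subset_filter _ h)

theorem up_eq_add (S : Finset ℕ) {x y : ℕ} (h : x ≤ y) :
    up S x = up S y + (S.filter fun c => x ≤ c ∧ c < y).card := by
  unfold up
  rw [← Finset.card_union_of_disjoint]
  · congr 1
    ext c
    simp only [Finset.mem_filter, Finset.mem_union]
    constructor
    · rintro ⟨h1, h2⟩
      by_cases h3 : y ≤ c
      · exact Or.inl ⟨h1, h3⟩
      · exact Or.inr ⟨h1, h2, by omega⟩
    · rintro (⟨h1, h2⟩ | ⟨h1, h2, h3⟩)
      · exact ⟨h1, by omega⟩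
      · exact ⟨h1, h2⟩
  · rw [Finset.disjoint_filter]
    intro c _ h1 h2
    omega

theorem up_sub_le {S C : Finset ℕ} (hS : S ⊆ C) {x y : ℕ} (h : x ≤ y) :
    up S x + up C y ≤ up C x + up S y := by
  rw [up_eq_add S h, up_eq_add C h]
  have := Finset.card_le_card (Finset.filter_subset_filter (fun c => x ≤ c ∧ c < y) hS)
  omega

theorem up_sub_eq {S C : Finset ℕ} (hS : S ⊆ C) {x y : ℕ} (h : x ≤ y)
    (hC : ∀ c ∈ C, x ≤ c → c < y → c ∈ S) : up S x + up C y = up C x + up S y := by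
  have : (S.filter fun c => x ≤ c ∧ c < y) = C.filter fun c => x ≤ c ∧ c < y := by
    ext c
    simp only [Finset.mem_filter]
    exact ⟨fun h => ⟨hS h.1, h.2⟩, fun h => ⟨hC c h.1 h.2.1 h.2.2, h.2⟩⟩
  rw [up_eq_add S h, up_eq_add C h, this]
  omega

theorem up_image {b : ℕ → ℕ} {n : ℕ} (hb : Set.InjOn b (Finset.range n)) (x : ℕ) :
    up ((Finset.range n).image b) x = ∑ i ∈ Finset.range n, if x ≤ b i then 1 else 0 := by
  unfold up
  rw [Finset.filter_image, Finset.card_image_of_injOn, Finset.card_filter]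
  exact hb.mono (Finset.coe_subset.mpr (Finset.filter_subset _ _))

/-- The maximality of the configuration `b`, which is obtained from the configuration `a` by a
greedy cyclic matching with elements of `C`. -/
theorem greedy_tight {C : Finset ℕ} {a b : ℕ → ℕ} {n : ℕ} (hn : n ≤ C.card)
    (hC : C = (Finset.range C.card).image b)
    (ht : ∀ i i', i < i' → i' < C.card → IsInversionTriple (a i) (b i) (b i')) (x : ℕ) :
    (∃ y, x ≤ y ∧ ∑ i ∈ Finset.range n, ((if x ≤ b i then 1 else 0) - if a i < b i then 1 else 0)
      = (∑ i ∈ Finset.range n, if y ≤ a i then 1 else 0) + (up C x : ℤ) - up C y) ∨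
    (∃ y, ∑ i ∈ Finset.range n, ((if x ≤ b i then 1 else 0) - if a i < b i then 1 else 0)
      = (∑ i ∈ Finset.range n, if y ≤ a i then 1 else 0) - n + (up C x : ℤ) + C.card - up C y) := by
  have hinj : Set.InjOn b (Finset.range C.card) := by
    rw [← Finset.card_image_iff, ← hC, Finset.card_range]
  have hmem : ∀ i, i < C.card → b i ∈ C := fun i hi => by
    rw [hC]; exact Finset.mem_image_of_mem b (Finset.mem_range.mpr hi)
  -- the two bounds
  have hsub : ∀ k, k ≤ C.card → (Finset.range k).image b ⊆ C := fun k hk c hc => by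
    obtain ⟨i, hi, rfl⟩ := Finset.mem_image.mp hc
    exact hmem i (by have := Finset.mem_range.mp hi; omega)
  have hinj' : ∀ k, k ≤ C.card → Set.InjOn b (Finset.range k) := fun k hk =>
    hinj.mono (by simpa using hk)
  -- Termwise: if `b i` is at least `y` while `a i` is not, then the row has wound.
  have hle : ∀ k y, ∑ i ∈ Finset.range k,
      (((if y ≤ b i then 1 else 0) : ℤ) - if a i < b i then 1 else 0) ≤
      ∑ i ∈ Finset.range k, if y ≤ a i then 1 else 0 := fun k y =>
    Finset.sum_le_sum fun i _ => by split_ifs <;> omega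
  have hG : ∀ k, k ≤ C.card → ∀ y, ∑ i ∈ Finset.range k,
      (((if y ≤ b i then 1 else 0) : ℤ) - if a i < b i then 1 else 0) =
      up ((Finset.range k).image b) y - ∑ i ∈ Finset.range k, if a i < b i then 1 else 0 := by
    intro k hk y
    rw [up_image (hinj' k hk), Finset.sum_sub_distrib]
    push_cast
    rfl
  -- The first bound compares the thresholds `x` and `y` on `C`; the second one, below, lets the
  -- path wind once around the circle. Both hold for every `y`, and the theorem says that one of
  -- them is attained.
  have hb1 : ∀ k, k ≤ C.card → ∀ x y, x ≤ y → ∑ i ∈ Finset.range k,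
      (((if x ≤ b i then 1 else 0) : ℤ) - if a i < b i then 1 else 0) ≤
      (∑ i ∈ Finset.range k, if y ≤ a i then 1 else 0) + (up C x : ℤ) - up C y := by
    intro k hk x y hxy
    have h1 := hle k y
    rw [hG k hk] at h1 ⊢
    have := up_sub_le (hsub k hk) hxy
    omega
  have hb2 : ∀ k, k ≤ C.card → ∀ x y, ∑ i ∈ Finset.range k,
      (((if x ≤ b i then 1 else 0) : ℤ) - if a i < b i then 1 else 0) ≤
      (∑ i ∈ Finset.range k, if y ≤ a i then 1 else 0) - k + (up C x : ℤ) + C.card - up C y := by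
    intro k hk x y
    have h1 := hle k y
    rw [hG k hk] at h1 ⊢
    have h2 := up_sub_le (hsub k hk) (Nat.zero_le y)
    have h3 := up_mono (hsub k hk) x
    rw [up_zero, up_zero, Finset.card_image_of_injOn (hinj' k hk), Finset.card_range] at h2
    omega
  induction n generalizing x with
  | zero => exact Or.inl ⟨x, le_rfl, by simp⟩
  | succ n ih =>
    have ih' := ih (by omega)
    have B1 := hb1 (n + 1) hn x
    have B2 := hb2 (n + 1) hn x
    have B2' := hb2 n (by omega) x
    have G := hG n (by omega)
    -- By the triple condition, all elements of `C` skipped on the cyclic way from `a n` leftwards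
    -- to `b n` were taken by earlier rows.
    have hcov : ∀ c ∈ C, c ≠ b n → (b n ≤ a n → b n < c → c ≤ a n → c ∈ (Finset.range n).image b) ∧
        (a n < b n → (c ≤ a n ∨ b n < c) → c ∈ (Finset.range n).image b) := by
      intro c hc hne
      have hc' := hc
      rw [hC] at hc'
      obtain ⟨i, hi, rfl⟩ := Finset.mem_image.mp hc'
      have hi := Finset.mem_range.mp hi
      have hin : i < n → b i ∈ (Finset.range n).image b := fun h =>
        Finset.mem_image_of_mem b (Finset.mem_range.mpr h)
      rcases lt_trichotomy i n with h | rfl | h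
      · exact ⟨fun _ _ _ => hin h, fun _ _ => hin h⟩
      · exact absurd rfl hne
      · have := ht n i h hi
        unfold IsInversionTriple at this
        exact ⟨fun _ _ _ => by omega, fun _ _ => by omega⟩
    have hs := hsub n (by omega)
    have hcn : ((Finset.range n).image b).card = n := by
      rw [Finset.card_image_of_injOn (hinj' n (by omega)), Finset.card_range]
    simp only [Finset.sum_range_succ] at B1 B2 ⊢
    have Gx := G x
    have Ga := G (a n + 1)
    have e0 : ∀ S : Finset ℕ, up S 0 = S.card := up_zero
    by_cases hw : b n ≤ a n
    · have hw' : ¬ a n < b n := by omega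
      simp only [hw', if_false, sub_zero] at B1 B2 ⊢
      by_cases hx : x ≤ b n
      · simp only [hx, if_true] at B1 B2 ⊢
        rcases ih' x with ⟨y, hy, e⟩ | ⟨y, e⟩
        · refine Or.inl ⟨y, hy, ?_⟩
          have := B1 y hy
          split_ifs at this ⊢ <;> omega
        · refine Or.inr ⟨y, ?_⟩
          have := B2 y
          split_ifs at this ⊢ <;> push_cast at this ⊢ <;> omega
      · simp only [hx, if_false] at B1 B2 ⊢
        by_cases hxa : x ≤ a n
        -- As everything in `C` between `x` and `a n` is already occupied, the threshold `x` can be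
        -- replaced by `a n + 1`, where row `n` does not contribute.
        · have hcov' := up_sub_eq hs (x := x) (y := a n + 1) (by omega) fun c hc h1 h2 =>
            (hcov c hc (by omega)).1 hw (by omega) (by omega)
          rcases ih' (a n + 1) with ⟨y, hy, e⟩ | ⟨y, e⟩
          · refine Or.inl ⟨y, by omega, ?_⟩
            have : ¬ y ≤ a n := by omega
            simp only [this, if_false]
            omega
          · refine Or.inr ⟨y, ?_⟩
            have := B2 y
            split_ifs at this ⊢ <;> push_cast at this ⊢ <;> omega
        · rcases ih' x with ⟨y, hy, e⟩ | ⟨y, e⟩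
          · refine Or.inl ⟨y, hy, ?_⟩
            have : ¬ y ≤ a n := by omega
            simp only [this, if_false]
            omega
          · refine Or.inr ⟨y, ?_⟩
            have := B2 y
            split_ifs at this ⊢ <;> push_cast at this ⊢ <;> omega
    · have hw' : a n < b n := by omega
      simp only [hw', if_true] at B1 B2 ⊢
      have hcov0 := up_sub_eq hs (x := 0) (y := a n + 1) (by omega) fun c hc h1 h2 =>
            (hcov c hc (by omega)).2 hw' (Or.inl (by omega))
      rw [e0, e0, hcn] at hcov0
      by_cases hx : x ≤ b n
      · simp only [hx, if_true] at B1 B2 ⊢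
        by_cases hxa : x ≤ a n
        · have hcov' := up_sub_eq hs (x := x) (y := a n + 1) (by omega) fun c hc h1 h2 =>
            (hcov c hc (by omega)).2 hw' (Or.inl (by omega))
          rcases ih' (a n + 1) with ⟨y, hy, e⟩ | ⟨y, e⟩
          · refine Or.inl ⟨y, by omega, ?_⟩
            have : ¬ y ≤ a n := by omega
            simp only [this, if_false]
            omega
          · refine Or.inr ⟨y, ?_⟩
            have := B2 y
            split_ifs at this ⊢ <;> push_cast at this ⊢ <;> omega
        · rcases ih' x with ⟨y, hy, e⟩ | ⟨y, e⟩
          · refine Or.inl ⟨y, hy, ?_⟩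
            have : ¬ y ≤ a n := by omega
            simp only [this, if_false]
            omega
          · refine Or.inr ⟨y, ?_⟩
            have := B2 y
            split_ifs at this ⊢ <;> push_cast at this ⊢ <;> omega
      · simp only [hx, if_false] at B1 B2 ⊢
        -- Row `n` winds and lands below `x`, so all of `C` from `x` on is occupied. The old
        -- configuration meets the first bound at `a n + 1`, which turns into the second bound for
        -- the new one.
        have hupx : up ((Finset.range n).image b) x = up C x := by
          unfold up
          congr 1
          ext c
          simp only [Finset.mem_filter]
          exact ⟨fun h => ⟨hs h.1, h.2⟩, fun h =>
            ⟨(hcov c h.1 (by omega)).2 hw' (Or.inr (by omega)), h.2⟩⟩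
        rcases ih' (a n + 1) with ⟨y, hy, e⟩ | ⟨y, e⟩
        · refine Or.inr ⟨y, ?_⟩
          have : ¬ y ≤ a n := by omega
          simp only [this, if_false]
          push_cast
          omega
        -- Equality in the second bound at `a n + 1`, where all lower elements of `C` are occupied,
        -- would force `C` to have at most `n` elements.
        · exfalso
          have := B2' y
          omega

/-- The positions `pos i j` of the boxes `(i, j)` of the rows, chosen greedily from the sets `C j` of
positions of the letters `j`. -/
structure RowSystem (C : ℕ → Finset ℕ) (pos : ℕ → ℕ → ℕ) : Prop where
  mem : ∀ i j, i < (C j).card → pos i j ∈ C j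
  anti : ∀ j, (C (j + 1)).card ≤ (C j).card
  first : ∀ i i', i < i' → i' < (C 0).card → pos i' 0 < pos i 0
  triple : ∀ j i i', i < i' → i' < (C (j + 1)).card →
    IsInversionTriple (pos i j) (pos i (j + 1)) (pos i' (j + 1))

namespace RowSystem

variable {C : ℕ → Finset ℕ} {pos : ℕ → ℕ → ℕ}

theorem injOn (h : RowSystem C pos) (j : ℕ) :
    Set.InjOn (fun i => pos i j) (Finset.range (C j).card) := by
  have key : ∀ i i', i < i' → i' < (C j).card → pos i j ≠ pos i' j := by
    intro i i' h1 h2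
    cases j with
    | zero => exact (h.first i i' h1 h2).ne'
    | succ j =>
      have := h.triple j i i' h1 h2
      unfold IsInversionTriple at this
      omega
  intro i hi i' hi' e
  simp only [Finset.coe_range, Set.mem_Iio] at hi hi'
  rcases lt_trichotomy i i' with h1 | h1 | h1
  · exact absurd e (key _ _ h1 hi')
  · exact h1
  · exact absurd e.symm (key _ _ h1 hi)

theorem eq_image (h : RowSystem C pos) (j : ℕ) :
    C j = (Finset.range (C j).card).image fun i => pos i j := by
  symm
  apply Finset.eq_of_subset_of_card_le
  · intro c hc
    obtain ⟨i, hi, rfl⟩ := Finset.mem_image.mp hc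
    exact h.mem i j (Finset.mem_range.mp hi)
  · rw [Finset.card_image_of_injOn (h.injOn j), Finset.card_range]

theorem antitone (h : RowSystem C pos) : Antitone fun j => (C j).card :=
  antitone_nat_of_succ_le h.anti

end RowSystem

/-- The number of windings of the row `i` up to the level `j`. -/
def rowWind (pos : ℕ → ℕ → ℕ) (i j : ℕ) : ℕ :=
  ((Finset.range j).filter fun k => pos i k < pos i (k + 1)).card

theorem rowWind_zero (pos : ℕ → ℕ → ℕ) (i : ℕ) : rowWind pos i 0 = 0 := rfl

theorem rowWind_succ (pos : ℕ → ℕ → ℕ) (i j : ℕ) :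
    rowWind pos i (j + 1) = rowWind pos i j + if pos i j < pos i (j + 1) then 1 else 0 := by
  unfold rowWind
  rw [Finset.range_add_one, Finset.filter_insert]
  split_ifs with h
  · rw [Finset.card_insert_of_notMem (by simp)]
  · rfl

/-! ### Position sets of a block word and optimality of the greedy rows -/

/-- The positions of the blocks of `L` which contain the letter `j`. -/
def levelSet (L : List (Finset ℕ)) (j : ℕ) : Finset ℕ :=
  (Finset.range L.length).filter fun x => j ∈ L.getD x ∅

theorem mem_levelSet {L : List (Finset ℕ)} {j x : ℕ} : x ∈ levelSet L j ↔ j ∈ L.getD x ∅ := by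
  unfold levelSet
  rw [Finset.mem_filter, Finset.mem_range, and_iff_right_iff_imp]
  intro h
  by_contra h1
  rw [List.getD_eq_default _ _ (by omega)] at h
  exact absurd h (Finset.notMem_empty _)

/-- The bridge between the two languages: suffix counts of block words are threshold counts of
position sets. -/
theorem cnt_drop (L : List (Finset ℕ)) (x j : ℕ) : cnt (L.drop x) j = up (levelSet L j) x := by
  induction L generalizing x with
  | nil => simp [levelSet, up]
  | cons b L ih =>
    have h1 : levelSet (b :: L) j = (if j ∈ b then {0} else ∅) ∪ (levelSet L j).image Nat.succ := by
      ext y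
      rw [mem_levelSet, Finset.mem_union, Finset.mem_image]
      cases y with
      | zero => by_cases h : j ∈ b <;> simp [h]
      | succ y => by_cases h : j ∈ b <;> simp [h, mem_levelSet]
    have h2 : ∀ z, up ((levelSet L j).image Nat.succ) (z + 1) = up (levelSet L j) z := by
      intro z
      unfold up
      rw [Finset.filter_image, Finset.card_image_of_injective _ Nat.succ_injective]
      simp
    cases x with
    | succ x =>
      rw [List.drop_succ_cons, ih, ← h2]
      unfold up
      congr 1
      ext y
      simp only [h1, Finset.mem_filter, Finset.mem_union]
      constructor
      · rintro ⟨h, h'⟩; exact ⟨Or.inr h, h'⟩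
      · rintro ⟨h | h, h'⟩
        · split_ifs at h <;> simp at h; omega
        · exact ⟨h, h'⟩
    | zero =>
      have ih0 := ih 0
      rw [List.drop_zero] at ih0 ⊢
      rw [cnt_cons, ih0, up_zero, up_zero, h1, Finset.card_union_of_disjoint,
        Finset.card_image_of_injective _ Nat.succ_injective]
      · split_ifs <;> simp
      · rw [Finset.disjoint_left]
        intro y hy hy'
        obtain ⟨z, _, rfl⟩ := Finset.mem_image.mp hy'
        split_ifs at hy <;> simp at hy

theorem cnt_eq_card (L : List (Finset ℕ)) (j : ℕ) : cnt L j = (levelSet L j).card := by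
  rw [← up_zero, ← cnt_drop, List.drop_zero]

theorem isChain_iff {s t : ℕ} {d : ℕ → ℤ} {D : List (Finset ℕ)} :
    IsChain s t d D ↔ ∀ x j, s ≤ j → j < t →
      (up (levelSet D (j + 1)) x : ℤ) - d (j + 1) ≤ up (levelSet D j) x - d j := by
  constructor
  · intro h x j h1 h2
    have := h (D.drop x) (List.drop_suffix _ _) j h1 h2
    rwa [cnt_drop, cnt_drop] at this
  · intro h D2 hD j h1 h2
    have := h (D.length - D2.length) j h1 h2
    rw [List.suffix_iff_eq_drop.mp hD, cnt_drop, cnt_drop]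
    exact this

theorem forall₂_subset_iff {D L : List (Finset ℕ)} :
    List.Forall₂ (· ⊆ ·) D L ↔ D.length = L.length ∧ ∀ x, D.getD x ∅ ⊆ L.getD x ∅ := by
  induction D generalizing L with
  | nil =>
    cases L with
    | nil => simp
    | cons b L => simp
  | cons a D ih =>
    cases L with
    | nil => simp
    | cons b L =>
      rw [List.forall₂_cons, ih]
      simp only [List.length_cons, add_left_inj]
      constructor
      · rintro ⟨h1, h2, h3⟩
        refine ⟨h2, fun x => ?_⟩
        cases x with
        | zero => exact h1
        | succ x => exact h3 x
      · rintro ⟨h2, h3⟩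
        exact ⟨h3 0, h2, fun x => h3 (x + 1)⟩

/-- The first `cnt L t` greedy rows form a chain with exactly these windings. Conversely, by
induction on the level, the greedy configuration dominates every chain: its threshold counts,
diminished by its windings, are at least those of the chain. -/
theorem RowSystem.hasChain_iff {L : List (Finset ℕ)} {pos : ℕ → ℕ → ℕ}
    (h : RowSystem (levelSet L) pos) (t : ℕ) (w : ℤ) :
    HasChain L 0 t (cnt L t) w ↔ (∑ i ∈ Finset.range (cnt L t), rowWind pos i t : ℕ) ≤ w := by
  have hanti : ∀ j, j ≤ t → cnt L t ≤ (levelSet L j).card := fun j hj => by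
    rw [cnt_eq_card]; exact h.antitone hj
  set n := cnt L t with hn
  have hinj : ∀ j, j ≤ t → Set.InjOn (fun i => pos i j) (Finset.range n) := fun j hj =>
    (h.injOn j).mono (by simpa using hanti j hj)
  constructor
  · rintro ⟨D, d, hD, h0, hw, hc, hch⟩
    rw [isChain_iff] at hch
    obtain ⟨hlen, hsub⟩ := forall₂_subset_iff.mp hD
    have hDL : ∀ j, levelSet D j ⊆ levelSet L j := fun j x hx =>
      mem_levelSet.mpr (hsub x (mem_levelSet.mp hx))
    have key : ∀ j, j ≤ t → ∀ x, (up (levelSet D j) x : ℤ) - d j ≤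
        (∑ i ∈ Finset.range n, if x ≤ pos i j then 1 else 0) -
          ∑ i ∈ Finset.range n, (rowWind pos i j : ℤ) := by
      intro j
      induction j with
      | zero =>
        intro _ x
        have e1 := up_image (hinj 0 (Nat.zero_le _)) x
        simp only [rowWind_zero, Nat.cast_zero, Finset.sum_const_zero, sub_zero, h0]
        have : up (levelSet D 0) x ≤ ∑ i ∈ Finset.range n, if x ≤ pos i 0 then 1 else 0 := by
          -- On the level `0` the rows take the largest positions. As soon as one of the first `n`
          -- rows lies below the threshold, all positions above the threshold belong to these rows.
          by_cases hall : ∀ i < n, x ≤ pos i 0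
          · rw [Finset.sum_congr rfl fun i hi => if_pos (hall i (Finset.mem_range.mp hi)),
              Finset.sum_const, Finset.card_range, smul_eq_mul, mul_one,
              ← hc 0 le_rfl (Nat.zero_le _), cnt_eq_card]
            exact Finset.card_filter_le _ _
          · push Not at hall
            obtain ⟨i0, hi0, hlt⟩ := hall
            rw [← e1]
            refine (up_mono (hDL 0) x).trans (Finset.card_le_card fun c hc => ?_)
            obtain ⟨hc1, hc2⟩ := Finset.mem_filter.mp hc
            rw [h.eq_image 0] at hc1
            obtain ⟨i, hi, rfl⟩ := Finset.mem_image.mp hc1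
            have hi := Finset.mem_range.mp hi
            refine Finset.mem_filter.mpr ⟨Finset.mem_image_of_mem _ (Finset.mem_range.mpr ?_), hc2⟩
            by_contra hni
            have := h.first i0 i (by omega) hi
            omega
        exact_mod_cast this
      | succ j ih =>
        intro hj x
        have ih := ih (by omega)
        have hk : ∀ y, (up (levelSet D (j + 1)) y : ℤ) - d (j + 1) +
            ∑ i ∈ Finset.range n, (rowWind pos i j : ℤ) ≤
            ∑ i ∈ Finset.range n, if y ≤ pos i j then 1 else 0 := by
          intro y
          have := hch y j (Nat.zero_le _) (by omega)
          have := ih y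
          omega
        have hcard : (levelSet D (j + 1)).card = n := by
          rw [← cnt_eq_card]; exact hc _ (Nat.zero_le _) hj
        have e : ∑ i ∈ Finset.range n, (rowWind pos i (j + 1) : ℤ) =
            ∑ i ∈ Finset.range n, (rowWind pos i j : ℤ) +
              ∑ i ∈ Finset.range n, if pos i j < pos i (j + 1) then 1 else 0 := by
          rw [← Finset.sum_add_distrib]
          refine Finset.sum_congr rfl fun i _ => ?_
          rw [rowWind_succ]; push_cast; rfl
        rw [e]
        have hm1 := up_mono (hDL (j + 1)) x
        -- The greedy value equals one of the two upper bounds, and the induction hypothesis at the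
        -- threshold `y` shows that the chain obeys the same bound.
        rcases greedy_tight (a := fun i => pos i j) (hanti (j + 1) hj) (h.eq_image (j + 1))
          (h.triple j) x with ⟨y, hy, e1⟩ | ⟨y, e1⟩
        · rw [Finset.sum_sub_distrib] at e1
          have := up_sub_le (hDL (j + 1)) hy
          have := hk y
          omega
        · rw [Finset.sum_sub_distrib] at e1
          have := up_sub_le (hDL (j + 1)) (Nat.zero_le y)
          rw [up_zero, up_zero, hcard] at this
          have := hk y
          omega
    -- Beyond all greedy positions the threshold count of the rows vanishes, and only the windings
    -- are compared.
    have := key t le_rfl (max L.length ((Finset.range n).sup (fun i => pos i t) + 1))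
    rw [Finset.sum_eq_zero (s := Finset.range n) (f := fun i => if _ ≤ pos i t then _ else _)] at this
    · push_cast
      omega
    · intro i hi
      rw [if_neg]
      have := Finset.le_sup (f := fun i => pos i t) hi
      omega
  · intro hw
    classical
    -- The sub-block word occupied by the first `n` rows; its windings are the sums of the windings
    -- of the rows.
    set D : List (Finset ℕ) := (List.range L.length).map fun x =>
      (L.getD x ∅).filter fun j => j ≤ t ∧ ∃ i < n, pos i j = x with hDdef
    have hDx : ∀ x j, j ∈ D.getD x ∅ ↔ j ∈ L.getD x ∅ ∧ j ≤ t ∧ ∃ i < n, pos i j = x := by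
      intro x j
      by_cases hx : x < L.length
      · rw [hDdef, List.getD_eq_getElem _ _ (by simpa using hx), List.getElem_map,
          List.getElem_range, Finset.mem_filter]
      · rw [List.getD_eq_default _ _ (by simp [hDdef]; omega),
          List.getD_eq_default _ _ (by omega)]
        simp
    have hlev : ∀ j, j ≤ t → levelSet D j = (Finset.range n).image fun i => pos i j := by
      intro j hj
      ext x
      rw [mem_levelSet, hDx, Finset.mem_image]
      constructor
      · rintro ⟨_, _, i, hi, e⟩; exact ⟨i, Finset.mem_range.mpr hi, e⟩
      · rintro ⟨i, hi, rfl⟩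
        have hi := Finset.mem_range.mp hi
        exact ⟨mem_levelSet.mp (h.mem i j (hi.trans_le (hanti j hj))), hj, i, hi, rfl⟩
    refine ⟨D, fun j => ∑ i ∈ Finset.range n, (rowWind pos i j : ℤ), forall₂_subset_iff.mpr
      ⟨by simp [hDdef], fun x j hj => ((hDx x j).mp hj).1⟩, by simp [rowWind_zero],
      by push_cast at hw; exact hw, ?_, isChain_iff.mpr ?_⟩
    · intro j _ hj
      rw [cnt_eq_card, hlev j hj, Finset.card_image_of_injOn (hinj j hj), Finset.card_range]
    · intro x j _ hj
      rw [hlev j hj.le, hlev (j + 1) hj, up_image (hinj j hj.le), up_image (hinj (j + 1) hj)]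
      push_cast
      rw [← Finset.sum_sub_distrib, ← Finset.sum_sub_distrib]
      refine Finset.sum_le_sum fun i _ => ?_
      rw [rowWind_succ]
      push_cast
      split_ifs <;> omega

theorem RowSystem.winding_eq {L : List (Finset ℕ)} {pos : ℕ → ℕ → ℕ}
    (h : RowSystem (levelSet L) pos) (t : ℕ) :
    winding L t = ∑ i ∈ Finset.range (cnt L t), rowWind pos i t := by
  unfold winding
  simp only [h.hasChain_iff, Nat.cast_le]
  exact csInf_Ici

/-- The contribution of a row of length `k` to the charge. -/
def rowCharge (k : ℕ) (p : ℕ → ℕ) : ℕ :=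
  ∑ j ∈ (Finset.range (k - 1)).filter (fun j => p j < p (j + 1)), (k - (j + 1))

/-- A winding between the levels `j` and `j + 1` is seen by all `t` with `j < t < k`, hence is
counted `k - (j + 1)` times. -/
theorem sum_rowWind (pos : ℕ → ℕ → ℕ) (i k : ℕ) :
    ∑ t ∈ Finset.range k, rowWind pos i t = rowCharge k (pos i) := by
  have h : ∀ k, rowCharge k (pos i) =
      ∑ j ∈ Finset.range k, if pos i j < pos i (j + 1) then k - (j + 1) else 0 := by
    intro k
    unfold rowCharge
    rw [Finset.sum_filter]
    cases k with
    | zero => rfl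
    | succ k =>
      rw [Finset.sum_range_succ, Nat.add_sub_cancel]
      simp
  rw [h]
  induction k with
  | zero => rfl
  | succ k ih =>
    rw [Finset.sum_range_succ, ih, Finset.sum_range_succ, rowWind, Finset.card_filter,
      ← Finset.sum_add_distrib]
    simp only [Nat.sub_self, ite_self, add_zero]
    refine Finset.sum_congr rfl fun j hj => ?_
    have := Finset.mem_range.mp hj
    split_ifs <;> omega

/-- The number of levels below `N` which have more than `i` positions. -/
def rowLength (N : ℕ) (κ : ℕ → ℕ) (i : ℕ) : ℕ := ((Finset.range N).filter fun t => i < κ t).card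

/-- Since `κ` is decreasing, the levels that reach row `i` form an initial segment, so their number
is a conjugate partition part. -/
theorem lt_rowLength {N : ℕ} {κ : ℕ → ℕ} (hκ : Antitone κ) {i t : ℕ} :
    t < rowLength N κ i ↔ t < N ∧ i < κ t := by
  have key : ∃ k, (Finset.range N).filter (fun t => i < κ t) = Finset.range k := by
    refine ⟨rowLength N κ i, ?_⟩
    unfold rowLength
    induction N with
    | zero => rfl
    | succ N ih =>
      rw [Finset.range_add_one, Finset.filter_insert]
      split_ifs with h
      · have : (Finset.range N).filter (fun t => i < κ t) = Finset.range N :=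
          Finset.filter_true_of_mem fun t ht =>
            h.trans_le (hκ (Finset.mem_range.mp ht).le)
        rw [this, ← Finset.range_add_one, Finset.card_range]
      · exact ih
  obtain ⟨k, hk⟩ := key
  have h1 : rowLength N κ i = k := by rw [rowLength, hk, Finset.card_range]
  have h2 : t ∈ (Finset.range N).filter (fun t => i < κ t) ↔ t ∈ Finset.range k := by rw [hk]
  rw [h1, ← Finset.mem_range, ← h2, Finset.mem_filter, Finset.mem_range]

/-- The windings of the first `cnt L t` rows, summed over the levels `t`, are rearranged row by row.
-/
theorem RowSystem.chargeSum_eq {L : List (Finset ℕ)} {pos : ℕ → ℕ → ℕ}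
    (h : RowSystem (levelSet L) pos) (N : ℕ) :
    chargeSum N L = ∑ i ∈ Finset.range (cnt L 0), rowCharge (rowLength N (cnt L) i) (pos i) := by
  have hanti : Antitone (cnt L) := by
    have := h.antitone
    simpa only [← cnt_eq_card] using this
  unfold chargeSum
  simp only [h.winding_eq, ← sum_rowWind]
  rw [Finset.sum_comm']
  intro t i
  simp only [Finset.mem_range]
  rw [lt_rowLength hanti]
  constructor
  · rintro ⟨h1, h2⟩; exact ⟨⟨h1, h2⟩, h2.trans_le (hanti (Nat.zero_le _))⟩
  · rintro ⟨⟨h1, h2⟩, _⟩; exact ⟨h1, h2⟩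

end

section

/-! ### The charge of a word as a sum of winding numbers -/

/-- The positions of the letter `a` in the word `w`. -/
def wordSet (w : List ℕ) (a : ℕ) : Finset ℕ :=
  (Finset.range w.length).filter fun i => w[i]? = some a

theorem mem_wordSet {w : List ℕ} {a i : ℕ} : i ∈ wordSet w a ↔ w[i]? = some a := by
  unfold wordSet
  rw [Finset.mem_filter, Finset.mem_range, and_iff_right_iff_imp]
  intro h
  exact (List.getElem?_eq_some_iff.mp h).1

/-- The block word of a word. -/
def singles (w : List ℕ) : List (Finset ℕ) := w.map fun a => {a}

theorem levelSet_singles (w : List ℕ) : levelSet (singles w) = wordSet w := by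
  funext a
  ext i
  rw [mem_levelSet, mem_wordSet, List.getD_eq_getElem?_getD, singles, List.getElem?_map]
  cases h : w[i]? with
  | none => simp
  | some b => simp [eq_comm]

theorem cnt_singles (w : List ℕ) (a : ℕ) : cnt (singles w) a = w.count a := by
  unfold cnt singles
  rw [List.countP_map, List.count]
  congr 1
  funext b
  simp only [Function.comp, Finset.mem_singleton]
  rw [Bool.eq_iff_iff, decide_eq_true_iff, beq_iff_eq]
  exact eq_comm

theorem card_wordSet (w : List ℕ) (a : ℕ) : (wordSet w a).card = w.count a := by
  rw [← cnt_singles, cnt_eq_card, levelSet_singles]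

/-- Searching to the left with wraparound is the cyclic choice expressed by inversion triples: no
other occurrence of the letter lies cyclically between `p` and the marked position. The last clause
serves the start at the right end of the word. -/
theorem markNext_spec {w : List ℕ} {a p : ℕ} (h : (wordSet w a).Nonempty) :
    markNext w a p ∈ wordSet w a ∧ (p ∉ wordSet w a → ∀ c ∈ wordSet w a, c ≠ markNext w a p →
      IsInversionTriple p (markNext w a p) c) ∧
      ((∀ c ∈ wordSet w a, c < p) → ∀ c ∈ wordSet w a, c ≤ markNext w a p) := by
  have e : markNext w a p = if ((wordSet w a).filter (· < p)).Nonempty then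
    ((wordSet w a).filter (· < p)).sup id else (wordSet w a).sup id := rfl
  have hle : ∀ (S : Finset ℕ), ∀ c ∈ S, c ≤ S.sup id := fun S c hc => Finset.le_sup (f := id) hc
  split_ifs at e with h1
  · obtain ⟨b, hb, hb'⟩ := Finset.exists_mem_eq_sup _ h1 id
    rw [hb'] at e
    simp only [id] at e
    obtain ⟨hb1, hb2⟩ := Finset.mem_filter.mp hb
    rw [e]
    refine ⟨hb1, fun hp c hc hne => ?_, fun hall c hc => ?_⟩
    · unfold IsInversionTriple
      by_cases hcp : c < p
      · have := hle ((wordSet w a).filter (· < p)) c (Finset.mem_filter.mpr ⟨hc, hcp⟩)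
        rw [hb'] at this
        simp only [id] at this
        omega
      · have : c ≠ p := fun h => hp (h ▸ hc)
        omega
    · have := hle ((wordSet w a).filter (· < p)) c (Finset.mem_filter.mpr ⟨hc, hall c hc⟩)
      rw [hb'] at this
      exact this
  · obtain ⟨b, hb, hb'⟩ := Finset.exists_mem_eq_sup _ h id
    rw [hb'] at e
    simp only [id] at e
    rw [e]
    have hle' : ∀ c ∈ wordSet w a, c ≤ b := fun c hc => by
      have := hle _ c hc
      rw [hb'] at this
      exact this
    refine ⟨hb, fun hp c hc hne => ?_, fun hall c hc => hle' c hc⟩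
    unfold IsInversionTriple
    have h2 : ¬ c < p := fun h => h1 ⟨c, Finset.mem_filter.mpr ⟨hc, h⟩⟩
    have h3 : c ≠ p := fun h => hp (h ▸ hc)
    have := hle' c hc
    omega

theorem wordSet_disjoint {w : List ℕ} {a b i : ℕ} (ha : i ∈ wordSet w a) (hb : i ∈ wordSet w b) :
    a = b := by
  rw [mem_wordSet] at ha hb
  rw [ha] at hb
  exact Option.some_injective _ hb

theorem markPos_mem {w : List ℕ} {a : ℕ} (h : (wordSet w a).Nonempty) :
    markPos w a ∈ wordSet w a := by
  cases a with
  | zero => exact (markNext_spec h).1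
  | succ a => exact (markNext_spec h).1

theorem markPos_zero_lt {w : List ℕ} (h : (wordSet w 0).Nonempty) {c : ℕ} (hc : c ∈ wordSet w 0)
    (hne : c ≠ markPos w 0) : c < markPos w 0 := by
  refine lt_of_le_of_ne ((markNext_spec h).2.2 (fun c hc => ?_) c hc) hne
  exact Finset.mem_range.mp (Finset.mem_filter.mp hc).1

theorem markPos_triple {w : List ℕ} {a c : ℕ} (h : (wordSet w a).Nonempty)
    (h' : (wordSet w (a + 1)).Nonempty) (hc : c ∈ wordSet w (a + 1))
    (hne : c ≠ markPos w (a + 1)) :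
    IsInversionTriple (markPos w a) (markPos w (a + 1)) c :=
  (markNext_spec h').2.1 (fun hp => by have := wordSet_disjoint (markPos_mem h) hp; omega) c hc hne

/-- The positions of `w` which do not belong to its first standard subword. -/
def keptPos (w : List ℕ) : List ℕ :=
  (List.range w.length).filter fun i => ∀ a < subwordLength w, i ≠ markPos w a

theorem removeSubword_eq (w : List ℕ) : removeSubword w = (keptPos w).map fun i => w.getD i 0 := by
  have h : w.zipIdx = (List.range w.length).map fun i => (w.getD i 0, i) := by
    apply List.ext_getElem
    · simp
    · intro i h1 h2
      simp at h1
      simp [h1]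
  unfold removeSubword keptPos
  rw [h, List.filter_map, List.map_map]
  rfl

theorem keptPos_sorted (w : List ℕ) : (keptPos w).Pairwise (· < ·) :=
  List.Pairwise.filter _ List.pairwise_lt_range

theorem mem_keptPos {w : List ℕ} {i : ℕ} :
    i ∈ keptPos w ↔ i < w.length ∧ ∀ a < subwordLength w, i ≠ markPos w a := by
  unfold keptPos
  rw [List.mem_filter, List.mem_range]
  simp

theorem mem_wordSet_removeSubword {w : List ℕ} {a q : ℕ} :
    q ∈ wordSet (removeSubword w) a ↔
      q < (keptPos w).length ∧ (keptPos w).getD q 0 ∈ wordSet w a := by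
  rw [mem_wordSet, mem_wordSet, removeSubword_eq, List.getElem?_map]
  by_cases hq : q < (keptPos w).length
  · rw [List.getElem?_eq_getElem hq, List.getD_eq_getElem _ _ hq]
    have := (mem_keptPos.mp (List.getElem_mem hq)).1
    simp [hq, this]
  · rw [List.getElem?_eq_none (by omega)]
    simp [hq]

theorem getD_keptPos_lt {w : List ℕ} {q q' : ℕ} (h : q < q') (h' : q' < (keptPos w).length) :
    (keptPos w).getD q 0 < (keptPos w).getD q' 0 := by
  rw [List.getD_eq_getElem _ _ h', List.getD_eq_getElem _ _ (h.trans h')]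
  exact List.pairwise_iff_getElem.mp (keptPos_sorted w) _ _ _ _ h

theorem getD_keptPos_lt_iff {w : List ℕ} {q q' : ℕ} (h : q < (keptPos w).length)
    (h' : q' < (keptPos w).length) :
    (keptPos w).getD q 0 < (keptPos w).getD q' 0 ↔ q < q' := by
  refine ⟨fun hlt => ?_, fun hlt => getD_keptPos_lt hlt h'⟩
  by_contra hn
  rcases (Nat.le_of_not_lt hn).eq_or_lt with rfl | h1
  · exact lt_irrefl _ hlt
  · have := getD_keptPos_lt h1 h
    omega

/-- Removing the subword deletes exactly one occurrence of each letter; the other occurrences are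
found again through the increasing map of the kept positions. -/
theorem wordSet_eq_insert {w : List ℕ} {a : ℕ} (hk : ∀ b, b < subwordLength w → (wordSet w b).Nonempty)
    (ha : a < subwordLength w) :
    wordSet w a = insert (markPos w a)
      ((wordSet (removeSubword w) a).image fun q => (keptPos w).getD q 0) ∧
    markPos w a ∉ (wordSet (removeSubword w) a).image fun q => (keptPos w).getD q 0 := by
  constructor
  · ext i
    rw [Finset.mem_insert, Finset.mem_image]
    constructor
    · intro hi
      by_cases h : i = markPos w a
      · exact Or.inl h
      · right
        have : i ∈ keptPos w := by
          refine mem_keptPos.mpr ⟨Finset.mem_range.mp (Finset.mem_filter.mp hi).1, ?_⟩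
          rintro b hb rfl
          have := wordSet_disjoint hi (markPos_mem (hk b hb))
          exact h (this ▸ rfl)
        obtain ⟨q, hq, rfl⟩ := List.getElem_of_mem this
        refine ⟨q, mem_wordSet_removeSubword.mpr ⟨hq, ?_⟩, ?_⟩
        · rwa [List.getD_eq_getElem _ _ hq]
        · rw [List.getD_eq_getElem _ _ hq]
    · rintro (rfl | ⟨q, hq, rfl⟩)
      · exact markPos_mem (hk a ha)
      · exact (mem_wordSet_removeSubword.mp hq).2
  · rw [Finset.mem_image]
    rintro ⟨q, hq, e⟩
    have h1 := (mem_wordSet_removeSubword.mp hq).1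
    rw [List.getD_eq_getElem _ _ h1] at e
    exact (mem_keptPos.mp (List.getElem_mem h1)).2 a ha e

/-- The successive standard subwords are the rows of a row system. Induction on their number: the
first subword becomes row `0`, and the rows of the remaining word are transported by the increasing
map `keptPos`, which preserves the triple conditions and the charge. -/
theorem exists_rowSystem_chargeAux (N n : ℕ) (w : List ℕ) (hN : ∀ a ∈ w, a < N)
    (hw : ∀ a, w.count (a + 1) ≤ w.count a) (hn : w.count 0 = n) :
    ∃ pos, RowSystem (wordSet w) pos ∧ chargeAux n w =
      ∑ i ∈ Finset.range n, rowCharge (rowLength N (fun a => w.count a) i) (pos i) := by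
  induction n generalizing w with
  | zero =>
    have h0 : ∀ a, (wordSet w a).card = 0 := fun a => by
      rw [card_wordSet]
      exact Nat.le_zero.mp (hn ▸ (antitone_nat_of_succ_le (f := fun a => w.count a) hw) (Nat.zero_le a))
    exact ⟨fun _ _ => 0, ⟨fun i j h => by simp [h0] at h, fun j => by rw [h0, h0],
      fun i i' _ h => by simp [h0] at h, fun j i i' _ h => by simp [h0] at h⟩, rfl⟩
  | succ n ih =>
    have hanti : Antitone fun a => w.count a := antitone_nat_of_succ_le hw
    have hkdef : subwordLength w = rowLength N (fun a => w.count a) 0 := by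
      unfold subwordLength rowLength
      congr 1
      ext a
      simp only [List.mem_toFinset, Finset.mem_filter, Finset.mem_range, List.count_pos_iff]
      exact ⟨fun h => ⟨hN a h, h⟩, fun h => h.2⟩
    -- Partition content makes the occurring letters an initial segment of the alphabet, so their
    -- number bounds them.
    have hklt : ∀ a, a < subwordLength w ↔ (wordSet w a).Nonempty := by
      intro a
      rw [hkdef, lt_rowLength hanti, ← Finset.card_pos, card_wordSet]
      exact ⟨fun h => h.2, fun h => ⟨hN a (List.count_pos_iff.mp h), h⟩⟩
    have hk : ∀ b, b < subwordLength w → (wordSet w b).Nonempty := fun b => (hklt b).mp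
    have hinj : ∀ a, Set.InjOn (fun q => (keptPos w).getD q 0) (wordSet (removeSubword w) a) := by
      intro a q hq q' hq' e
      have h1 := (mem_wordSet_removeSubword.mp hq).1
      have h2 := (mem_wordSet_removeSubword.mp hq').1
      simp only at e
      rcases lt_trichotomy q q' with h | h | h
      · have := getD_keptPos_lt h h2; omega
      · exact h
      · have := getD_keptPos_lt h h1; omega
    have hcard : ∀ a, (wordSet w a).card =
        (wordSet (removeSubword w) a).card + if a < subwordLength w then 1 else 0 := by
      intro a
      split_ifs with ha
      · obtain ⟨h1, h2⟩ := wordSet_eq_insert hk ha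
        rw [h1, Finset.card_insert_of_notMem h2, Finset.card_image_of_injOn (hinj a)]
      · have h1 : wordSet w a = ∅ := by
          rw [hklt, Finset.not_nonempty_iff_eq_empty] at ha
          exact ha
        rw [h1, Finset.card_empty, eq_comm, add_zero, Finset.card_eq_zero]
        refine Finset.eq_empty_of_forall_notMem fun q hq => ?_
        have := (mem_wordSet_removeSubword.mp hq).2
        rw [h1] at this
        exact absurd this (Finset.notMem_empty _)
    have hkanti : ∀ a, a + 1 < subwordLength w → a < subwordLength w := fun a h => by omega
    have hcount : ∀ a, w.count a =
        (removeSubword w).count a + if a < subwordLength w then 1 else 0 := fun a => by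
      rw [← card_wordSet, ← card_wordSet, hcard]
    have hk0 : 0 < subwordLength w := (hklt 0).mpr (by
      rw [← Finset.card_pos, card_wordSet]; omega)
    obtain ⟨pos, hpos, hch⟩ := ih (removeSubword w) (by
        intro a ha
        apply hN
        rw [removeSubword_eq] at ha
        obtain ⟨i, hi, rfl⟩ := List.mem_map.mp ha
        have := (mem_keptPos.mp hi).1
        rw [List.getD_eq_getElem _ _ this]
        exact List.getElem_mem _) (by
        intro a
        have h1 := hw a
        have h2 := hcount a
        have h3 := hcount (a + 1)
        have h4 : (removeSubword w).count (a + 1) ≤ w.count (a + 1) := by omega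
        by_cases h5 : a + 1 < subwordLength w
        · simp only [h5, hkanti a h5, if_true] at h2 h3
          omega
        · have : w.count (a + 1) = 0 := by
            rw [hklt, ← Finset.card_pos, card_wordSet] at h5
            omega
          omega) (by
        have := hcount 0
        rw [if_pos hk0] at this
        omega)
    refine ⟨fun i j => if i = 0 then markPos w j else (keptPos w).getD (pos (i - 1) j) 0, ⟨?_, ?_, ?_, ?_⟩, ?_⟩
    · intro i j hi
      have hj : j < subwordLength w := (hklt j).mpr (Finset.card_pos.mp (by omega))
      split_ifs with h0
      · exact markPos_mem (hk j hj)
      · have := hcard j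
        rw [if_pos hj] at this
        exact (mem_wordSet_removeSubword.mp (hpos.mem (i - 1) j (by omega))).2
    · intro j
      rw [card_wordSet, card_wordSet]
      exact hw j
    · intro i i' h1 h2
      have hc := hcard 0
      rw [if_pos hk0] at hc
      rw [if_neg (by omega : ¬ i' = 0)]
      have hm := hpos.mem (i' - 1) 0 (by omega)
      split_ifs with h0
      · refine markPos_zero_lt (hk 0 hk0) (mem_wordSet_removeSubword.mp hm).2 ?_
        intro e
        exact (wordSet_eq_insert hk hk0).2 (e ▸ Finset.mem_image_of_mem _ hm)
      · exact getD_keptPos_lt (hpos.first (i - 1) (i' - 1) (by omega) (by omega))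
          (mem_wordSet_removeSubword.mp (hpos.mem (i - 1) 0 (by omega))).1
    · intro j i i' h1 h2
      have hj : j + 1 < subwordLength w := (hklt _).mpr (Finset.card_pos.mp (by omega))
      have hc := hcard (j + 1)
      rw [if_pos hj] at hc
      have hc' := hcard j
      rw [if_pos (hkanti j hj)] at hc'
      rw [if_neg (by omega : ¬ i' = 0)]
      have hm := hpos.mem (i' - 1) (j + 1) (by omega)
      split_ifs with h0
      · refine markPos_triple (hk j (hkanti j hj)) (hk _ hj) (mem_wordSet_removeSubword.mp hm).2 ?_
        intro e
        exact (wordSet_eq_insert hk hj).2 (e ▸ Finset.mem_image_of_mem _ hm)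
      · have ht := hpos.triple j (i - 1) (i' - 1) (by omega) (by omega)
        have ha := hpos.anti j
        have m1 := (mem_wordSet_removeSubword.mp (hpos.mem (i - 1) j (by omega))).1
        have m2 := (mem_wordSet_removeSubword.mp (hpos.mem (i - 1) (j + 1) (by omega))).1
        have m3 := (mem_wordSet_removeSubword.mp hm).1
        unfold IsInversionTriple at ht ⊢
        have i1 := getD_keptPos_lt_iff m1 m3
        have i2 := getD_keptPos_lt_iff m3 m2
        have i3 := getD_keptPos_lt_iff m1 m2
        omega
    · rw [Finset.sum_range_succ']
      simp only [Nat.add_eq_zero_iff, one_ne_zero, and_false, if_false, if_true, Nat.add_sub_cancel]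
      rw [show chargeAux (n + 1) w = permCharge (subwordLength w) (markPos w) +
        chargeAux n (removeSubword w) from rfl, hch, ← hkdef,
        add_comm (permCharge _ _)]
      congr 1
      refine Finset.sum_congr rfl fun i hi => ?_
      have e1 : rowLength N (fun a => w.count a) (i + 1) =
          rowLength N (fun a => (removeSubword w).count a) i := by
        unfold rowLength
        congr 1
        ext t
        simp only [Finset.mem_filter, Finset.mem_range, and_congr_right_iff]
        intro _
        have h1 := hcount t
        by_cases h5 : t < subwordLength w
        · rw [if_pos h5] at h1
          omega
        · rw [if_neg h5] at h1
          rw [hklt, ← Finset.card_pos, card_wordSet] at h5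
          omega
      -- The charge of a row depends only on the relative order of its positions.
      have e2 : ∀ (k : ℕ) (p p' : ℕ → ℕ), (∀ j, j < k → ∀ j', j' < k → (p j < p j' ↔ p' j < p' j')) →
          rowCharge k p = rowCharge k p' := by
        intro k p p' h
        unfold rowCharge
        congr 1
        ext j
        simp only [Finset.mem_filter, Finset.mem_range, and_congr_right_iff]
        intro hj
        exact h j (by omega) (j + 1) (by omega)
      rw [e1]
      refine e2 _ _ _ fun j hj j' hj' => ?_
      have hanti' : Antitone fun a => (removeSubword w).count a := by
        have := hpos.antitone
        simpa only [card_wordSet] using this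
      rw [lt_rowLength hanti', ← card_wordSet] at hj hj'
      exact (getD_keptPos_lt_iff (mem_wordSet_removeSubword.mp (hpos.mem i j hj.2)).1
        (mem_wordSet_removeSubword.mp (hpos.mem i j' hj'.2)).1).symm

/-- The charge of a word with partition content. -/
theorem charge_eq_chargeSum {N : ℕ} {w : List ℕ} (hN : ∀ a ∈ w, a < N)
    (hw : ∀ a, w.count (a + 1) ≤ w.count a) : charge w = chargeSum N (singles w) := by
  obtain ⟨pos, h1, h2⟩ := exists_rowSystem_chargeAux N _ w hN hw rfl
  rw [← levelSet_singles] at h1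
  rw [charge, h2, h1.chargeSum_eq, cnt_singles]
  simp only [← cnt_singles]

end

section

/-! ### Crystal operators on paths -/

/-- The height at `k` of the path with steps `s` which starts at `a`. -/
def height (a : ℕ) (s : ℕ → ℤ) (k : ℕ) : ℤ := ∑ i ∈ Finset.Ico a k, s i

theorem height_self (a : ℕ) (s : ℕ → ℤ) : height a s a = 0 := by simp [height]

theorem height_succ {a k : ℕ} (h : a ≤ k) (s : ℕ → ℤ) :
    height a s (k + 1) = height a s k + s k := Finset.sum_Ico_succ_top h _

/-- The depth of a path below its starting height. -/
def depth (a b : ℕ) (s : ℕ → ℤ) : ℕ := (Finset.Icc a b).sup fun k => (-height a s k).toNat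

theorem neg_depth_le {a b k : ℕ} {s : ℕ → ℤ} (h1 : a ≤ k) (h2 : k ≤ b) :
    -(depth a b s : ℤ) ≤ height a s k := by
  have := Finset.le_sup (f := fun k => (-height a s k).toNat) (Finset.mem_Icc.mpr ⟨h1, h2⟩)
  unfold depth
  omega

theorem exists_height_eq {a b : ℕ} (hab : a ≤ b) (s : ℕ → ℤ) :
    ∃ k, a ≤ k ∧ k ≤ b ∧ height a s k = -(depth a b s : ℤ) := by
  obtain ⟨k, hk, h⟩ := Finset.exists_mem_eq_sup (Finset.Icc a b) ⟨a, by simp [hab]⟩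
    fun k => (-height a s k).toNat
  have h' : depth a b s = (-height a s k).toNat := h
  obtain ⟨h1, h2⟩ := Finset.mem_Icc.mp hk
  by_cases h3 : 0 ≤ -height a s k
  · exact ⟨k, h1, h2, by omega⟩
  · exact ⟨a, le_rfl, hab, by rw [height_self]; omega⟩

theorem depth_eq {a b : ℕ} {s : ℕ → ℤ} {e : ℕ} (h1 : ∀ k, a ≤ k → k ≤ b → -(e : ℤ) ≤ height a s k)
    (h2 : ∃ k, a ≤ k ∧ k ≤ b ∧ height a s k = -(e : ℤ)) : depth a b s = e := by
  obtain ⟨k, hk1, hk2, hk⟩ := h2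
  have h3 := neg_depth_le (s := s) hk1 hk2
  obtain ⟨l, hl1, hl2, hl⟩ := exists_height_eq (hk1.trans hk2) s
  have h4 := h1 l hl1 hl2
  omega

/-- The first time at which the path reaches its minimum. -/
def firstMin (a b : ℕ) (s : ℕ → ℤ) : ℕ :=
  sInf {k | a ≤ k ∧ k ≤ b ∧ height a s k = -(depth a b s : ℤ)}

/-- The last time at which the path is at its minimum. -/
def lastMin (a b : ℕ) (s : ℕ → ℤ) : ℕ :=
  sSup {k | a ≤ k ∧ k ≤ b ∧ height a s k = -(depth a b s : ℤ)}

theorem firstMin_spec {a b : ℕ} (hab : a ≤ b) (s : ℕ → ℤ) : a ≤ firstMin a b s ∧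
    firstMin a b s ≤ b ∧ height a s (firstMin a b s) = -(depth a b s : ℤ) :=
  Nat.sInf_mem (s := {k | a ≤ k ∧ k ≤ b ∧ height a s k = -(depth a b s : ℤ)})
    (exists_height_eq hab s)

theorem lt_height_of_lt_firstMin {a b k : ℕ} {s : ℕ → ℤ} (h1 : a ≤ k) (h2 : k ≤ b)
    (h : k < firstMin a b s) : -(depth a b s : ℤ) < height a s k := by
  refine lt_of_le_of_ne (neg_depth_le h1 h2) fun e => ?_
  exact Nat.notMem_of_lt_sInf h ⟨h1, h2, e.symm⟩

theorem firstMin_eq {a b k : ℕ} {s : ℕ → ℤ} (h1 : a ≤ k) (h2 : k ≤ b)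
    (h : height a s k = -(depth a b s : ℤ))
    (h' : ∀ i, a ≤ i → i < k → -(depth a b s : ℤ) < height a s i) : firstMin a b s = k := by
  obtain ⟨g1, g2, g3⟩ := firstMin_spec (h1.trans h2) s
  rcases lt_trichotomy (firstMin a b s) k with c | c | c
  · have := h' _ g1 c
    omega
  · exact c
  · have := lt_height_of_lt_firstMin h1 h2 c
    omega

theorem bddAbove_argmin (a b : ℕ) (s : ℕ → ℤ) :
    BddAbove {k | a ≤ k ∧ k ≤ b ∧ height a s k = -(depth a b s : ℤ)} := ⟨b, fun _ h => h.2.1⟩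

theorem lastMin_spec {a b : ℕ} (hab : a ≤ b) (s : ℕ → ℤ) : a ≤ lastMin a b s ∧
    lastMin a b s ≤ b ∧ height a s (lastMin a b s) = -(depth a b s : ℤ) :=
  Nat.sSup_mem (s := {k | a ≤ k ∧ k ≤ b ∧ height a s k = -(depth a b s : ℤ)})
    (exists_height_eq hab s) (bddAbove_argmin a b s)

theorem lt_height_of_lastMin_lt {a b k : ℕ} {s : ℕ → ℤ} (h1 : a ≤ k) (h2 : k ≤ b)
    (h : lastMin a b s < k) : -(depth a b s : ℤ) < height a s k := by
  refine lt_of_le_of_ne (neg_depth_le h1 h2) fun e => ?_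
  have := le_csSup (bddAbove_argmin a b s) ⟨h1, h2, e.symm⟩
  exact absurd this (not_le.mpr h)

theorem lastMin_eq {a b k : ℕ} {s : ℕ → ℤ} (h1 : a ≤ k) (h2 : k ≤ b)
    (h : height a s k = -(depth a b s : ℤ))
    (h' : ∀ i, k < i → i ≤ b → -(depth a b s : ℤ) < height a s i) : lastMin a b s = k := by
  obtain ⟨g1, g2, g3⟩ := lastMin_spec (h1.trans h2) s
  rcases lt_trichotomy (lastMin a b s) k with c | c | c
  · have := lt_height_of_lastMin_lt h1 h2 c
    omega
  · exact c
  · have := h' _ c g2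
    omega

/-- The path `s` with the step `k` reversed. -/
def negStep (k : ℕ) (s : ℕ → ℤ) : ℕ → ℤ := fun i => if i = k then -s k else s i

theorem height_negStep {a k : ℕ} (hk : a ≤ k) (s : ℕ → ℤ) (l : ℕ) :
    height a (negStep k s) l = height a s l - if k < l then 2 * s k else 0 := by
  unfold height
  have : ∀ i, negStep k s i = s i - if i = k then 2 * s k else 0 := by
    intro i
    unfold negStep
    split_ifs with h
    · subst h; ring
    · ring
  simp only [this]
  rw [Finset.sum_sub_distrib, Finset.sum_ite_eq']
  simp [hk]

section

variable {a b : ℕ} {s : ℕ → ℤ}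

/-- Before its first minimum the path stays strictly above it, so the step into this minimum goes
down. Reversing it raises the rest of the path by two: the depth drops by one and the new last
minimum is where the step begins, so the lowering operator finds the same step again. -/
theorem raise_path (hab : a ≤ b) (hs : ∀ i, -1 ≤ s i ∧ s i ≤ 1) (h : 0 < depth a b s) :
    ∃ k, firstMin a b s = k + 1 ∧ a ≤ k ∧ k < b ∧ s k = -1 ∧
      depth a b (negStep k s) + 1 = depth a b s ∧ lastMin a b (negStep k s) = k ∧
      height a (negStep k s) b = height a s b + 2 := by
  obtain ⟨g1, g2, g3⟩ := firstMin_spec hab s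
  have hne : a ≠ firstMin a b s := fun e => by rw [← e, height_self] at g3; omega
  obtain ⟨k, hk⟩ := Nat.exists_eq_succ_of_ne_zero (show firstMin a b s ≠ 0 by omega)
  rw [Nat.succ_eq_add_one] at hk
  have h1 := lt_height_of_lt_firstMin (a := a) (b := b) (s := s) (k := k) (by omega) (by omega)
    (by omega)
  rw [hk, height_succ (by omega)] at g3
  have h2 := hs k
  have hsk : s k = -1 := by omega
  have hd : depth a b (negStep k s) = depth a b s - 1 := by
    refine depth_eq (fun l hl1 hl2 => ?_) ⟨k, by omega, by omega, ?_⟩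
    · rw [height_negStep (by omega), hsk]
      split_ifs with c
      · have := neg_depth_le (s := s) hl1 hl2; omega
      · have := lt_height_of_lt_firstMin (s := s) hl1 hl2 (by omega); omega
    · rw [height_negStep (by omega), if_neg (lt_irrefl _)]
      omega
  refine ⟨k, hk, by omega, by omega, hsk, by omega, ?_, ?_⟩
  · refine lastMin_eq (by omega) (by omega) ?_ fun i hi1 hi2 => ?_
    · rw [height_negStep (by omega), if_neg (lt_irrefl _), hd]
      omega
    · rw [height_negStep (by omega), if_pos hi1, hd, hsk]
      have := neg_depth_le (s := s) (a := a) (by omega) hi2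
      omega
  · rw [height_negStep (by omega), if_pos (by omega), hsk]
    ring

/-- Inverse to `raise_path`: the step after the last minimum goes up, and when it is reversed its
end becomes the first minimum of the new path. -/
theorem lower_path (hab : a ≤ b) (hs : ∀ i, -1 ≤ s i ∧ s i ≤ 1)
    (h : 0 < depth a b s + height a s b) :
    ∃ k, lastMin a b s = k ∧ a ≤ k ∧ k < b ∧ s k = 1 ∧
      depth a b (negStep k s) = depth a b s + 1 ∧ firstMin a b (negStep k s) = k + 1 ∧
      height a (negStep k s) b = height a s b - 2 := by
  obtain ⟨g1, g2, g3⟩ := lastMin_spec hab s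
  have hne : b ≠ lastMin a b s := fun e => by rw [← e] at g3; omega
  obtain ⟨k, hk⟩ : ∃ k, lastMin a b s = k := ⟨_, rfl⟩
  rw [hk] at g1 g2 g3 hne
  have h1 := lt_height_of_lastMin_lt (a := a) (b := b) (s := s) (k := k + 1) (by omega) (by omega)
    (by omega)
  rw [height_succ (by omega)] at h1
  have h2 := hs k
  have hsk : s k = 1 := by omega
  have hd : depth a b (negStep k s) = depth a b s + 1 := by
    refine depth_eq (fun l hl1 hl2 => ?_) ⟨k + 1, by omega, by omega, ?_⟩
    · rw [height_negStep (by omega), hsk]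
      split_ifs with c
      · have := lt_height_of_lastMin_lt (s := s) hl1 hl2 (by omega); push_cast; omega
      · have := neg_depth_le (s := s) hl1 hl2; push_cast; omega
    · rw [height_negStep (by omega), if_pos (Nat.lt_succ_self _), height_succ (by omega)]
      push_cast
      omega
  refine ⟨k, hk, by omega, by omega, hsk, hd, ?_, ?_⟩
  · refine firstMin_eq (by omega) (by omega) ?_ fun i hi1 hi2 => ?_
    · rw [height_negStep (by omega), if_pos (Nat.lt_succ_self _), hd, height_succ (by omega)]
      push_cast
      omega
    · rw [height_negStep (by omega), if_neg (by omega), hd]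
      have := neg_depth_le (s := s) (b := b) hi1 (by omega)
      push_cast
      omega
  · rw [height_negStep (by omega), if_pos (by omega), hsk]
    ring

end

/-! ### Crystal operators on families of blocks -/

variable {m : ℕ}

/-- The steps `1` for letters in the block `u`, `-1` for letters in the block `v`. -/
def step (u v : Fin m) (B : Fin m → Finset ℕ) (i : ℕ) : ℤ :=
  (if i ∈ B u then 1 else 0) - if i ∈ B v then 1 else 0

/-- The blocks `u` and `v` are interchanged with respect to the letter `k`. -/
def flip (u v : Fin m) (k : ℕ) (B : Fin m → Finset ℕ) : Fin m → Finset ℕ := fun y =>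
  if k ∈ B (Equiv.swap u v y) then insert k (B y) else (B y).erase k

theorem mem_flip {u v y : Fin m} {k j : ℕ} {B : Fin m → Finset ℕ} :
    j ∈ flip u v k B y ↔ if j = k then j ∈ B (Equiv.swap u v y) else j ∈ B y := by
  unfold flip
  by_cases h : j = k
  · subst h
    rw [if_pos rfl]
    split_ifs with h' <;> simp [h']
  · split_ifs <;> simp [h]

theorem flip_flip (u v : Fin m) (k : ℕ) (B : Fin m → Finset ℕ) :
    flip u v k (flip u v k B) = B := by
  funext y
  ext j
  rw [mem_flip, mem_flip, mem_flip, Equiv.swap_apply_self]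
  split_ifs <;> rfl

theorem step_flip (u v : Fin m) (k : ℕ) (B : Fin m → Finset ℕ) :
    step u v (flip u v k B) = negStep k (step u v B) := by
  funext i
  unfold step negStep
  simp only [mem_flip, Equiv.swap_apply_left, Equiv.swap_apply_right]
  by_cases h : i = k
  · subst h; simp
  · simp [h]

theorem step_bound (u v : Fin m) (B : Fin m → Finset ℕ) (i : ℕ) :
    -1 ≤ step u v B i ∧ step u v B i ≤ 1 := by
  unfold step; split_ifs <;> omega

/-- The unmatched letters of the block `u` from the letter `a` on. -/
def free (a b : ℕ) (s : ℕ → ℤ) : ℕ := (depth a b s + height a s b).toNat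

theorem coe_free {a b : ℕ} (hab : a ≤ b) (s : ℕ → ℤ) :
    (free a b s : ℤ) = depth a b s + height a s b := by
  have := neg_depth_le (s := s) hab le_rfl
  unfold free
  omega

/-- The raising operator, restricted to the letters in `[a, b)`. -/
def raiseOp (a b : ℕ) (u v : Fin m) (B : Fin m → Finset ℕ) : Fin m → Finset ℕ :=
  flip u v (firstMin a b (step u v B) - 1) B

/-- The lowering operator, restricted to the letters in `[a, b)`. -/
def lowerOp (a b : ℕ) (u v : Fin m) (B : Fin m → Finset ℕ) : Fin m → Finset ℕ :=
  flip u v (lastMin a b (step u v B)) B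

/-- The crystal reflection, restricted to the letters in `[a, b)`. -/
def reflect (a b : ℕ) (u v : Fin m) (B : Fin m → Finset ℕ) : Fin m → Finset ℕ :=
  if free a b (step u v B) ≤ depth a b (step u v B) then
    (raiseOp a b u v)^[depth a b (step u v B) - free a b (step u v B)] B
  else (lowerOp a b u v)^[free a b (step u v B) - depth a b (step u v B)] B

section

variable {a b : ℕ} {u v : Fin m}

theorem raiseOp_spec (hab : a ≤ b) {B : Fin m → Finset ℕ} (h : 0 < depth a b (step u v B)) :
    ∃ k, a ≤ k ∧ k < b ∧ firstMin a b (step u v B) = k + 1 ∧ step u v B k = -1 ∧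
      raiseOp a b u v B = flip u v k B ∧
      depth a b (step u v (raiseOp a b u v B)) + 1 = depth a b (step u v B) ∧
      free a b (step u v (raiseOp a b u v B)) = free a b (step u v B) + 1 ∧
      lowerOp a b u v (raiseOp a b u v B) = B := by
  obtain ⟨k, h1, h2, h3, h4, h5, h6, h7⟩ := raise_path hab (step_bound u v B) h
  have e : raiseOp a b u v B = flip u v k B := by rw [raiseOp, h1, Nat.add_sub_cancel]
  refine ⟨k, h2, h3, h1, h4, e, ?_, ?_, ?_⟩
  · rw [e, step_flip, h5]
  · rw [← Nat.cast_inj (R := ℤ)]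
    push_cast
    rw [coe_free hab, coe_free hab, e, step_flip, h7]
    omega
  · rw [e, lowerOp, step_flip, h6, flip_flip]

theorem lowerOp_spec (hab : a ≤ b) {B : Fin m → Finset ℕ} (h : 0 < free a b (step u v B)) :
    ∃ k, a ≤ k ∧ k < b ∧ lowerOp a b u v B = flip u v k B ∧
      depth a b (step u v (lowerOp a b u v B)) = depth a b (step u v B) + 1 ∧
      free a b (step u v (lowerOp a b u v B)) + 1 = free a b (step u v B) ∧
      raiseOp a b u v (lowerOp a b u v B) = B := by
  have hf := coe_free hab (step u v B)
  obtain ⟨k, h1, h2, h3, h4, h5, h6, h7⟩ := lower_path hab (step_bound u v B) (by omega)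
  have e : lowerOp a b u v B = flip u v k B := by rw [lowerOp, h1]
  refine ⟨k, h2, h3, e, ?_, ?_, ?_⟩
  · rw [e, step_flip, h5]
  · rw [← Nat.cast_inj (R := ℤ)]
    push_cast
    rw [coe_free hab, coe_free hab, e, step_flip, h7]
    omega
  · rw [e, raiseOp, step_flip, h6, Nat.add_sub_cancel, flip_flip]

theorem iterate_raiseOp (hab : a ≤ b) (P : (Fin m → Finset ℕ) → Prop)
    (hP : ∀ B, 0 < depth a b (step u v B) → P B → P (raiseOp a b u v B))
    {B : Fin m → Finset ℕ} (hB : P B) (n : ℕ) (hn : n ≤ depth a b (step u v B)) :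
    depth a b (step u v ((raiseOp a b u v)^[n] B)) + n = depth a b (step u v B) ∧
    free a b (step u v ((raiseOp a b u v)^[n] B)) = free a b (step u v B) + n ∧
    (lowerOp a b u v)^[n] ((raiseOp a b u v)^[n] B) = B ∧ P ((raiseOp a b u v)^[n] B) := by
  induction n with
  | zero => exact ⟨rfl, rfl, rfl, hB⟩
  | succ n ih =>
    obtain ⟨h1, h2, h3, h4⟩ := ih (by omega)
    have hpos : 0 < depth a b (step u v ((raiseOp a b u v)^[n] B)) := by omega
    obtain ⟨k, -, -, -, -, -, g1, g2, g3⟩ := raiseOp_spec hab hpos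
    rw [Function.iterate_succ_apply', Function.iterate_succ_apply, g3]
    exact ⟨by omega, by omega, h3, hP _ hpos h4⟩

theorem iterate_lowerOp (hab : a ≤ b) (P : (Fin m → Finset ℕ) → Prop)
    (hP : ∀ B, 0 < free a b (step u v B) → P B → P (lowerOp a b u v B))
    {B : Fin m → Finset ℕ} (hB : P B) (n : ℕ) (hn : n ≤ free a b (step u v B)) :
    depth a b (step u v ((lowerOp a b u v)^[n] B)) = depth a b (step u v B) + n ∧
    free a b (step u v ((lowerOp a b u v)^[n] B)) + n = free a b (step u v B) ∧
    (raiseOp a b u v)^[n] ((lowerOp a b u v)^[n] B) = B ∧ P ((lowerOp a b u v)^[n] B) := by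
  induction n with
  | zero => exact ⟨rfl, rfl, rfl, hB⟩
  | succ n ih =>
    obtain ⟨h1, h2, h3, h4⟩ := ih (by omega)
    have hpos : 0 < free a b (step u v ((lowerOp a b u v)^[n] B)) := by omega
    obtain ⟨k, -, -, -, g1, g2, g3⟩ := lowerOp_spec hab hpos
    rw [Function.iterate_succ_apply', Function.iterate_succ_apply, g3]
    exact ⟨by omega, by omega, h3, hP _ hpos h4⟩

/-- Raising and lowering move along a string on which the sum of `depth` and `free` is constant; the
reflection goes to the opposite place of the string. The predicate `P` collects whatever single
steps preserve. -/
theorem reflect_spec (hab : a ≤ b) (P : (Fin m → Finset ℕ) → Prop)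
    (hP : ∀ B, 0 < depth a b (step u v B) → P B → P (raiseOp a b u v B))
    (hP' : ∀ B, 0 < free a b (step u v B) → P B → P (lowerOp a b u v B))
    {B : Fin m → Finset ℕ} (hB : P B) :
    height a (step u v (reflect a b u v B)) b = -height a (step u v B) b ∧
    reflect a b u v (reflect a b u v B) = B ∧ P (reflect a b u v B) := by
  have e1 := coe_free hab (step u v B)
  have e2 := coe_free hab (step u v (reflect a b u v B))
  by_cases h : free a b (step u v B) ≤ depth a b (step u v B)
  · obtain ⟨h1, h2, h3, h4⟩ := iterate_raiseOp hab P hP hB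
      (depth a b (step u v B) - free a b (step u v B)) (by omega)
    have e : reflect a b u v B =
        (raiseOp a b u v)^[depth a b (step u v B) - free a b (step u v B)] B := if_pos h
    rw [← e] at h1 h2 h3 h4
    refine ⟨by omega, ?_, h4⟩
    rcases h.eq_or_lt with h' | h'
    · have : reflect a b u v B = B := by rw [e, h', Nat.sub_self]; rfl
      rw [this, this]
    · rw [reflect, if_neg (by omega)]
      -- The reflection has exchanged `depth` and `free`, so the second reflection makes equally
      -- many steps of the opposite kind.
      have : free a b (step u v (reflect a b u v B)) - depth a b (step u v (reflect a b u v B)) =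
        depth a b (step u v B) - free a b (step u v B) := by omega
      rw [this, h3]
  · obtain ⟨h1, h2, h3, h4⟩ := iterate_lowerOp hab P hP' hB
      (free a b (step u v B) - depth a b (step u v B)) (by omega)
    have e : reflect a b u v B =
        (lowerOp a b u v)^[free a b (step u v B) - depth a b (step u v B)] B := if_neg h
    rw [← e] at h1 h2 h3 h4
    refine ⟨by omega, ?_, h4⟩
    rw [reflect, if_pos (by omega)]
    have : depth a b (step u v (reflect a b u v B)) - free a b (step u v (reflect a b u v B)) =
        free a b (step u v B) - depth a b (step u v B) := by omega
    rw [this, h3]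

end

theorem sum_step (u v : Fin m) (B : Fin m → Finset ℕ) (T : Finset ℕ) :
    ∑ i ∈ T, step u v B i = ((B u ∩ T).card : ℤ) - (B v ∩ T).card := by
  have h : ∀ S : Finset ℕ, ((S ∩ T).card : ℤ) = ∑ i ∈ T, if i ∈ S then 1 else 0 := by
    intro S
    rw [Finset.inter_comm, ← Finset.filter_mem_eq_inter, Finset.card_filter]
    push_cast
    rfl
  unfold step
  rw [Finset.sum_sub_distrib, ← h, ← h]

/-- A change of two neighbouring members of a family is a change of two neighbouring blocks of the
list, as required by `BlockStep.raise`. -/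
theorem ofFn_split {u v : Fin m} (huv : (v : ℕ) = u + 1) {B B' : Fin m → Finset ℕ}
    (h : ∀ y, y ≠ u → y ≠ v → B' y = B y) :
    ∃ A Z, List.ofFn B = A ++ B u :: B v :: Z ∧ List.ofFn B' = A ++ B' u :: B' v :: Z := by
  have key : ∀ B : Fin m → Finset ℕ, List.ofFn B =
      (List.ofFn B).take u ++ B u :: B v :: (List.ofFn B).drop (u + 2) := by
    intro B
    have h1 : (u : ℕ) < (List.ofFn B).length := by simp
    have h2 : (u : ℕ) + 1 < (List.ofFn B).length := by rw [← huv]; simp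
    conv_lhs => rw [← List.take_append_drop u (List.ofFn B), List.drop_eq_getElem_cons h1,
      List.drop_eq_getElem_cons h2]
    congr 2
    · simp
    · congr 1
      rw [List.getElem_ofFn]
      congr 1
      exact Fin.ext huv.symm
  refine ⟨(List.ofFn B).take u, (List.ofFn B).drop (u + 2), key B, ?_⟩
  rw [key B']
  congr 1
  · apply List.ext_getElem
    · simp
    · intro i h1 h2
      simp only [List.length_take, List.length_ofFn] at h1
      rw [List.getElem_take, List.getElem_take, List.getElem_ofFn, List.getElem_ofFn]
      apply h
      · intro e; have := congrArg Fin.val e; simp at this; omega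
      · intro e; have := congrArg Fin.val e; simp at this; omega
  · congr 2
    apply List.ext_getElem
    · simp
    · intro i h1 h2
      rw [List.getElem_drop, List.getElem_drop, List.getElem_ofFn, List.getElem_ofFn]
      apply h
      · intro e; have := congrArg Fin.val e; simp at this; omega
      · intro e; have := congrArg Fin.val e; simp at this; omega

/-- In every interval of letters which ends before `a` there are at least as many letters in the
block `v` as in the block `u`. -/
def TailCond (a : ℕ) (u v : Fin m) (B : Fin m → Finset ℕ) : Prop :=
  ∀ i < a, ∑ k ∈ Finset.Ico i a, step u v B k ≤ 0

theorem step_flip_of_lt {a k : ℕ} {u v : Fin m} {B : Fin m → Finset ℕ} (hk : a ≤ k) {i : ℕ}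
    (hi : i < a) : step u v (flip u v k B) i = step u v B i := by
  rw [step_flip, negStep, if_neg (by omega)]

theorem TailCond.flip {a k : ℕ} {u v : Fin m} {B : Fin m → Finset ℕ} (h : TailCond a u v B)
    (hk : a ≤ k) : TailCond a u v (flip u v k B) := by
  intro i hi
  refine le_trans (le_of_eq ?_) (h i hi)
  exact Finset.sum_congr rfl fun j hj => step_flip_of_lt hk (Finset.mem_Ico.mp hj).2

/-- The operator only looks at letters from `a` on, but `CanRaise` concerns all letters. Intervals
starting below `a` are harmless because `TailCond` says that the part below `a` never favours `u`.
The remaining conditions express that the path reaches its minimum for the first time right after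
the step `k`. -/
theorem raiseOp_equiv {a b : ℕ} {u v : Fin m} (hab : a ≤ b) (huv : (v : ℕ) = u + 1)
    {B : Fin m → Finset ℕ} (hB : ∀ y, B y ⊆ Finset.range b) (ht : TailCond a u v B)
    (h : 0 < depth a b (step u v B)) :
    BlockEquiv (List.ofFn B) (List.ofFn (raiseOp a b u v B)) := by
  obtain ⟨k, hk1, hk2, hfm, hst, e, -, -, -⟩ := raiseOp_spec hab h
  have hvu : v ≠ u := fun e => by rw [e] at huv; omega
  have hkv : k ∈ B v ∧ k ∉ B u := by
    unfold step at hst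
    split_ifs at hst with c1 c2 c2 <;> first | omega | exact ⟨c2, c1⟩
  obtain ⟨A, Z, h1, h2⟩ := ofFn_split huv (B := B) (B' := flip u v k B) (by
    intro y hy1 hy2
    ext j
    rw [mem_flip, Equiv.swap_apply_of_ne_of_ne hy1 hy2]
    split_ifs <;> rfl)
  have e1 : flip u v k B u = insert k (B u) := by
    rw [flip, Equiv.swap_apply_left, if_pos hkv.1]
  have e2 : flip u v k B v = (B v).erase k := by
    rw [flip, Equiv.swap_apply_right, if_neg hkv.2]
  obtain ⟨g1, g2, g3⟩ := firstMin_spec hab (step u v B)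
  rw [hfm] at g1 g2 g3
  -- The blocks contain no letters from `b` on, so the path is constant there and its minimum is
  -- global.
  have hbig : ∀ l, b ≤ l → height a (step u v B) l = height a (step u v B) b := by
    intro l hl
    unfold height
    symm
    apply Finset.sum_subset (Finset.Ico_subset_Ico le_rfl hl)
    intro i hi hi'
    have : b ≤ i := by simp only [Finset.mem_Ico] at hi hi'; omega
    have hn : ∀ y, i ∉ B y := fun y hy => by
      have := Finset.mem_range.mp (hB y hy); omega
    simp [step, hn]
  have hge : ∀ l, a ≤ l → -(depth a b (step u v B) : ℤ) ≤ height a (step u v B) l := by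
    intro l hl
    by_cases hlb : l ≤ b
    · exact neg_depth_le hl hlb
    · rw [hbig l (by omega)]; exact neg_depth_le hab le_rfl
  rw [e, h1, h2, e1, e2]
  refine .of_step (.raise _ _ _ _ _ ⟨hkv.1, hkv.2, fun i hi => ?_, fun j hj => ?_⟩)
  · have : ∑ l ∈ Finset.Icc i k, step u v B l < 0 := by
      have hIcc : Finset.Icc i k = Finset.Ico i (k + 1) := by
        ext l; simp only [Finset.mem_Icc, Finset.mem_Ico]; omega
      rw [hIcc]
      by_cases hia : a ≤ i
      · have e3 := Finset.sum_Ico_consecutive (step u v B) hia (show i ≤ k + 1 by omega)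
        have e4 := lt_height_of_lt_firstMin (s := step u v B) (b := b) hia (by omega) (by omega)
        unfold height at g3 e4
        omega
      · have e3 := Finset.sum_Ico_consecutive (step u v B) (show i ≤ a by omega)
          (show a ≤ k + 1 by omega)
        have e4 := ht i (by omega)
        unfold height at g3
        omega
    rw [sum_step] at this
    omega
  · have : 0 ≤ ∑ l ∈ Finset.Ioc k j, step u v B l := by
      have hIoc : Finset.Ioc k j = Finset.Ico (k + 1) (j + 1) := by
        ext l; simp only [Finset.mem_Ioc, Finset.mem_Ico]; omega
      rw [hIoc]
      have e3 := Finset.sum_Ico_consecutive (step u v B) (show a ≤ k + 1 by omega)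
        (show k + 1 ≤ j + 1 by omega)
      have e4 := hge (j + 1) (by omega)
      unfold height at g3 e4
      omega
    rw [sum_step] at this
    omega

theorem flip_subset {u v : Fin m} {k b : ℕ} (hk : k < b) {B : Fin m → Finset ℕ}
    (hB : ∀ y, B y ⊆ Finset.range b) (y : Fin m) : flip u v k B y ⊆ Finset.range b := by
  intro j hj
  rw [mem_flip] at hj
  split_ifs at hj with h
  · rw [h]; exact Finset.mem_range.mpr hk
  · exact hB y hj

/-- The number of blocks of the family `B` which contain `j`. -/
def levelCard (B : Fin m → Finset ℕ) (j : ℕ) : ℕ :=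
  (Finset.univ.filter fun x => j ∈ B x).card

theorem levelCard_flip (u v : Fin m) (k : ℕ) (B : Fin m → Finset ℕ) (j : ℕ) :
    levelCard (flip u v k B) j = levelCard B j := by
  unfold levelCard
  by_cases h : j = k
  · subst h
    rw [← Finset.card_map (Equiv.swap u v).toEmbedding]
    congr 1
    ext y
    simp [mem_flip]
  · congr 1
    ext y
    simp [mem_flip, h]

theorem card_flip_add (u v : Fin m) (k : ℕ) (B : Fin m → Finset ℕ) :
    (flip u v k B u).card + (flip u v k B v).card = (B u).card + (B v).card := by
  unfold flip
  rw [Equiv.swap_apply_left, Equiv.swap_apply_right]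
  by_cases h1 : k ∈ B u <;> by_cases h2 : k ∈ B v <;> simp only [h1, h2, if_true, if_false]
  · rw [Finset.insert_eq_of_mem h1, Finset.insert_eq_of_mem h2]
  · rw [Finset.card_erase_of_mem h1, Finset.card_insert_of_notMem h2]
    have := Finset.card_pos.mpr ⟨k, h1⟩
    omega
  · rw [Finset.card_erase_of_mem h2, Finset.card_insert_of_notMem h1]
    have := Finset.card_pos.mpr ⟨k, h2⟩
    omega
  · rw [Finset.erase_eq_of_notMem h1, Finset.erase_eq_of_notMem h2]

theorem flip_apply_of_ne {u v y : Fin m} (h1 : y ≠ u) (h2 : y ≠ v) (k : ℕ)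
    (B : Fin m → Finset ℕ) : flip u v k B y = B y := by
  ext j
  rw [mem_flip, Equiv.swap_apply_of_ne_of_ne h1 h2]
  split_ifs <;> rfl

/-- The reflection of the letters from `a` on: an involution which preserves the block word up to
equivalence. -/
theorem reflect_properties {a b : ℕ} {u v : Fin m} (hab : a ≤ b) (huv : (v : ℕ) = u + 1)
    {B : Fin m → Finset ℕ} (hB : ∀ y, B y ⊆ Finset.range b) (ht : TailCond a u v B) :
    height a (step u v (reflect a b u v B)) b = -height a (step u v B) b ∧
    reflect a b u v (reflect a b u v B) = B ∧
    (∀ y, reflect a b u v B y ⊆ Finset.range b) ∧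
    BlockEquiv (List.ofFn B) (List.ofFn (reflect a b u v B)) ∧
    (∀ j, levelCard (reflect a b u v B) j = levelCard B j) ∧
    ((reflect a b u v B u).card + (reflect a b u v B v).card = (B u).card + (B v).card) ∧
    (∀ y, y ≠ u → y ≠ v → reflect a b u v B y = B y) ∧
    (∀ j < a, ∀ y, j ∈ reflect a b u v B y ↔ j ∈ B y) := by
  obtain ⟨h1, h2, h3, -, h5, h6, h7, h8, h9⟩ := reflect_spec (u := u) (v := v) hab
    (fun B' => (∀ y, B' y ⊆ Finset.range b) ∧ TailCond a u v B' ∧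
      BlockEquiv (List.ofFn B) (List.ofFn B') ∧ (∀ j, levelCard B' j = levelCard B j) ∧
      ((B' u).card + (B' v).card = (B u).card + (B v).card) ∧
      (∀ y, y ≠ u → y ≠ v → B' y = B y) ∧ (∀ j < a, ∀ y, j ∈ B' y ↔ j ∈ B y))
    (by
      rintro B' hpos ⟨p1, p2, p3, p4, p5, p6, p7⟩
      have he := raiseOp_equiv hab huv p1 p2 hpos
      obtain ⟨k, hk1, hk2, -, -, e, -⟩ := raiseOp_spec hab hpos
      rw [e] at he ⊢
      refine ⟨flip_subset hk2 p1, p2.flip hk1, p3.trans he, fun j => ?_, ?_, fun y y1 y2 => ?_,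
        fun j hj y => ?_⟩
      · rw [levelCard_flip, p4]
      · rw [card_flip_add, p5]
      · rw [flip_apply_of_ne y1 y2, p6 y y1 y2]
      · rw [mem_flip, if_neg (by omega), p7 j hj])
    (by
      rintro B' hpos ⟨p1, p2, p3, p4, p5, p6, p7⟩
      obtain ⟨k, hk1, hk2, e, g1, g2, g3⟩ := lowerOp_spec hab hpos
      have hs := flip_subset (u := u) (v := v) hk2 p1
      have hT := p2.flip hk1
      -- A lowering move is the inverse of the raising move that starts at its result.
      have he := raiseOp_equiv hab huv (B := lowerOp a b u v B') (by rwa [e]) (by rwa [e]) (by omega)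
      rw [g3] at he
      rw [e] at he ⊢
      refine ⟨hs, hT, p3.trans he.symm, fun j => ?_, ?_, fun y y1 y2 => ?_,
        fun j hj y => ?_⟩
      · rw [levelCard_flip, p4]
      · rw [card_flip_add, p5]
      · rw [flip_apply_of_ne y1 y2, p6 y y1 y2]
      · rw [mem_flip, if_neg (by omega), p7 j hj])
    (B := B) ⟨hB, ht, .refl _, fun _ => rfl, rfl, fun _ _ _ => rfl, fun _ _ _ => Iff.rfl⟩
  exact ⟨h1, h2, h3, h5, h6, h7, h8, h9⟩

end

section

/-! ### Alternants -/

variable {m : ℕ} {R : Type*} [CommRing R]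

/-- The monomial with exponents `v`. -/
def mono (R : Type*) [CommRing R] (v : Fin m → ℕ) : MvPolynomial (Fin m) R :=
  ∏ i, MvPolynomial.X i ^ v i

theorem mono_add (v w : Fin m → ℕ) : mono R (v + w) = mono R v * mono R w := by
  simp [mono, pow_add, Finset.prod_mul_distrib]

theorem rename_mono (σ : Equiv.Perm (Fin m)) (v : Fin m → ℕ) :
    MvPolynomial.rename σ (mono R v) = mono R (v ∘ σ.symm) := by
  simp only [mono, map_prod, map_pow, MvPolynomial.rename_X, Function.comp]
  rw [← Equiv.prod_comp σ fun i => MvPolynomial.X i ^ v (σ.symm i)]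
  simp

/-- Antisymmetrization. -/
def antisymm (p : MvPolynomial (Fin m) R) : MvPolynomial (Fin m) R :=
  ∑ σ : Equiv.Perm (Fin m), Equiv.Perm.sign σ • MvPolynomial.rename σ p

/-- The alternant `det (x_i ^ v_j)`. -/
def alt (R : Type*) [CommRing R] (v : Fin m → ℕ) : MvPolynomial (Fin m) R := antisymm (mono R v)

theorem alt_eq_det (v : Fin m → ℕ) :
    alt R v = (Matrix.of fun i j => MvPolynomial.X i ^ v j : Matrix _ _ (MvPolynomial (Fin m) R)).det := by
  rw [Matrix.det_apply, alt, antisymm]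
  refine Finset.sum_congr rfl fun σ _ => ?_
  simp [mono, map_prod]

theorem alt_comp_swap {u v : Fin m} (h : u ≠ v) (w : Fin m → ℕ) :
    alt R (w ∘ Equiv.swap u v) = -alt R w := by
  have := Matrix.det_permute' (Equiv.swap u v)
    (Matrix.of fun i j => MvPolynomial.X i ^ w j : Matrix _ _ (MvPolynomial (Fin m) R))
  rw [Equiv.Perm.sign_swap h] at this
  rw [alt_eq_det, alt_eq_det]
  simp only [Units.val_neg, Units.val_one, Int.cast_neg, Int.cast_one, neg_mul, one_mul] at this
  rw [← this]
  rfl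

theorem alt_eq_zero {u v : Fin m} (h : u ≠ v) {w : Fin m → ℕ} (hw : w u = w v) : alt R w = 0 := by
  rw [alt_eq_det]
  exact Matrix.det_zero_of_column_eq h fun k => by simp [hw]

/-- The staircase `(m - 1, …, 1, 0)`. -/
def stair (m : ℕ) (i : Fin m) : ℕ := m - 1 - i

theorem antisymm_C_mul (c : R) (p : MvPolynomial (Fin m) R) :
    antisymm (MvPolynomial.C c * p) = MvPolynomial.C c * antisymm p := by
  unfold antisymm
  rw [Finset.mul_sum]
  refine Finset.sum_congr rfl fun σ _ => ?_
  rw [map_mul, MvPolynomial.rename_C, mul_smul_comm]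

theorem antisymm_sum {ι : Type*} (s : Finset ι) (f : ι → MvPolynomial (Fin m) R) :
    antisymm (∑ i ∈ s, f i) = ∑ i ∈ s, antisymm (f i) := by
  unfold antisymm
  simp only [map_sum, Finset.smul_sum]
  rw [Finset.sum_comm]

theorem antisymm_mul {p q : MvPolynomial (Fin m) R}
    (hq : ∀ σ : Equiv.Perm (Fin m), MvPolynomial.rename σ q = q) :
    antisymm (p * q) = antisymm p * q := by
  unfold antisymm
  rw [Finset.sum_mul]
  refine Finset.sum_congr rfl fun σ _ => ?_
  rw [map_mul, hq, smul_mul_assoc]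

/-- Adjacent transpositions generate the symmetric group. -/
theorem rename_eq_of_adjacent {q : MvPolynomial (Fin m) R}
    (hq : ∀ u v : Fin m, (v : ℕ) = u + 1 → MvPolynomial.rename (Equiv.swap u v) q = q)
    (σ : Equiv.Perm (Fin m)) : MvPolynomial.rename σ q = q := by
  cases m with
  | zero =>
    have : (σ : Fin 0 → Fin 0) = id := by funext i; exact i.elim0
    rw [this, MvPolynomial.rename_id_apply]
  | succ n =>
    have hσ : σ ∈ Submonoid.closure (Set.range fun i : Fin n => Equiv.swap i.castSucc i.succ) := by
      rw [Equiv.Perm.mclosure_swap_castSucc_succ]; trivial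
    induction hσ using Submonoid.closure_induction with
    | mem σ h =>
      obtain ⟨i, rfl⟩ := h
      exact hq _ _ (by simp)
    | one => exact MvPolynomial.rename_id_apply q
    | mul σ τ _ _ h1 h2 =>
      rw [Equiv.Perm.coe_mul, ← MvPolynomial.rename_rename, h2, h1]

/-! ### Families of blocks -/

open Classical in
/-- The families `B` of blocks with letters less than `b` such that `α j` blocks contain `j`. -/
def fillings (m b : ℕ) (α : ℕ → ℕ) : Finset (Fin m → Finset ℕ) :=
  (Fintype.piFinset fun _ => (Finset.range b).powerset).filter fun B => ∀ j, levelCard B j = α j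

theorem mem_fillings {b : ℕ} {α : ℕ → ℕ} {B : Fin m → Finset ℕ} :
    B ∈ fillings m b α ↔ (∀ y, B y ⊆ Finset.range b) ∧ ∀ j, levelCard B j = α j := by
  classical
  unfold fillings
  simp [Fintype.mem_piFinset]

/-- The block sizes. -/
def weight (B : Fin m → Finset ℕ) (x : Fin m) : ℕ := (B x).card

/-- The generating function of the families of blocks. -/
def genFun (m b : ℕ) (α : ℕ → ℕ) (g : (Fin m → Finset ℕ) → R) : MvPolynomial (Fin m) R :=
  ∑ B ∈ fillings m b α, MvPolynomial.C (g B) * mono R (weight B)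

/-- Invariance under the equivalence of block words. -/
def IsInvariant (g : (Fin m → Finset ℕ) → R) : Prop :=
  ∀ B B', BlockEquiv (List.ofFn B) (List.ofFn B') → g B = g B'

theorem height_eq_card (u v : Fin m) {b : ℕ} {B : Fin m → Finset ℕ}
    (hB : ∀ y, B y ⊆ Finset.range b) :
    ∑ i ∈ Finset.range b, step u v B i = (weight B u : ℤ) - weight B v := by
  rw [sum_step, Finset.inter_eq_left.mpr (hB u), Finset.inter_eq_left.mpr (hB v)]
  rfl

/-- The difference of the two block sizes splits at the letter `a`: the part below `a` is kept, the
part from `a` on changes its sign, and the sum of the sizes is constant. -/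
theorem weight_reflect {a b : ℕ} {u v : Fin m} (hab : a ≤ b) (huv : (v : ℕ) = u + 1)
    {B : Fin m → Finset ℕ} (hB : ∀ y, B y ⊆ Finset.range b) (ht : TailCond a u v B) :
    (weight (reflect a b u v B) u : ℤ) = weight B v + ∑ i ∈ Finset.range a, step u v B i ∧
    (weight (reflect a b u v B) v : ℤ) = weight B u - ∑ i ∈ Finset.range a, step u v B i ∧
    ∀ y, y ≠ u → y ≠ v → weight (reflect a b u v B) y = weight B y := by
  obtain ⟨h1, -, h3, -, -, h6, h7, h8⟩ := reflect_properties hab huv hB ht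
  have e1 := height_eq_card u v hB
  have e2 := height_eq_card u v h3
  rw [← Finset.sum_range_add_sum_Ico _ hab] at e1 e2
  have e3 : ∑ i ∈ Finset.range a, step u v (reflect a b u v B) i =
      ∑ i ∈ Finset.range a, step u v B i := by
    refine Finset.sum_congr rfl fun i hi => ?_
    unfold step
    simp only [h8 i (Finset.mem_range.mp hi)]
  unfold height at h1
  have h6' : weight (reflect a b u v B) u + weight (reflect a b u v B) v =
    weight B u + weight B v := h6
  refine ⟨by omega, by omega, fun y y1 y2 => ?_⟩
  unfold weight
  rw [h7 y y1 y2]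

theorem tailCond_zero (u v : Fin m) (B : Fin m → Finset ℕ) : TailCond 0 u v B :=
  fun _ hi => absurd hi (Nat.not_lt_zero _)

/-- For the full range of letters, the reflection interchanges the sizes of two neighbouring blocks,
and it stays inside the equivalence class on which `g` is constant. -/
theorem genFun_symm (b : ℕ) (α : ℕ → ℕ) {g : (Fin m → Finset ℕ) → R} (hg : IsInvariant g)
    (σ : Equiv.Perm (Fin m)) : MvPolynomial.rename σ (genFun m b α g) = genFun m b α g := by
  refine rename_eq_of_adjacent (fun u v huv => ?_) σ
  unfold genFun
  rw [map_sum]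
  have hp := fun B (hB : B ∈ fillings m b α) => reflect_properties (Nat.zero_le b) huv
    (mem_fillings.mp hB).1 (tailCond_zero u v B)
  have hmem : ∀ B ∈ fillings m b α, reflect 0 b u v B ∈ fillings m b α := fun B hB =>
    mem_fillings.mpr ⟨(hp B hB).2.2.1, fun j => by
      rw [(hp B hB).2.2.2.2.1, (mem_fillings.mp hB).2]⟩
  refine Finset.sum_bij' (fun B _ => reflect 0 b u v B) (fun B _ => reflect 0 b u v B)
    hmem hmem (fun B hB => (hp B hB).2.1) (fun B hB => (hp B hB).2.1) fun B hB => ?_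
  rw [map_mul, MvPolynomial.rename_C, rename_mono, hg _ _ (hp B hB).2.2.2.1]
  congr 2
  obtain ⟨w1, w2, w3⟩ := weight_reflect (Nat.zero_le b) huv (mem_fillings.mp hB).1
    (tailCond_zero u v B)
  simp only [Finset.range_zero, Finset.sum_empty, add_zero, sub_zero, Nat.cast_inj] at w1 w2
  funext y
  simp only [Function.comp, Equiv.symm_swap]
  by_cases y1 : y = u
  · rw [y1, Equiv.swap_apply_left, w1]
  · by_cases y2 : y = v
    · rw [y2, Equiv.swap_apply_right, w2]
    · rw [Equiv.swap_apply_of_ne_of_ne y1 y2, w3 y y1 y2]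

/-- A symmetric factor can be pulled into the antisymmetrization. -/
theorem alt_mul_genFun (b : ℕ) (α : ℕ → ℕ) {g : (Fin m → Finset ℕ) → R} (hg : IsInvariant g)
    (v : Fin m → ℕ) : alt R v * genFun m b α g =
      ∑ B ∈ fillings m b α, MvPolynomial.C (g B) * alt R (v + weight B) := by
  unfold alt
  rw [← antisymm_mul (genFun_symm b α hg)]
  unfold genFun
  rw [Finset.mul_sum, antisymm_sum]
  refine Finset.sum_congr rfl fun B _ => ?_
  rw [mul_left_comm, antisymm_C_mul, ← mono_add]

/-! ### The cancellation -/

/-- The number of letters less than `j` in the block `x`. -/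
def below (B : Fin m → Finset ℕ) (x : Fin m) (j : ℕ) : ℕ := (B x ∩ Finset.range j).card

/-- The blocks of `B` are the columns of a semistandard tableau. -/
def Highest (B : Fin m → Finset ℕ) : Prop :=
  ∀ j, ∀ u v : Fin m, (v : ℕ) = u + 1 → below B v j ≤ below B u j

/-- The blocks `x` and `x + 1` violate the condition on a semistandard tableau. -/
def Violates (B : Fin m → Finset ℕ) (j x : ℕ) : Prop :=
  ∃ u v : Fin m, (u : ℕ) = x ∧ (v : ℕ) = u + 1 ∧ below B u j < below B v j

theorem exists_violates {B : Fin m → Finset ℕ} (h : ¬ Highest B) : ∃ j x, Violates B j x := by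
  unfold Highest at h
  push Not at h
  obtain ⟨j, u, v, h1, h2⟩ := h
  exact ⟨j, u, u, v, rfl, h1, h2⟩

open Classical in
theorem exists_first_violation {B : Fin m → Finset ℕ} (h : ¬ Highest B) :
    ∃ a, ∃ u v : Fin m, (v : ℕ) = u + 1 ∧ below B u a < below B v a ∧
      (∀ j < a, ∀ x, ¬ Violates B j x) ∧ ∀ x < (u : ℕ), ¬ Violates B a x := by
  have h1 := exists_violates h
  have h2 := Nat.find_spec h1
  obtain ⟨u, v, e1, e2, e3⟩ := Nat.find_spec h2
  refine ⟨Nat.find h1, u, v, e2, e3, fun j hj x hx => Nat.find_min h1 hj ⟨x, hx⟩,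
    fun x hx => Nat.find_min h2 (e1 ▸ hx)⟩

theorem sum_range_step (u v : Fin m) (B : Fin m → Finset ℕ) (j : ℕ) :
    ∑ i ∈ Finset.range j, step u v B i = (below B u j : ℤ) - below B v j := sum_step u v B _

/-- The partial sums are nonnegative before the first violating level and change by at most one at
each step, so the violating sum is exactly `-1`. Subtracting an earlier partial sum gives
`TailCond`. -/
theorem first_violation {B : Fin m → Finset ℕ} {a b : ℕ} {u v : Fin m}
    (hB : ∀ y, B y ⊆ Finset.range b) (huv : (v : ℕ) = u + 1)
    (h : below B u a < below B v a) (hmin : ∀ j < a, ∀ x, ¬ Violates B j x) :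
    a ≤ b ∧ ∑ i ∈ Finset.range a, step u v B i = -1 ∧ TailCond a u v B := by
  have hlt : ∀ j < a, 0 ≤ ∑ i ∈ Finset.range j, step u v B i := by
    intro j hj
    rw [sum_range_step]
    have : ¬ below B u j < below B v j := fun hh => hmin j hj u ⟨u, v, rfl, huv, hh⟩
    omega
  have ha : ∑ i ∈ Finset.range a, step u v B i = -1 := by
    cases a with
    | zero => simp [below] at h
    | succ a =>
      have h1 := hlt a (Nat.lt_succ_self _)
      have h2 := step_bound u v B a
      have h3 := sum_range_step u v B (a + 1)
      rw [Finset.sum_range_succ] at h3 ⊢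
      omega
  refine ⟨?_, ha, fun i hi => ?_⟩
  · by_contra hba
    push Not at hba
    have h1 := hlt b hba
    rw [sum_range_step] at h1
    have : ∀ y, below B y a = below B y b := fun y => by
      unfold below
      rw [Finset.inter_eq_left.mpr (hB y), Finset.inter_eq_left.mpr
        ((hB y).trans (Finset.range_subset_range.mpr hba.le))]
    rw [this, this] at h
    omega
  · have := hlt i hi
    rw [← Finset.sum_range_add_sum_Ico _ hi.le] at ha
    omega

open Classical in
/-- Stembridge's involution. -/
def cancel (b : ℕ) (B : Fin m → Finset ℕ) : Fin m → Finset ℕ :=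
  if h : Highest B then B else
    reflect (exists_first_violation h).choose b (exists_first_violation h).choose_spec.choose
      (exists_first_violation h).choose_spec.choose_spec.choose B

/-- The first violation is determined by the violations up to its own level, so it is shared by
families that agree there. -/
theorem first_violation_unique {B B' : Fin m → Finset ℕ} {a a' : ℕ} {u v u' v' : Fin m}
    (hBB : ∀ j ≤ a, ∀ x, Violates B' j x ↔ Violates B j x)
    (huv : (v : ℕ) = u + 1) (huv' : (v' : ℕ) = u' + 1)
    (h : below B u a < below B v a) (hmin : ∀ j < a, ∀ x, ¬ Violates B j x)
    (hx : ∀ x < (u : ℕ), ¬ Violates B a x)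
    (h' : below B' u' a' < below B' v' a') (hmin' : ∀ j < a', ∀ x, ¬ Violates B' j x)
    (hx' : ∀ x < (u' : ℕ), ¬ Violates B' a' x) : a = a' ∧ u = u' ∧ v = v' := by
  have V : Violates B a u := ⟨u, v, rfl, huv, h⟩
  have V' : Violates B' a' u' := ⟨u', v', rfl, huv', h'⟩
  have ha : a = a' := by
    rcases lt_trichotomy a a' with c | c | c
    · exact absurd ((hBB a le_rfl u).mpr V) (hmin' a c u)
    · exact c
    · exact absurd ((hBB a' c.le u').mp V') (hmin a' c u')
  subst ha
  have hu : u = u' := by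
    rcases lt_trichotomy (u : ℕ) u' with c | c | c
    · exact absurd ((hBB a le_rfl u).mpr V) (hx' u c)
    · exact Fin.ext c
    · exact absurd ((hBB a le_rfl u').mp V') (hx u' c)
  subst hu
  exact ⟨rfl, rfl, Fin.ext (huv.trans huv'.symm)⟩

/-- Only letters from the first violating level on are reflected, so the violations up to that level
do not change. The same reflection is therefore applied the second time, and it undoes the first
one. -/
theorem cancel_spec {b : ℕ} {α : ℕ → ℕ} {B : Fin m → Finset ℕ} (hB : B ∈ fillings m b α)
    (h : ¬ Highest B) : cancel b B ∈ fillings m b α ∧ ¬ Highest (cancel b B) ∧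
      cancel b (cancel b B) = B ∧ BlockEquiv (List.ofFn B) (List.ofFn (cancel b B)) ∧
      alt R (stair m + weight (cancel b B)) = -alt R (stair m + weight B) ∧
      (cancel b B = B → alt R (stair m + weight B) = 0) := by
  have hs := (exists_first_violation h).choose_spec.choose_spec.choose_spec
  have hc : cancel b B = reflect (exists_first_violation h).choose b
    (exists_first_violation h).choose_spec.choose
      (exists_first_violation h).choose_spec.choose_spec.choose B := dif_neg h
  generalize (exists_first_violation h).choose_spec.choose_spec.choose = v at hs hc
  generalize (exists_first_violation h).choose_spec.choose = u at hs hc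
  generalize (exists_first_violation h).choose = a at hs hc
  obtain ⟨huv, h1, hmin, hx⟩ := hs
  obtain ⟨hB1, hB2⟩ := mem_fillings.mp hB
  obtain ⟨hab, hS, ht⟩ := first_violation hB1 huv h1 hmin
  obtain ⟨p1, p2, p3, p4, p5, p6, p7, p8⟩ := reflect_properties hab huv hB1 ht
  obtain ⟨w1, w2, w3⟩ := weight_reflect hab huv hB1 ht
  rw [← hc] at p1 p2 p3 p4 p5 p6 p7 p8 w1 w2 w3
  rw [hS] at w1 w2
  have hbel : ∀ j ≤ a, ∀ y, below (cancel b B) y j = below B y j := by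
    intro j hj y
    unfold below
    congr 1
    ext i
    simp only [Finset.mem_inter, Finset.mem_range]
    constructor
    · rintro ⟨i1, i2⟩; exact ⟨(p8 i (by omega) y).mp i1, i2⟩
    · rintro ⟨i1, i2⟩; exact ⟨(p8 i (by omega) y).mpr i1, i2⟩
  have hV : ∀ j ≤ a, ∀ x, Violates (cancel b B) j x ↔ Violates B j x := by
    intro j hj x
    unfold Violates
    simp only [hbel j hj]
  have hnot : ¬ Highest (cancel b B) := fun hh => by
    have := hh a u v huv
    rw [hbel a le_rfl, hbel a le_rfl] at this
    omega
  have hne : u ≠ v := fun e => by rw [e] at huv; omega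
  -- The partial sum `-1` in the new block sizes compensates the difference `1` of neighbouring
  -- staircase parts, so the exponents are interchanged exactly.
  have hwt : stair m + weight (cancel b B) = (stair m + weight B) ∘ Equiv.swap u v := by
    have hv := v.isLt
    funext y
    simp only [Function.comp, Pi.add_apply]
    by_cases y1 : y = u
    · rw [y1, Equiv.swap_apply_left]
      unfold stair
      omega
    · by_cases y2 : y = v
      · rw [y2, Equiv.swap_apply_right]
        unfold stair
        omega
      · rw [Equiv.swap_apply_of_ne_of_ne y1 y2, w3 y y1 y2]
  refine ⟨mem_fillings.mpr ⟨p3, fun j => by rw [p5, hB2]⟩, hnot, ?_, p4, ?_, fun e => ?_⟩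
  · have hs' := (exists_first_violation hnot).choose_spec.choose_spec.choose_spec
    have hc' : cancel b (cancel b B) = reflect (exists_first_violation hnot).choose b
      (exists_first_violation hnot).choose_spec.choose
        (exists_first_violation hnot).choose_spec.choose_spec.choose (cancel b B) := dif_neg hnot
    generalize (exists_first_violation hnot).choose_spec.choose_spec.choose = v' at hs' hc'
    generalize (exists_first_violation hnot).choose_spec.choose = u' at hs' hc'
    generalize (exists_first_violation hnot).choose = a' at hs' hc'
    obtain ⟨huv', h1', hmin', hx'⟩ := hs'
    obtain ⟨rfl, rfl, rfl⟩ := first_violation_unique hV huv huv' h1 hmin hx h1' hmin' hx'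
    rw [hc', hc]
    rw [hc] at p2
    exact p2
  · rw [hwt, alt_comp_swap hne]
  · refine alt_eq_zero hne ?_
    have := congrFun hwt u
    rw [e] at this
    simpa using this

open Classical in
-- The families that are not columns of a tableau cancel in pairs under `cancel`; a fixed point of
-- `cancel` has two equal exponents and a vanishing alternant.
theorem sum_alt_eq_sum_highest (b : ℕ) (α : ℕ → ℕ) {g : (Fin m → Finset ℕ) → R}
    (hg : IsInvariant g) :
    alt R (stair m) * genFun m b α g =
      ∑ B ∈ (fillings m b α).filter Highest,
        MvPolynomial.C (g B) * alt R (stair m + weight B) := by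
  rw [alt_mul_genFun b α hg, ← Finset.sum_filter_add_sum_filter_not _ Highest, add_eq_left]
  refine Finset.sum_involution (fun B _ => cancel b B) ?_ ?_ ?_ ?_
  · intro B hB
    obtain ⟨h1, h2⟩ := Finset.mem_filter.mp hB
    obtain ⟨-, -, -, c4, c5, -⟩ := cancel_spec (R := R) h1 h2
    rw [c5, hg _ _ c4]
    ring
  · intro B hB hne e
    obtain ⟨h1, h2⟩ := Finset.mem_filter.mp hB
    obtain ⟨-, -, -, -, -, c6⟩ := cancel_spec (R := R) h1 h2
    exact hne (by rw [c6 e, mul_zero])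
  · intro B hB
    obtain ⟨h1, h2⟩ := Finset.mem_filter.mp hB
    obtain ⟨c1, c2, -⟩ := cancel_spec (R := R) h1 h2
    exact Finset.mem_filter.mpr ⟨c1, c2⟩
  · intro B hB
    obtain ⟨h1, h2⟩ := Finset.mem_filter.mp hB
    exact (cancel_spec (R := R) h1 h2).2.2.1

end

section

/-! ### Young diagrams and columns of tableaux -/

theorem youngDiagram_ext_rowLen {μ ν : YoungDiagram} (h : ∀ i, μ.rowLen i = ν.rowLen i) : μ = ν := by
  refine YoungDiagram.ext ?_
  ext ⟨i, j⟩
  rw [YoungDiagram.mem_cells, YoungDiagram.mem_cells, YoungDiagram.mem_iff_lt_rowLen,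
    YoungDiagram.mem_iff_lt_rowLen, h]

theorem youngDiagram_ext_colLen {μ ν : YoungDiagram} (h : ∀ i, μ.colLen i = ν.colLen i) : μ = ν := by
  refine YoungDiagram.ext ?_
  ext ⟨i, j⟩
  rw [YoungDiagram.mem_cells, YoungDiagram.mem_cells, YoungDiagram.mem_iff_lt_colLen,
    YoungDiagram.mem_iff_lt_colLen, h]

theorem rowLen_eq_zero_iff {ν : YoungDiagram} {i : ℕ} : ν.rowLen i = 0 ↔ ν.colLen 0 ≤ i := by
  rw [← not_iff_not, ← Ne, ← Nat.pos_iff_ne_zero, ← YoungDiagram.mem_iff_lt_rowLen, not_le,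
    YoungDiagram.mem_iff_lt_colLen]

theorem colLen_eq_zero_iff {ν : YoungDiagram} {j : ℕ} : ν.colLen j = 0 ↔ ν.rowLen 0 ≤ j := by
  rw [← not_iff_not, ← Ne, ← Nat.pos_iff_ne_zero, ← YoungDiagram.mem_iff_lt_colLen, not_le,
    YoungDiagram.mem_iff_lt_rowLen]

/-- The Young diagram with `f i` boxes in the row `i`. -/
def ofRowFun (f : ℕ → ℕ) (n : ℕ) (hf : Antitone f) : YoungDiagram where
  cells := (Finset.range n ×ˢ Finset.range (f 0)).filter fun c => c.2 < f c.1
  isLowerSet := by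
    rintro ⟨i, j⟩ ⟨i', j'⟩ ⟨h1, h2⟩ h
    simp only [Finset.coe_filter, Finset.mem_product, Finset.mem_range, Set.mem_ofPred_eq] at h ⊢
    simp only at h1 h2
    have h3 := hf h1
    omega

theorem rowLen_ofRowFun (f : ℕ → ℕ) (n : ℕ) (hf : Antitone f) (hn : f n = 0) (i : ℕ) :
    (ofRowFun f n hf).rowLen i = f i := by
  have h : ∀ j, j < (ofRowFun f n hf).rowLen i ↔ j < f i := by
    intro j
    rw [← YoungDiagram.mem_iff_lt_rowLen, ← YoungDiagram.mem_cells]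
    simp only [ofRowFun, Finset.mem_filter, Finset.mem_product, Finset.mem_range,
      and_iff_right_iff_imp]
    intro h
    have h1 := hf (Nat.zero_le i)
    refine ⟨?_, by omega⟩
    by_contra hni
    have := hf (not_lt.mp hni)
    omega
  exact le_antisymm (le_of_not_gt fun hh => lt_irrefl _ ((h _).mp hh))
    (le_of_not_gt fun hh => lt_irrefl _ ((h _).mpr hh))

section

variable {ν : YoungDiagram}

/-- The set of entries of the column `c` of `T`. -/
def colSet (T : SemistandardYoungTableau ν) (c : ℕ) : Finset ℕ :=
  (Finset.range (ν.colLen c)).image fun i => T i c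

theorem mem_colSet {T : SemistandardYoungTableau ν} {c a : ℕ} :
    a ∈ colSet T c ↔ ∃ i, i < ν.colLen c ∧ T i c = a := by
  simp [colSet]

theorem col_injOn (T : SemistandardYoungTableau ν) (c : ℕ) :
    Set.InjOn (fun i => T i c) (Finset.range (ν.colLen c)) := by
  intro i hi i' hi' e
  simp only [Finset.coe_range, Set.mem_Iio] at hi hi' e
  rcases lt_trichotomy i i' with h | h | h
  · have := T.col_strict h (YoungDiagram.mem_iff_lt_colLen.mpr hi'); omega
  · exact h
  · have := T.col_strict h (YoungDiagram.mem_iff_lt_colLen.mpr hi); omega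

theorem card_colSet (T : SemistandardYoungTableau ν) (c : ℕ) :
    (colSet T c).card = ν.colLen c := by
  rw [colSet, Finset.card_image_of_injOn (col_injOn T c), Finset.card_range]

theorem card_colSet_inter (T : SemistandardYoungTableau ν) (c j : ℕ) :
    (colSet T c ∩ Finset.range j).card =
      ((Finset.range (ν.colLen c)).filter fun i => T i c < j).card := by
  have : colSet T c ∩ Finset.range j =
      ((Finset.range (ν.colLen c)).filter fun i => T i c < j).image fun i => T i c := by
    ext a
    simp only [Finset.mem_inter, mem_colSet, Finset.mem_range, Finset.mem_image, Finset.mem_filter]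
    constructor
    · rintro ⟨⟨i, h1, rfl⟩, h2⟩; exact ⟨i, ⟨h1, h2⟩, rfl⟩
    · rintro ⟨i, ⟨h1, h2⟩, rfl⟩; exact ⟨⟨i, h1, rfl⟩, h2⟩
  rw [this, Finset.card_image_of_injOn]
  exact (col_injOn T c).mono (Finset.coe_subset.mpr (Finset.filter_subset _ _))

/-- Rows increase weakly, so an entry less than `j` in column `c + 1` has one to its left. -/
theorem colSet_dominance (T : SemistandardYoungTableau ν) (c j : ℕ) :
    (colSet T (c + 1) ∩ Finset.range j).card ≤ (colSet T c ∩ Finset.range j).card := by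
  rw [card_colSet_inter, card_colSet_inter]
  refine Finset.card_le_card fun i hi => ?_
  simp only [Finset.mem_filter, Finset.mem_range] at hi ⊢
  have h1 := T.row_weak (Nat.lt_succ_self c) (YoungDiagram.mem_iff_lt_colLen.mpr hi.1)
  exact ⟨hi.1.trans_le (ν.colLen_anti _ _ (Nat.le_succ c)), h1.trans_lt hi.2⟩

theorem count_mem_eq (S : Finset ℕ) (j : ℕ) : Nat.count (· ∈ S) j = (S ∩ Finset.range j).card := by
  rw [Nat.count_eq_card_filter_range]
  congr 1
  ext a
  simp [and_comm]

theorem eq_nth_colSet (T : SemistandardYoungTableau ν) {i c : ℕ} (h : i < ν.colLen c) :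
    T i c = Nat.nth (· ∈ colSet T c) i := by
  have h1 : Nat.count (· ∈ colSet T c) (T i c) = i := by
    rw [count_mem_eq, card_colSet_inter]
    have : (Finset.range (ν.colLen c)).filter (fun i' => T i' c < T i c) = Finset.range i := by
      ext i'
      simp only [Finset.mem_filter, Finset.mem_range]
      constructor
      · rintro ⟨h1, h2⟩
        by_contra h3
        have := T.col_weak (not_lt.mp h3) (YoungDiagram.mem_iff_lt_colLen.mpr h1)
        omega
      · intro h1
        exact ⟨h1.trans h, T.col_strict h1 (YoungDiagram.mem_iff_lt_colLen.mpr h)⟩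
    rw [this, Finset.card_range]
  have h2 := Nat.nth_count (p := (· ∈ colSet T c)) (n := T i c) (mem_colSet.mpr ⟨i, h, rfl⟩)
  rw [h1] at h2
  exact h2.symm

theorem ssyt_ext_colSet {T T' : SemistandardYoungTableau ν} (h : ∀ c, colSet T c = colSet T' c) :
    T = T' := by
  refine SemistandardYoungTableau.ext fun i c => ?_
  by_cases hc : i < ν.colLen c
  · rw [eq_nth_colSet T hc, eq_nth_colSet T' hc, h]
  · rw [T.zeros (fun hh => hc (YoungDiagram.mem_iff_lt_colLen.mp hh)),
      T'.zeros (fun hh => hc (YoungDiagram.mem_iff_lt_colLen.mp hh))]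

/-- Each set is written increasingly as a column. The rows are then weakly increasing because the
`i`-th smallest element of a later set has at least `i` smaller or equal elements in every earlier
one. -/
theorem exists_ssyt_colSet (S : ℕ → Finset ℕ) (h1 : ∀ c, (S c).card = ν.colLen c)
    (h2 : ∀ c j, (S (c + 1) ∩ Finset.range j).card ≤ (S c ∩ Finset.range j).card) :
    ∃ T : SemistandardYoungTableau ν, ∀ c, colSet T c = S c := by
  have hcard : ∀ c i, i < ν.colLen c → ∀ hf : (Set.ofPred (· ∈ S c)).Finite,
      i < hf.toFinset.card := by
    intro c i hi hf
    have : hf.toFinset = S c := by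
      ext a
      rw [Set.Finite.mem_toFinset]
      exact Iff.rfl
    rw [this, h1]
    exact hi
  have hmem : ∀ c i, i < ν.colLen c → Nat.nth (· ∈ S c) i ∈ S c := fun c i hi =>
    Nat.nth_mem i (hcard c i hi)
  have hanti : ∀ c c' j, c ≤ c' → (S c' ∩ Finset.range j).card ≤ (S c ∩ Finset.range j).card := by
    intro c c' j h
    exact antitone_nat_of_succ_le (f := fun c => (S c ∩ Finset.range j).card) (fun c => h2 c j) h
  let T : SemistandardYoungTableau ν :=
    { entry := fun i c => if i < ν.colLen c then Nat.nth (· ∈ S c) i else 0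
      row_weak' := by
        intro i c c' hcc hc
        have hi := YoungDiagram.mem_iff_lt_colLen.mp hc
        have hi' := hi.trans_le (ν.colLen_anti _ _ hcc.le)
        rw [if_pos hi, if_pos hi']
        refine Nat.le_of_lt_succ (Nat.nth_lt_of_lt_count ?_)
        rw [count_mem_eq]
        refine lt_of_lt_of_le ?_ (hanti c c' _ hcc.le)
        rw [← count_mem_eq, Nat.succ_eq_add_one, Nat.count_succ, if_pos (hmem c' i hi),
          Nat.count_nth (hcard c' i hi)]
        omega
      col_strict' := by
        intro i i' c hii hc
        have hi := YoungDiagram.mem_iff_lt_colLen.mp hc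
        rw [if_pos hi, if_pos (hii.trans hi)]
        exact Nat.nth_lt_nth' hii (hcard c i' hi)
      zeros' := by
        intro i c hc
        rw [if_neg fun hh => hc (YoungDiagram.mem_iff_lt_colLen.mpr hh)] }
  have hT : ∀ i c, i < ν.colLen c → T i c = Nat.nth (· ∈ S c) i := fun i c hi => if_pos hi
  refine ⟨T, fun c => ?_⟩
  refine Finset.eq_of_subset_of_card_le (fun a ha => ?_) (by rw [card_colSet, h1])
  obtain ⟨i, hi, rfl⟩ := mem_colSet.mp ha
  rw [hT i c hi]
  exact hmem c i hi

theorem mem_ssyt {T : SemistandardYoungTableau ν} {α : ℕ → ℕ} :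
    T ∈ ssyt ν α ↔ ∀ k, content T k = α k := by
  simp [ssyt]

theorem mem_ssytLT {T : SemistandardYoungTableau ν} {m : ℕ} :
    T ∈ ssytLT ν m ↔ ∀ c, colSet T c ⊆ Finset.range m := by
  simp only [ssytLT, Set.Finite.mem_toFinset, Set.mem_ofPred_eq]
  constructor
  · intro h c a ha
    obtain ⟨i, hi, rfl⟩ := mem_colSet.mp ha
    exact Finset.mem_range.mpr
      (h (i, c) ((YoungDiagram.mem_cells _).mpr (YoungDiagram.mem_iff_lt_colLen.mpr hi)))
  · rintro h ⟨i, c⟩ hc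
    exact Finset.mem_range.mp (h c (mem_colSet.mpr
      ⟨i, YoungDiagram.mem_iff_lt_colLen.mp ((YoungDiagram.mem_cells _).mp hc), rfl⟩))

/-- The content counts columns, as a column contains a letter at most once. -/
theorem content_eq_card {b : ℕ} (hb : ν.rowLen 0 ≤ b) (T : SemistandardYoungTableau ν) (k : ℕ) :
    content T k = ((Finset.range b).filter fun c => k ∈ colSet T c).card := by
  unfold content
  refine Finset.card_bij (fun x _ => x.2) ?_ ?_ ?_
  · rintro ⟨i, c⟩ h
    obtain ⟨h1, h2⟩ := Finset.mem_filter.mp h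
    rw [YoungDiagram.mem_cells] at h1
    have h3 := YoungDiagram.mem_iff_lt_rowLen.mp h1
    have h4 := ν.rowLen_anti _ _ (Nat.zero_le i)
    simp only [Finset.mem_filter, Finset.mem_range]
    exact ⟨by omega, mem_colSet.mpr ⟨i, YoungDiagram.mem_iff_lt_colLen.mp h1, h2⟩⟩
  · rintro ⟨i, c⟩ h ⟨i', c'⟩ h' e
    obtain ⟨h1, h2⟩ := Finset.mem_filter.mp h
    obtain ⟨h1', h2'⟩ := Finset.mem_filter.mp h'
    rw [YoungDiagram.mem_cells, YoungDiagram.mem_iff_lt_colLen] at h1 h1'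
    simp only at e h2 h2'
    subst e
    have := col_injOn T c (Finset.mem_coe.mpr (Finset.mem_range.mpr h1))
      (Finset.mem_coe.mpr (Finset.mem_range.mpr h1')) (h2.trans h2'.symm)
    rw [this]
  · intro c hc
    obtain ⟨-, h⟩ := Finset.mem_filter.mp hc
    obtain ⟨i, hi, e⟩ := mem_colSet.mp h
    exact ⟨(i, c), Finset.mem_filter.mpr ⟨(YoungDiagram.mem_cells _).mpr
      (YoungDiagram.mem_iff_lt_colLen.mpr hi), e⟩, rfl⟩

end

/-! ### Schur polynomials as generating functions of lattice families -/

variable {m : ℕ} {R : Type*} [CommRing R]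

theorem latticeAt_iff_up {j : ℕ} {L : List (Finset ℕ)} :
    LatticeAt j L ↔ ∀ x, up (levelSet L (j + 1)) x ≤ up (levelSet L j) x := by
  constructor
  · intro h x
    have := h (L.drop x) (List.drop_suffix _ _)
    rwa [cnt_drop, cnt_drop] at this
  · intro h D hD
    rw [List.suffix_iff_eq_drop.mp hD, cnt_drop, cnt_drop]
    exact h _

theorem levelSet_ofFn (B : Fin m → Finset ℕ) (j : ℕ) :
    levelSet (List.ofFn B) j = (Finset.univ.filter fun x => j ∈ B x).image Fin.val := by
  ext x
  rw [mem_levelSet]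
  simp only [Finset.mem_image, Finset.mem_filter, Finset.mem_univ, true_and]
  by_cases hx : x < m
  · rw [List.getD_eq_getElem _ _ (by simpa using hx), List.getElem_ofFn]
    exact ⟨fun h => ⟨⟨x, hx⟩, h, rfl⟩, by rintro ⟨y, h, rfl⟩; exact h⟩
  · rw [List.getD_eq_default _ _ (by simpa using hx)]
    refine ⟨fun h => absurd h (Finset.notMem_empty _), ?_⟩
    rintro ⟨y, h, rfl⟩
    exact absurd y.isLt hx

theorem up_levelSet_ofFn (B : Fin m → Finset ℕ) (j k : ℕ) :
    up (levelSet (List.ofFn B) j) k = (Finset.univ.filter fun x : Fin m => j ∈ B x ∧ k ≤ x).card := by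
  rw [levelSet_ofFn, up, Finset.filter_image, Finset.card_image_of_injective _ Fin.val_injective,
    Finset.filter_filter]

theorem cnt_ofFn (B : Fin m → Finset ℕ) (j : ℕ) : cnt (List.ofFn B) j = levelCard B j := by
  rw [cnt_eq_card, levelSet_ofFn, Finset.card_image_of_injective _ Fin.val_injective, levelCard]

open Classical in
/-- The indicator of the lattice condition for the letters in `[s, t)`. -/
def latInd (R : Type*) [CommRing R] (s t : ℕ) (B : Fin m → Finset ℕ) : R :=
  if ∀ j, s ≤ j → j + 1 < t → LatticeAt j (List.ofFn B) then 1 else 0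

theorem latInd_invariant (s t : ℕ) : IsInvariant (latInd R s t : (Fin m → Finset ℕ) → R) := by
  intro B B' h
  classical
  exact if_congr (forall_congr' fun j => imp_congr_right fun _ => imp_congr_right fun _ =>
    h.latticeAt_iff j) rfl rfl

/-- The family of blocks belonging to a tableau with entries less than `m`. -/
def tabBlocks (m : ℕ) {ν : YoungDiagram} (T : SemistandardYoungTableau ν) (x : Fin m) : Finset ℕ :=
  (Finset.range (ν.rowLen 0)).filter fun c => (Fin.rev x : ℕ) ∈ colSet T c

theorem mem_tabBlocks {ν : YoungDiagram} {T : SemistandardYoungTableau ν} {x : Fin m} {c : ℕ} :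
    c ∈ tabBlocks m T x ↔ (Fin.rev x : ℕ) ∈ colSet T c := by
  unfold tabBlocks
  rw [Finset.mem_filter, Finset.mem_range, and_iff_right_iff_imp]
  intro h
  by_contra hc
  have h1 := colLen_eq_zero_iff.mpr (not_lt.mp hc)
  rw [← card_colSet T, Finset.card_eq_zero] at h1
  rw [h1] at h
  exact absurd h (Finset.notMem_empty _)

theorem card_filter_rev (S : Finset ℕ) (hS : S ⊆ Finset.range m) (k : ℕ) (hk : k ≤ m) :
    (Finset.univ.filter fun x : Fin m => (Fin.rev x : ℕ) ∈ S ∧ k ≤ x).card =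
      (S ∩ Finset.range (m - k)).card := by
  refine Finset.card_bij (fun x _ => (Fin.rev x : ℕ)) ?_ ?_ ?_
  · intro x hx
    obtain ⟨-, h1, h2⟩ := Finset.mem_filter.mp hx
    refine Finset.mem_inter.mpr ⟨h1, Finset.mem_range.mpr ?_⟩
    rw [Fin.val_rev]
    omega
  · intro x _ y _ e
    exact Fin.rev_injective (Fin.ext e)
  · intro a ha
    obtain ⟨h1, h2⟩ := Finset.mem_inter.mp ha
    have h3 := Finset.mem_range.mp (hS h1)
    have h4 := Finset.mem_range.mp h2
    refine ⟨Fin.rev ⟨a, h3⟩, Finset.mem_filter.mpr ⟨Finset.mem_univ _, ?_, ?_⟩, ?_⟩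
    · rw [Fin.rev_rev]; exact h1
    · rw [Fin.val_rev]; simp only; omega
    · rw [Fin.rev_rev]

/-- Blocks are indexed by letters in reversed order, so the suffix from the block `k` on sees
exactly the letters less than `m - k`. -/
theorem latticeAt_tabBlocks {S : ℕ → Finset ℕ} {B : Fin m → Finset ℕ}
    (hS : ∀ c, S c ⊆ Finset.range m) (hB : ∀ x c, c ∈ B x ↔ (Fin.rev x : ℕ) ∈ S c) (c : ℕ) :
    LatticeAt c (List.ofFn B) ↔
      ∀ j, (S (c + 1) ∩ Finset.range j).card ≤ (S c ∩ Finset.range j).card := by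
  rw [latticeAt_iff_up]
  simp only [up_levelSet_ofFn, hB]
  constructor
  · intro h j
    by_cases hj : j ≤ m
    · have := h (m - j)
      rw [card_filter_rev _ (hS _) _ (by omega), card_filter_rev _ (hS _) _ (by omega),
        show m - (m - j) = j by omega] at this
      exact this
    · have := h 0
      rw [card_filter_rev _ (hS _) _ (by omega), card_filter_rev _ (hS _) _ (by omega)] at this
      rw [Nat.sub_zero, Finset.inter_eq_left.mpr (hS _), Finset.inter_eq_left.mpr (hS _)] at this
      have hr : Finset.range m ⊆ Finset.range j := Finset.range_subset_range.mpr (by omega)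
      rw [Finset.inter_eq_left.mpr ((hS _).trans hr), Finset.inter_eq_left.mpr ((hS _).trans hr)]
      exact this
  · intro h k
    by_cases hk : k ≤ m
    · rw [card_filter_rev _ (hS _) _ hk, card_filter_rev _ (hS _) _ hk]
      exact h _
    · rw [Finset.card_eq_zero.mpr]
      · exact Nat.zero_le _
      · refine Finset.filter_eq_empty_iff.mpr fun x _ hx => ?_
        have := x.isLt
        omega

theorem levelCard_tabBlocks {S : ℕ → Finset ℕ} {B : Fin m → Finset ℕ}
    (hS : ∀ c, S c ⊆ Finset.range m) (hB : ∀ x c, c ∈ B x ↔ (Fin.rev x : ℕ) ∈ S c) (c : ℕ) :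
    levelCard B c = (S c).card := by
  have := card_filter_rev (S c) (hS c) 0 (Nat.zero_le _)
  rw [Nat.sub_zero, Finset.inter_eq_left.mpr (hS c)] at this
  rw [← this, levelCard]
  simp only [hB, Nat.zero_le, and_true]

theorem monomial_eq_mono (f : Fin m → ℕ) :
    MvPolynomial.monomial (Finsupp.equivFunOnFinite.symm f) (1 : R) = mono R f := by
  rw [MvPolynomial.monomial_eq, MvPolynomial.C_1, one_mul, Finsupp.prod_fintype]
  · rfl
  · intro i; exact pow_zero _

/-- A tableau is encoded by the sets of columns in which its letters occur. Then the level `c` has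
as many blocks as column `c` has boxes, and the lattice condition at `c` says that the columns `c`
and `c + 1` fit together. -/
theorem schur_eq_genFun (ν : YoungDiagram) {b : ℕ} (hb : ν.rowLen 0 ≤ b) :
    schur R m ν = genFun m b ν.colLen (latInd R 0 b) := by
  classical
  -- The encoding reverses the alphabet; the symmetry of the generating function absorbs this.
  have hrev := genFun_symm (m := m) b ν.colLen (latInd_invariant (R := R) 0 b) Fin.revPerm
  rw [← hrev, genFun, map_sum, schur]
  have : ∀ B : Fin m → Finset ℕ, MvPolynomial.rename Fin.revPerm
      (MvPolynomial.C (latInd R 0 b B) * mono R (weight B)) =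
      if (∀ j, 0 ≤ j → j + 1 < b → LatticeAt j (List.ofFn B)) then
        mono R (weight B ∘ Fin.revPerm.symm) else 0 := by
    intro B
    rw [map_mul, MvPolynomial.rename_C, rename_mono, latInd]
    split_ifs <;> simp
  simp only [this]
  rw [← Finset.sum_filter]
  refine Finset.sum_bij (fun T _ => tabBlocks m T) ?_ ?_ ?_ ?_
  · intro T hT
    rw [mem_ssytLT] at hT
    refine Finset.mem_filter.mpr ⟨mem_fillings.mpr ⟨fun y => ?_, fun j => ?_⟩, fun j _ _ => ?_⟩
    · exact (Finset.filter_subset _ _).trans (Finset.range_subset_range.mpr hb)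
    · rw [levelCard_tabBlocks hT (fun _ _ => mem_tabBlocks), card_colSet]
    · exact (latticeAt_tabBlocks hT (fun _ _ => mem_tabBlocks) j).mpr (colSet_dominance T j)
  · intro T hT T' hT' e
    rw [mem_ssytLT] at hT hT'
    refine ssyt_ext_colSet fun c => ?_
    ext a
    by_cases ha : a < m
    · have h1 := congrFun e (Fin.rev ⟨a, ha⟩)
      have h2 : c ∈ tabBlocks m T (Fin.rev ⟨a, ha⟩) ↔ c ∈ tabBlocks m T' (Fin.rev ⟨a, ha⟩) := by
        rw [h1]
      rwa [mem_tabBlocks, mem_tabBlocks, Fin.rev_rev] at h2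
    · exact ⟨fun h => absurd (Finset.mem_range.mp (hT c h)) ha,
        fun h => absurd (Finset.mem_range.mp (hT' c h)) ha⟩
  · intro B hB
    obtain ⟨hB1, hB2⟩ := Finset.mem_filter.mp hB
    obtain ⟨hB3, hB4⟩ := mem_fillings.mp hB1
    -- The columns of the tableau to be recovered from `B`.
    let S : ℕ → Finset ℕ := fun c => (Finset.univ.filter fun x => c ∈ B x).image fun x => (Fin.rev x : ℕ)
    have hS : ∀ c, S c ⊆ Finset.range m := fun c a ha => by
      obtain ⟨x, -, rfl⟩ := Finset.mem_image.mp ha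
      exact Finset.mem_range.mpr (Fin.rev x).isLt
    have hBS : ∀ x c, c ∈ B x ↔ (Fin.rev x : ℕ) ∈ S c := by
      intro x c
      simp only [S, Finset.mem_image, Finset.mem_filter, Finset.mem_univ, true_and]
      constructor
      · intro h; exact ⟨x, h, rfl⟩
      · rintro ⟨y, h, e⟩
        rwa [← Fin.rev_injective (Fin.ext e)]
    obtain ⟨T, hT⟩ := exists_ssyt_colSet (ν := ν) S
      (fun c => by rw [← levelCard_tabBlocks hS hBS, hB4]) (fun c => by
        by_cases hc : c + 1 < b
        · exact (latticeAt_tabBlocks hS hBS c).mp (hB2 c (Nat.zero_le _) hc)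
        · intro j
          have : S (c + 1) = ∅ := by
            rw [← Finset.card_eq_zero, ← levelCard_tabBlocks hS hBS, hB4, colLen_eq_zero_iff]
            omega
          simp [this])
    refine ⟨T, mem_ssytLT.mpr fun c => by rw [hT]; exact hS c, ?_⟩
    funext x
    ext c
    rw [mem_tabBlocks, hT, hBS]
  · intro T hT
    rw [monomial_eq_mono]
    congr 1
    funext k
    rw [content_eq_card le_rfl]
    simp only [weight, tabBlocks, Function.comp, Fin.revPerm_symm, Fin.revPerm_apply, Fin.rev_rev]

/-! ### The unique highest lattice family -/

open Classical in
-- Induction on the letter. The lattice condition confines the letter `j + 1` to blocks that contain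
-- all letters up to `j`, and among these `Highest` forces the blocks with `j + 1` to be the first
-- ones. Their number is prescribed.
theorem highest_lattice_unique {ν : YoungDiagram} {b : ℕ} (hb : ν.rowLen 0 ≤ b)
    {B : Fin m → Finset ℕ} (hB : B ∈ fillings m b ν.colLen) (hh : Highest B)
    (hl : ∀ j, 0 ≤ j → j + 1 < b → LatticeAt j (List.ofFn B)) (x : Fin m) :
    B x = Finset.range (ν.rowLen x) := by
  obtain ⟨hB1, hB2⟩ := mem_fillings.mp hB
  have hsucc : ∀ (x : Fin m) j, below B x (j + 1) = below B x j + if j ∈ B x then 1 else 0 := by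
    intro x j
    unfold below
    rw [Finset.range_add_one]
    by_cases h : j ∈ B x
    · rw [Finset.inter_insert_of_mem h, Finset.card_insert_of_notMem (by simp), if_pos h]
    · rw [Finset.inter_insert_of_notMem h, if_neg h]
      rfl
  -- a set of positions which is closed under predecessors is an initial segment
  have hinit : ∀ j, (∀ u v : Fin m, (v : ℕ) = u + 1 → j ∈ B v → j ∈ B u) →
      ∀ x : Fin m, j ∈ B x ↔ (x : ℕ) < ν.colLen j := by
    intro j h
    have hdown : ∀ n, ∀ u v : Fin m, (v : ℕ) = u + n → j ∈ B v → j ∈ B u := by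
      intro n
      induction n with
      | zero => intro u v e hv; rwa [Fin.ext (show (u : ℕ) = v by omega)]
      | succ n ih =>
        intro u v e hv
        have : (u : ℕ) + n < m := by have := v.isLt; omega
        exact ih u ⟨u + n, this⟩ rfl (h ⟨u + n, this⟩ v (by simp only; omega) hv)
    have hset : ∃ c, Finset.univ.filter (fun x => j ∈ B x) =
        Finset.univ.filter fun x : Fin m => (x : ℕ) < c := by
      by_cases hall : ∀ x, j ∈ B x
      · exact ⟨m, by ext x; simp [hall x]⟩
      · push Not at hall
        have hex : ∃ c, ∃ x : Fin m, (x : ℕ) = c ∧ j ∉ B x := by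
          obtain ⟨x, hx⟩ := hall
          exact ⟨x, x, rfl, hx⟩
        obtain ⟨x0, e0, hx0⟩ := Nat.find_spec hex
        refine ⟨Nat.find hex, ?_⟩
        ext x
        simp only [Finset.mem_filter, Finset.mem_univ, true_and]
        constructor
        · intro hx
          by_contra hc
          exact hx0 (hdown (x - x0) x0 x (by omega) hx)
        · intro hx
          by_contra hc
          exact Nat.find_min hex hx ⟨x, rfl, hc⟩
    obtain ⟨c, hc⟩ := hset
    have hcard := hB2 j
    rw [levelCard, hc] at hcard
    have hmin : (Finset.univ.filter fun x : Fin m => (x : ℕ) < c).card = min c m := by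
      rw [← Finset.card_image_of_injective _ Fin.val_injective, ← Finset.card_range (min c m)]
      congr 1
      ext a
      simp only [Finset.mem_image, Finset.mem_filter, Finset.mem_univ, true_and, Finset.mem_range]
      constructor
      · rintro ⟨x, hx, rfl⟩; have := x.isLt; omega
      · intro h; exact ⟨⟨a, by omega⟩, by simp only; omega, rfl⟩
    intro x
    have : x ∈ Finset.univ.filter (fun x => j ∈ B x) ↔
      x ∈ Finset.univ.filter fun x : Fin m => (x : ℕ) < c := by rw [hc]
    simp only [Finset.mem_filter, Finset.mem_univ, true_and] at this
    rw [this, ← hcard, hmin]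
    have := x.isLt
    omega
  have key : ∀ j, ∀ i ≤ j, ∀ x : Fin m, i ∈ B x ↔ (x : ℕ) < ν.colLen i := by
    intro j
    induction j with
    | zero =>
      intro i hi
      obtain rfl : i = 0 := by omega
      refine hinit 0 fun u v e hv => ?_
      have h1 := hh 1 u v e
      rw [hsucc, hsucc, if_pos hv] at h1
      simp only [below, Finset.range_zero, Finset.inter_empty, Finset.card_empty] at h1
      by_contra hu
      rw [if_neg hu] at h1
      omega
    | succ j ih =>
      intro i hi
      by_cases hij : i ≤ j
      · exact ih i hij
      obtain rfl : i = j + 1 := by omega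
      by_cases hjb : j + 1 < b
      swap
      · have h0 : ν.colLen (j + 1) = 0 := colLen_eq_zero_iff.mpr (by omega)
        intro x
        rw [h0]
        refine ⟨fun h => ?_, fun h => absurd h (Nat.not_lt_zero _)⟩
        have := hB2 (j + 1)
        rw [h0, levelCard, Finset.card_eq_zero, Finset.filter_eq_empty_iff] at this
        exact absurd h (this (Finset.mem_univ x))
      refine hinit (j + 1) fun u v e hv => ?_
      -- the lattice condition bounds the position of the letter `j + 1`
      have hvlt : (v : ℕ) < ν.colLen j := by
        have h1 := latticeAt_iff_up.mp (hl j (Nat.zero_le _) hjb) v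
        rw [up_levelSet_ofFn, up_levelSet_ofFn] at h1
        have h2 : 0 < (Finset.univ.filter fun x : Fin m => j + 1 ∈ B x ∧ (v : ℕ) ≤ x).card :=
          Finset.card_pos.mpr ⟨v, by simp [hv]⟩
        obtain ⟨y, hy⟩ := Finset.card_pos.mp (h2.trans_le h1)
        simp only [Finset.mem_filter, Finset.mem_univ, true_and] at hy
        exact lt_of_le_of_lt hy.2 ((ih j le_rfl y).mp hy.1)
      have hfull : ∀ y : Fin m, (y : ℕ) < ν.colLen j → below B y (j + 1) = j + 1 := by
        intro y hy
        unfold below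
        rw [Finset.inter_eq_right.mpr, Finset.card_range]
        intro i hi
        have hi := Finset.mem_range.mp hi
        exact (ih i (by omega) y).mpr (hy.trans_le (ν.colLen_anti _ _ (by omega)))
      have h1 := hh (j + 1 + 1) u v e
      rw [hsucc v, hsucc u, if_pos hv, hfull v hvlt, hfull u (by omega)] at h1
      by_contra hu
      rw [if_neg hu] at h1
      omega
  ext j
  rw [key j j le_rfl x, Finset.mem_range, ← YoungDiagram.mem_iff_lt_colLen,
    YoungDiagram.mem_iff_lt_rowLen]

theorem range_rowLen_mem {ν : YoungDiagram} {b : ℕ} (hb : ν.rowLen 0 ≤ b) (hm : ν.colLen 0 ≤ m) :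
    (fun x : Fin m => Finset.range (ν.rowLen x)) ∈ fillings m b ν.colLen ∧
    Highest (fun x : Fin m => Finset.range (ν.rowLen x)) ∧
    ∀ j, LatticeAt j (List.ofFn fun x : Fin m => Finset.range (ν.rowLen x)) := by
  refine ⟨mem_fillings.mpr ⟨fun y => ?_, fun j => ?_⟩, fun j u v e => ?_, fun j => ?_⟩
  · exact Finset.range_subset_range.mpr ((ν.rowLen_anti _ _ (Nat.zero_le _)).trans hb)
  · unfold levelCard
    rw [← Finset.card_range (ν.colLen j), ← Finset.card_image_of_injective _ Fin.val_injective]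
    congr 1
    ext a
    simp only [Finset.mem_image, Finset.mem_filter, Finset.mem_univ, true_and, Finset.mem_range,
      ← YoungDiagram.mem_iff_lt_rowLen]
    constructor
    · rintro ⟨x, hx, rfl⟩; exact YoungDiagram.mem_iff_lt_colLen.mp hx
    · intro h
      have := ν.colLen_anti _ _ (Nat.zero_le j)
      exact ⟨⟨a, by omega⟩, YoungDiagram.mem_iff_lt_colLen.mpr h, rfl⟩
  · unfold below
    refine Finset.card_le_card (Finset.inter_subset_inter_right (Finset.range_subset_range.mpr ?_))
    exact ν.rowLen_anti _ _ (by omega)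
  · rw [latticeAt_iff_up]
    intro k
    rw [up_levelSet_ofFn, up_levelSet_ofFn]
    refine Finset.card_le_card fun x hx => ?_
    simp only [Finset.mem_filter, Finset.mem_univ, true_and, Finset.mem_range] at hx ⊢
    exact ⟨by omega, hx.2⟩

/-- The bialternant formula: among the lattice families counted by the Schur polynomial a single one
is `Highest`, and its block sizes are the rows of the diagram. -/
theorem alt_mul_schur (ν : YoungDiagram) (hm : ν.colLen 0 ≤ m) :
    alt R (stair m) * schur R m ν = alt R (stair m + fun x : Fin m => ν.rowLen x) := by
  classical
  obtain ⟨h1, h2, h3⟩ := range_rowLen_mem (le_refl (ν.rowLen 0)) hm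
  rw [schur_eq_genFun ν le_rfl, sum_alt_eq_sum_highest _ _ (latInd_invariant 0 _),
    Finset.sum_eq_single fun x : Fin m => Finset.range (ν.rowLen x)]
  · rw [latInd, if_pos fun j _ _ => h3 j, MvPolynomial.C_1, one_mul]
    congr 2
    funext x
    exact Finset.card_range _
  · intro B hB hne
    obtain ⟨hB1, hB2⟩ := Finset.mem_filter.mp hB
    rw [latInd, if_neg, MvPolynomial.C_0, zero_mul]
    intro hl
    exact hne (funext (highest_lattice_unique le_rfl hB1 hB2 hl))
  · intro h
    exact absurd (Finset.mem_filter.mpr ⟨h1, h2⟩) h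

/-- The first column would need more distinct entries than there are letters. -/
theorem schur_eq_zero (ν : YoungDiagram) (hm : m < ν.colLen 0) : schur R m ν = 0 := by
  unfold schur
  refine Finset.sum_eq_zero fun T hT => ?_
  have h1 := Finset.card_le_card (mem_ssytLT.mp hT 0)
  rw [card_colSet, Finset.card_range] at h1
  omega

end

section

/-! ### Schur expansions -/

variable {m : ℕ} {R : Type*} [CommRing R]

theorem coeff_mono [DecidableEq (Fin m → ℕ)] (v w : Fin m → ℕ) :
    MvPolynomial.coeff (Finsupp.equivFunOnFinite.symm v) (mono R w) = if w = v then 1 else 0 := by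
  classical
  rw [← monomial_eq_mono, MvPolynomial.coeff_monomial]
  simp only [EmbeddingLike.apply_eq_iff_eq]

open Classical in
-- A permutation that carries one strictly decreasing exponent to another is increasing, hence the
-- identity.
theorem coeff_alt {v w : Fin m → ℕ} (hv : StrictAnti v) (hw : StrictAnti w) :
    MvPolynomial.coeff (Finsupp.equivFunOnFinite.symm v) (alt R w) = if w = v then 1 else 0 := by
  unfold alt antisymm
  rw [MvPolynomial.coeff_sum, Finset.sum_eq_single 1]
  · rw [Equiv.Perm.sign_one, one_smul]
    simp only [rename_mono]
    rw [coeff_mono]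
    rfl
  · intro σ _ hσ
    rw [rename_mono, Units.smul_def, MvPolynomial.coeff_smul, coeff_mono, if_neg, smul_zero]
    intro e
    apply hσ
    have hmono : StrictMono σ.symm := by
      intro i j hij
      have h1 := hv hij
      rw [← e] at h1
      exact hw.lt_iff_gt.mp h1
    have h2 : (σ.symm : Fin m → Fin m) = id := hmono.eq_id
    ext i
    have h3 := congrFun h2 (σ i)
    simp only [Equiv.symm_apply_apply, id] at h3
    rw [Equiv.Perm.one_apply, ← h3]
  · intro h; exact absurd (Finset.mem_univ _) h

theorem stair_add_strictAnti {f : ℕ → ℕ} (hf : Antitone f) :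
    StrictAnti (stair m + fun x : Fin m => f x) := by
  intro i j hij
  have h1 : (i : ℕ) < j := hij
  have h2 := hf h1.le
  have h3 := j.isLt
  simp only [Pi.add_apply, stair]
  omega

theorem alt_stair_ne_zero [Nontrivial R] : alt R (stair m) ≠ 0 := by
  intro h
  have h1 : StrictAnti (stair m) := by
    have := stair_add_strictAnti (m := m) (f := fun _ => 0) antitone_const
    exact this
  have h2 := coeff_alt (R := R) h1 h1
  rw [h, if_pos rfl, MvPolynomial.coeff_zero] at h2
  exact zero_ne_one h2

/-- The list of the columns of a tableau. -/
def colList {ν : YoungDiagram} (T : SemistandardYoungTableau ν) : List (Finset ℕ) :=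
  (List.range (ν.rowLen 0)).map (colSet T)

theorem colSet_eq_empty {ν : YoungDiagram} (T : SemistandardYoungTableau ν) {c : ℕ}
    (h : ν.rowLen 0 ≤ c) : colSet T c = ∅ := by
  rw [← Finset.card_eq_zero, card_colSet, colLen_eq_zero_iff]
  exact h

theorem blockEquiv_map_range {f : ℕ → Finset ℕ} {r n : ℕ} (hrn : r ≤ n) (hf : ∀ x, r ≤ x → f x = ∅) :
    BlockEquiv ((List.range n).map f) ((List.range r).map f) := by
  induction n, hrn using Nat.le_induction with
  | base => exact .refl _
  | succ n hn ih =>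
    rw [List.range_succ, List.map_append, List.map_singleton, hf n hn]
    refine BlockEquiv.trans (.of_step (.dropEmpty _ [])) ?_
    rwa [List.append_nil]

theorem ofFn_eq_map_range (f : ℕ → Finset ℕ) :
    List.ofFn (fun x : Fin m => f x) = (List.range m).map f := by
  apply List.ext_getElem
  · simp
  · intro i h1 h2
    simp

theorem colList_equiv {ν : YoungDiagram} (T : SemistandardYoungTableau ν) (hm : ν.rowLen 0 ≤ m) :
    BlockEquiv (List.ofFn fun x : Fin m => colSet T x) (colList T) := by
  rw [ofFn_eq_map_range]
  exact blockEquiv_map_range hm fun x hx => colSet_eq_empty T hx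

theorem mem_partitionsOf {n : ℕ} {ν : YoungDiagram} : ν ∈ partitionsOf n ↔ ν.card = n := by
  simp [partitionsOf]

theorem levelCard_colSet {ν : YoungDiagram} (T : SemistandardYoungTableau ν) (hm : ν.rowLen 0 ≤ m)
    (j : ℕ) : levelCard (fun x : Fin m => colSet T x) j = content T j := by
  rw [content_eq_card hm, levelCard, ← Finset.card_image_of_injective _ Fin.val_injective]
  congr 1
  ext a
  simp only [Finset.mem_image, Finset.mem_filter, Finset.mem_univ, true_and, Finset.mem_range]
  constructor
  · rintro ⟨x, hx, rfl⟩; exact ⟨x.isLt, hx⟩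
  · rintro ⟨h1, h2⟩; exact ⟨⟨a, h1⟩, h2, rfl⟩

theorem content_pos {ν : YoungDiagram} {T : SemistandardYoungTableau ν} {c k : ℕ}
    (h : k ∈ colSet T c) : 0 < content T k := by
  obtain ⟨i, hi, e⟩ := mem_colSet.mp h
  exact Finset.card_pos.mpr ⟨(i, c), Finset.mem_filter.mpr ⟨(YoungDiagram.mem_cells _).mpr
    (YoungDiagram.mem_iff_lt_colLen.mpr hi), e⟩⟩

theorem card_eq_sum_content {ν : YoungDiagram} {T : SemistandardYoungTableau ν} {b : ℕ}
    (h : ∀ k, b ≤ k → content T k = 0) : ν.card = ∑ k ∈ Finset.range b, content T k := by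
  unfold content YoungDiagram.card
  refine Finset.card_eq_sum_card_fiberwise fun c hc => ?_
  rw [Finset.mem_coe, YoungDiagram.mem_cells] at hc
  rw [Finset.mem_coe, Finset.mem_range]
  by_contra hb
  have := content_pos (T := T) (mem_colSet.mpr ⟨c.1, YoungDiagram.mem_iff_lt_colLen.mp hc, rfl⟩)
  rw [h _ (not_lt.mp hb)] at this
  omega

/-- The Schur expansion of the generating function of an invariant. -/
theorem genFun_eq_sum_schur [IsDomain R] {b n : ℕ} {α : ℕ → ℕ} (hα : ∀ j, b ≤ j → α j = 0)
    (hn : ∑ j ∈ Finset.range b, α j = n) {G : List (Finset ℕ) → R}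
    (hG : ∀ L L', BlockEquiv L L' → G L = G L') :
    genFun m b α (fun B => G (List.ofFn B)) = ∑ ν ∈ partitionsOf n, ∑ T ∈ ssyt ν α,
      MvPolynomial.C (G (colList T)) * schur R m ν.transpose := by
  classical
  apply mul_left_cancel₀ (alt_stair_ne_zero (m := m) (R := R))
  rw [sum_alt_eq_sum_highest b α (fun B B' h => hG _ _ h), Finset.sum_sigma', Finset.mul_sum]
  -- Shapes with more than `m` columns contribute nothing; for the others the bialternant formula
  -- applies, and padding the list of columns by empty blocks does not change `G`.
  have hterm : ∀ x : (ν : YoungDiagram) × SemistandardYoungTableau ν,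
      alt R (stair m) * (MvPolynomial.C (G (colList x.2)) * schur R m x.1.transpose) =
      if x.1.rowLen 0 ≤ m then MvPolynomial.C (G (List.ofFn fun y : Fin m => colSet x.2 y)) *
        alt R (stair m + weight fun y : Fin m => colSet x.2 y) else 0 := by
    rintro ⟨ν, T⟩
    simp only
    split_ifs with h
    · rw [mul_left_comm, alt_mul_schur _ (by rwa [YoungDiagram.colLen_transpose]),
        hG _ _ (colList_equiv T h)]
      congr 3
      funext x
      rw [YoungDiagram.rowLen_transpose, weight, card_colSet]
    · rw [schur_eq_zero _ (by rw [YoungDiagram.colLen_transpose]; omega), mul_zero, mul_zero]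
  simp only [hterm]
  rw [← Finset.sum_filter]
  symm
  refine Finset.sum_bij (fun x _ (y : Fin m) => colSet x.2 y) ?_ ?_ ?_ ?_
  · rintro ⟨ν, T⟩ hx
    obtain ⟨hx1, hx2⟩ := Finset.mem_filter.mp hx
    have hT := mem_ssyt.mp (Finset.mem_sigma.mp hx1).2
    refine Finset.mem_filter.mpr ⟨mem_fillings.mpr ⟨fun y k hk => ?_, fun j => ?_⟩,
      fun j u v e => ?_⟩
    · have h1 := content_pos hk
      rw [hT] at h1
      rw [Finset.mem_range]
      by_contra hb
      rw [hα k (not_lt.mp hb)] at h1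
      omega
    · rw [levelCard_colSet T hx2, hT]
    · simp only [below, e]
      exact colSet_dominance T u j
  · rintro ⟨ν, T⟩ hx ⟨ν', T'⟩ hx' e
    obtain ⟨-, hx2⟩ := Finset.mem_filter.mp hx
    obtain ⟨-, hx2'⟩ := Finset.mem_filter.mp hx'
    simp only at e hx2 hx2'
    have hc : ∀ c, colSet T c = colSet T' c := by
      intro c
      by_cases hc : c < m
      · exact congrFun e ⟨c, hc⟩
      · rw [colSet_eq_empty T (by omega), colSet_eq_empty T' (by omega)]
    obtain rfl : ν = ν' := youngDiagram_ext_colLen fun c => by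
      rw [← card_colSet T, ← card_colSet T', hc]
    rw [ssyt_ext_colSet hc]
  · intro B hB
    obtain ⟨hB1, hB2⟩ := Finset.mem_filter.mp hB
    obtain ⟨hB3, hB4⟩ := mem_fillings.mp hB1
    -- The family continued by empty columns; its block sizes decrease and define the conjugate of
    -- the shape.
    let S : ℕ → Finset ℕ := fun c => if h : c < m then B ⟨c, h⟩ else ∅
    have hS : ∀ x : Fin m, S x = B x := fun x => dif_pos x.isLt
    have hS0 : ∀ c, m ≤ c → S c = ∅ := fun c hc => dif_neg (by omega)
    have hdom : ∀ c j, (S (c + 1) ∩ Finset.range j).card ≤ (S c ∩ Finset.range j).card := by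
      intro c j
      by_cases hc : c + 1 < m
      · have := hB2 j ⟨c, by omega⟩ ⟨c + 1, hc⟩ rfl
        unfold below at this
        rw [← hS, ← hS] at this
        exact this
      · rw [hS0 (c + 1) (by omega)]
        simp
    have hSb : ∀ c, S c ⊆ Finset.range b := by
      intro c
      by_cases hc : c < m
      · have := hS ⟨c, hc⟩
        simp only at this
        rw [this]
        exact hB3 _
      · rw [hS0 c (by omega)]; exact Finset.empty_subset _
    have hanti : Antitone fun c => (S c).card := antitone_nat_of_succ_le fun c => by
      have := hdom c b
      rwa [Finset.inter_eq_left.mpr (hSb _), Finset.inter_eq_left.mpr (hSb _)] at this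
    have h0 : (S m).card = 0 := by rw [hS0 m le_rfl, Finset.card_empty]
    set ν := (ofRowFun (fun c => (S c).card) m hanti).transpose with hν
    have hcol : ∀ c, ν.colLen c = (S c).card := fun c => by
      rw [hν, YoungDiagram.colLen_transpose, rowLen_ofRowFun _ _ _ h0]
    obtain ⟨T, hT⟩ := exists_ssyt_colSet (ν := ν) S (fun c => (hcol c).symm) hdom
    have hm : ν.rowLen 0 ≤ m := colLen_eq_zero_iff.mp (by rw [hcol, h0])
    have hBT : (fun x : Fin m => colSet T x) = B := by
      funext x
      rw [hT, hS]
    have hcont : ∀ k, content T k = α k := fun k => by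
      rw [← levelCard_colSet T hm, hBT, hB4]
    refine ⟨⟨ν, T⟩, Finset.mem_filter.mpr ⟨Finset.mem_sigma.mpr ⟨?_, mem_ssyt.mpr hcont⟩, hm⟩, hBT⟩
    rw [mem_partitionsOf, card_eq_sum_content (T := T) (b := b) fun k hk => by
      rw [hcont, hα k hk]]
    simp only [hcont, hn]
  · intro x hx
    rfl

/-! ### Products -/

/-- The sequence `α 0, …, α (b - 1), β 0, β 1, …`. -/
def concat (b : ℕ) (α β : ℕ → ℕ) (j : ℕ) : ℕ := if j < b then α j else β (j - b)

/-- The union of a family of blocks and of the shift by `b` of another one. -/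
def join (b : ℕ) (B B' : Fin m → Finset ℕ) (x : Fin m) : Finset ℕ :=
  B x ∪ (B' x).image (b + ·)

theorem mem_join {b : ℕ} {B B' : Fin m → Finset ℕ} (hB : ∀ y, B y ⊆ Finset.range b) {x : Fin m}
    {j : ℕ} : j ∈ join b B B' x ↔ if j < b then j ∈ B x else j - b ∈ B' x := by
  unfold join
  simp only [Finset.mem_union, Finset.mem_image]
  split_ifs with h
  · refine ⟨fun hh => hh.resolve_right ?_, Or.inl⟩
    rintro ⟨i, -, rfl⟩
    omega
  · constructor
    · rintro (hh | ⟨i, hi, rfl⟩)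
      · exact absurd (Finset.mem_range.mp (hB x hh)) h
      · rwa [Nat.add_sub_cancel_left]
    · intro hh
      exact Or.inr ⟨j - b, hh, by omega⟩

theorem weight_join {b : ℕ} {B B' : Fin m → Finset ℕ} (hB : ∀ y, B y ⊆ Finset.range b) :
    weight (join b B B') = weight B + weight B' := by
  funext x
  unfold weight join
  rw [Finset.card_union_of_disjoint, Finset.card_image_of_injective _ (add_right_injective b)]
  · rfl
  · rw [Finset.disjoint_left]
    intro j hj hj'
    obtain ⟨i, -, rfl⟩ := Finset.mem_image.mp hj'
    have := Finset.mem_range.mp (hB x hj)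
    omega

theorem levelCard_join {b : ℕ} {B B' : Fin m → Finset ℕ} (hB : ∀ y, B y ⊆ Finset.range b) (j : ℕ) :
    levelCard (join b B B') j = concat b (levelCard B) (levelCard B') j := by
  unfold levelCard concat
  simp only [mem_join hB]
  split_ifs <;> rfl

/-- A pair of families on the alphabets `[0, b)` and `[0, b')` is one family on the concatenated
alphabet. -/
theorem sum_fillings_join {M : Type*} [AddCommMonoid M] {b b' : ℕ} {α β : ℕ → ℕ}
    (hα : ∀ j, b ≤ j → α j = 0) (f : (Fin m → Finset ℕ) → M) :
    ∑ x ∈ fillings m b α ×ˢ fillings m b' β, f (join b x.1 x.2) =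
      ∑ B ∈ fillings m (b + b') (concat b α β), f B := by
  classical
  refine Finset.sum_bij (fun x _ => join b x.1 x.2) ?_ ?_ ?_ fun _ _ => rfl
  · rintro ⟨B, B'⟩ hx
    obtain ⟨h1, h2⟩ := Finset.mem_product.mp hx
    obtain ⟨h3, h4⟩ := mem_fillings.mp h1
    obtain ⟨h5, h6⟩ := mem_fillings.mp h2
    simp only at h3 h4 h5 h6 ⊢
    refine mem_fillings.mpr ⟨fun y j hj => ?_, fun j => ?_⟩
    · rw [mem_join h3] at hj
      rw [Finset.mem_range]
      split_ifs at hj with h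
      · omega
      · have := Finset.mem_range.mp (h5 y hj); omega
    · rw [levelCard_join h3]
      unfold concat
      simp only [h4, h6]
  · rintro ⟨B, B'⟩ hx ⟨C, C'⟩ hy e
    obtain ⟨h1, -⟩ := Finset.mem_product.mp hx
    obtain ⟨h2, -⟩ := Finset.mem_product.mp hy
    have h3 := (mem_fillings.mp h1).1
    have h4 := (mem_fillings.mp h2).1
    simp only at e h3 h4
    have key : ∀ y j, j ∈ join b B B' y ↔ j ∈ join b C C' y := fun y j => by rw [e]
    simp only [mem_join h3, mem_join h4] at key
    refine Prod.ext ?_ ?_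
    · funext y
      ext j
      by_cases hj : j < b
      · have := key y j
        rwa [if_pos hj, if_pos hj] at this
      · exact ⟨fun h => absurd (Finset.mem_range.mp (h3 y h)) hj,
          fun h => absurd (Finset.mem_range.mp (h4 y h)) hj⟩
    · funext y
      ext j
      have := key y (b + j)
      rwa [if_neg (by omega), if_neg (by omega), Nat.add_sub_cancel_left] at this
  · intro D hD
    obtain ⟨h1, h2⟩ := mem_fillings.mp hD
    have h3 : ∀ y, D y ∩ Finset.range b ⊆ Finset.range b := fun y => Finset.inter_subset_right
    have e : join b (fun y => D y ∩ Finset.range b)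
        (fun y => (Finset.range b').filter fun j => b + j ∈ D y) = D := by
      funext y
      ext j
      rw [mem_join h3]
      split_ifs with h
      · simp [h]
      · simp only [Finset.mem_filter, Finset.mem_range, show b + (j - b) = j by omega,
          and_iff_right_iff_imp]
        intro hj
        have := Finset.mem_range.mp (h1 y hj)
        omega
    have hl := fun j => levelCard_join (B' := fun y => (Finset.range b').filter fun j => b + j ∈ D y)
      h3 j
    simp only [e, h2] at hl
    refine ⟨(_, _), Finset.mem_product.mpr ⟨mem_fillings.mpr ⟨h3, fun j => ?_⟩,
      mem_fillings.mpr ⟨fun y => Finset.filter_subset _ _, fun j => ?_⟩⟩, e⟩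
    · by_cases hj : j < b
      · have := hl j
        unfold concat at this
        rw [if_pos hj, if_pos hj] at this
        exact this.symm
      · rw [hα j (by omega), levelCard, Finset.card_eq_zero, Finset.filter_eq_empty_iff]
        intro y _ hy
        exact hj (Finset.mem_range.mp (h3 y hy))
    · have := hl (b + j)
      unfold concat at this
      rw [if_neg (by omega), if_neg (by omega), Nat.add_sub_cancel_left] at this
      exact this.symm

theorem latticeAt_join_left {b : ℕ} {B B' : Fin m → Finset ℕ} (hB : ∀ y, B y ⊆ Finset.range b)
    {j : ℕ} (hj : j + 1 < b) :
    LatticeAt j (List.ofFn (join b B B')) ↔ LatticeAt j (List.ofFn B) := by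
  rw [latticeAt_iff_up, latticeAt_iff_up]
  simp only [up_levelSet_ofFn, mem_join hB, if_pos hj, if_pos (show j < b by omega)]

theorem latticeAt_join_right {b : ℕ} {B B' : Fin m → Finset ℕ} (hB : ∀ y, B y ⊆ Finset.range b)
    (j : ℕ) : LatticeAt (b + j) (List.ofFn (join b B B')) ↔ LatticeAt j (List.ofFn B') := by
  rw [latticeAt_iff_up, latticeAt_iff_up]
  simp only [up_levelSet_ofFn, mem_join hB, if_neg (show ¬ b + j < b by omega),
    if_neg (show ¬ b + j + 1 < b by omega), Nat.add_sub_cancel_left,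
    show b + j + 1 - b = j + 1 by omega]

/-- The lattice condition for the letters less than `b`, and for the letters in `[b, b + b')`. -/
def DoubleLattice (b b' : ℕ) (L : List (Finset ℕ)) : Prop :=
  (∀ j, j + 1 < b → LatticeAt j L) ∧ ∀ j, j + 1 < b' → LatticeAt (b + j) L

theorem BlockEquiv.doubleLattice_iff {L L' : List (Finset ℕ)} (h : BlockEquiv L L') (b b' : ℕ) :
    DoubleLattice b b' L ↔ DoubleLattice b b' L' := by
  unfold DoubleLattice
  simp only [h.latticeAt_iff]

open Classical in
/-- The number of tableaux which give the Littlewood–Richardson coefficient. -/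
def lrNumber (μ ν κ : YoungDiagram) : ℕ :=
  ((ssyt κ.transpose (concat (μ.rowLen 0) μ.colLen ν.colLen)).filter fun T =>
    DoubleLattice (μ.rowLen 0) (ν.rowLen 0) (colList T)).card

theorem card_eq_sum_colLen (ν : YoungDiagram) :
    ∑ j ∈ Finset.range (ν.rowLen 0), ν.colLen j = ν.card := by
  unfold YoungDiagram.card
  symm
  simp only [YoungDiagram.colLen_eq_card, YoungDiagram.col]
  refine Finset.card_eq_sum_card_fiberwise fun c hc => ?_
  rw [Finset.mem_coe, YoungDiagram.mem_cells] at hc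
  rw [Finset.mem_coe, Finset.mem_range]
  exact YoungDiagram.mem_iff_lt_rowLen.mp (ν.up_left_mem (Nat.zero_le c.1) le_rfl hc)

theorem sum_concat (b b' : ℕ) (α β : ℕ → ℕ) :
    ∑ j ∈ Finset.range (b + b'), concat b α β j =
      ∑ j ∈ Finset.range b, α j + ∑ j ∈ Finset.range b', β j := by
  rw [Finset.sum_range_add]
  congr 1
  · exact Finset.sum_congr rfl fun j hj => if_pos (Finset.mem_range.mp hj)
  · refine Finset.sum_congr rfl fun j _ => ?_
    rw [concat, if_neg (by omega), Nat.add_sub_cancel_left]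

theorem concat_eq_zero {μ ν : YoungDiagram} {j : ℕ} (hj : μ.rowLen 0 + ν.rowLen 0 ≤ j) :
    concat (μ.rowLen 0) μ.colLen ν.colLen j = 0 := by
  rw [concat, if_neg (by omega), colLen_eq_zero_iff]
  omega

theorem card_transpose (ν : YoungDiagram) : ν.transpose.card = ν.card := by
  rw [← card_eq_sum_colLen, ← card_eq_sum_colLen]
  simp only [YoungDiagram.colLen_transpose, YoungDiagram.rowLen_transpose]
  have h := card_eq_sum_colLen ν
  rw [h]
  unfold YoungDiagram.card
  symm
  simp only [YoungDiagram.rowLen_eq_card, YoungDiagram.row]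
  refine Finset.card_eq_sum_card_fiberwise fun c hc => ?_
  rw [Finset.mem_coe, YoungDiagram.mem_cells] at hc
  rw [Finset.mem_coe, Finset.mem_range]
  exact YoungDiagram.mem_iff_lt_colLen.mp (ν.up_left_mem le_rfl (Nat.zero_le c.2) hc)

theorem sum_partitionsOf_transpose {M : Type*} [AddCommMonoid M] (n : ℕ) (f : YoungDiagram → M) :
    ∑ ν ∈ partitionsOf n, f ν.transpose = ∑ ν ∈ partitionsOf n, f ν := by
  refine Finset.sum_nbij' YoungDiagram.transpose YoungDiagram.transpose ?_ ?_ ?_ ?_ ?_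
  · intro ν hν
    rw [mem_partitionsOf] at hν ⊢
    rw [card_transpose, hν]
  · intro ν hν
    rw [mem_partitionsOf] at hν ⊢
    rw [card_transpose, hν]
  · intro ν _; exact ν.transpose_transpose
  · intro ν _; exact ν.transpose_transpose
  · intro ν _; rfl

/-- The product of the two generating functions of lattice families is the generating function of
the joined families with the indicator of `DoubleLattice`. This indicator is invariant, so
`genFun_eq_sum_schur` expands it. -/
theorem schur_mul_schur [IsDomain R] (μ ν : YoungDiagram) :
    schur R m μ * schur R m ν =
      ∑ κ ∈ partitionsOf (μ.card + ν.card), (lrNumber μ ν κ : MvPolynomial (Fin m) R) * schur R m κ := by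
  classical
  have h := genFun_eq_sum_schur (m := m) (R := R) (b := μ.rowLen 0 + ν.rowLen 0)
    (n := μ.card + ν.card) (α := concat (μ.rowLen 0) μ.colLen ν.colLen)
    (fun j => concat_eq_zero) (by rw [sum_concat, card_eq_sum_colLen, card_eq_sum_colLen])
    (G := fun L => if DoubleLattice (μ.rowLen 0) (ν.rowLen 0) L then 1 else 0)
    (fun L L' e => if_congr (e.doubleLattice_iff _ _) rfl rfl)
  rw [← sum_partitionsOf_transpose]
  have h2 : ∀ κ ∈ partitionsOf (μ.card + ν.card),
      (lrNumber μ ν κ.transpose : MvPolynomial (Fin m) R) * schur R m κ.transpose =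
      ∑ T ∈ ssyt κ (concat (μ.rowLen 0) μ.colLen ν.colLen),
      MvPolynomial.C (if DoubleLattice (μ.rowLen 0) (ν.rowLen 0) (colList T) then (1 : R) else 0) *
        schur R m κ.transpose := by
    intro κ _
    rw [← Finset.sum_mul, lrNumber, YoungDiagram.transpose_transpose, Finset.card_filter]
    push_cast
    congr 1
    refine Finset.sum_congr rfl fun T _ => ?_
    split_ifs <;> simp
  rw [Finset.sum_congr rfl h2, ← h, genFun, ← sum_fillings_join fun j hj => colLen_eq_zero_iff.mpr hj,
    schur_eq_genFun μ le_rfl, schur_eq_genFun ν le_rfl, genFun, genFun, Finset.sum_mul_sum,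
    ← Finset.sum_product']
  refine Finset.sum_congr rfl fun x hx => ?_
  obtain ⟨h1, h2⟩ := Finset.mem_product.mp hx
  have h3 := (mem_fillings.mp h1).1
  rw [weight_join h3, mono_add, mul_mul_mul_comm, ← MvPolynomial.C_mul]
  congr 2
  have hiff : DoubleLattice (μ.rowLen 0) (ν.rowLen 0) (List.ofFn (join (μ.rowLen 0) x.1 x.2)) ↔
      (∀ j, 0 ≤ j → j + 1 < μ.rowLen 0 → LatticeAt j (List.ofFn x.1)) ∧
      ∀ j, 0 ≤ j → j + 1 < ν.rowLen 0 → LatticeAt j (List.ofFn x.2) := by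
    unfold DoubleLattice
    refine and_congr ⟨fun h j _ hj => (latticeAt_join_left h3 hj).mp (h j hj),
      fun h j hj => (latticeAt_join_left h3 hj).mpr (h j (Nat.zero_le _) hj)⟩ ?_
    exact ⟨fun h j _ hj => (latticeAt_join_right h3 j).mp (h j hj),
      fun h j hj => (latticeAt_join_right h3 j).mpr (h j (Nat.zero_le _) hj)⟩
  simp only [hiff, latInd]
  generalize (∀ j, 0 ≤ j → j + 1 < μ.rowLen 0 → LatticeAt j (List.ofFn x.1)) = p
  generalize (∀ j, 0 ≤ j → j + 1 < ν.rowLen 0 → LatticeAt j (List.ofFn x.2)) = q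
  by_cases hp : p <;> by_cases hq : q <;> simp [hp, hq]

/-! ### Littlewood–Richardson coefficients -/

/-- After multiplication by the Vandermonde alternant in sufficiently many variables, the
coefficient of the monomial with exponent staircase plus `κ` isolates the coefficient at `κ`. -/
theorem schur_injective {c c' : YoungDiagram →₀ ℤ}
    (h : ∀ m, (c.sum fun κ a => a • schur ℤ m κ) = c'.sum fun κ a => a • schur ℤ m κ) : c = c' := by
  classical
  ext κ
  set S := insert κ (c.support ∪ c'.support) with hS
  obtain ⟨m, hm⟩ : ∃ m, ∀ ρ ∈ S, ρ.colLen 0 ≤ m :=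
    ⟨S.sup fun ρ => ρ.colLen 0, fun ρ hρ => Finset.le_sup (f := fun ρ => ρ.colLen 0) hρ⟩
  have hstr : ∀ ρ : YoungDiagram, StrictAnti (stair m + fun x : Fin m => ρ.rowLen x) := fun ρ =>
    stair_add_strictAnti (f := ρ.rowLen) fun i j hij => ρ.rowLen_anti i j hij
  have key : ∀ d : YoungDiagram →₀ ℤ, d.support ⊆ S →
      MvPolynomial.coeff (Finsupp.equivFunOnFinite.symm (stair m + fun x : Fin m => κ.rowLen x))
        (alt ℤ (stair m) * d.sum fun κ a => a • schur ℤ m κ) = d κ := by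
    intro d hd
    rw [Finsupp.sum_of_support_subset d hd (fun κ a => a • schur ℤ m κ)
      (fun _ _ => zero_smul ℤ _), Finset.mul_sum,
      MvPolynomial.coeff_sum, Finset.sum_eq_single κ]
    · rw [mul_smul_comm, alt_mul_schur _ (hm κ (Finset.mem_insert_self _ _)),
        MvPolynomial.coeff_smul, coeff_alt (hstr κ) (hstr κ), if_pos rfl, smul_eq_mul, mul_one]
    · intro ρ hρ hne
      rw [mul_smul_comm, alt_mul_schur _ (hm ρ hρ), MvPolynomial.coeff_smul,
        coeff_alt (hstr κ) (hstr ρ), if_neg, smul_zero]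
      intro e
      apply hne
      refine youngDiagram_ext_rowLen fun i => ?_
      by_cases hi : i < m
      · have := congrFun e ⟨i, hi⟩
        simpa using this
      · rw [rowLen_eq_zero_iff.mpr ((hm ρ hρ).trans (not_lt.mp hi)),
          rowLen_eq_zero_iff.mpr ((hm κ (Finset.mem_insert_self _ _)).trans (not_lt.mp hi))]
    · intro hκ
      exact absurd (Finset.mem_insert_self _ _) hκ
  rw [← key c (Finset.subset_union_left.trans (Finset.subset_insert _ _)), h,
    key c' (Finset.subset_union_right.trans (Finset.subset_insert _ _))]

theorem lrNumber_eq_zero {μ ν κ : YoungDiagram} (h : lrNumber μ ν κ ≠ 0) :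
    κ ∈ partitionsOf (μ.card + ν.card) := by
  classical
  obtain ⟨T, hT⟩ := Finset.card_pos.mp (Nat.pos_of_ne_zero h)
  have hc := mem_ssyt.mp (Finset.mem_filter.mp hT).1
  rw [mem_partitionsOf, ← card_transpose, card_eq_sum_content (T := T)
    (b := μ.rowLen 0 + ν.rowLen 0) fun k hk => by rw [hc, concat_eq_zero hk]]
  simp only [hc]
  rw [sum_concat, card_eq_sum_colLen, card_eq_sum_colLen]

/-- The expansion of a product of Schur functions. -/
def lrExpansion (μ ν : YoungDiagram) : YoungDiagram →₀ ℤ :=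
  Finsupp.onFinset (partitionsOf (μ.card + ν.card)) (fun κ => (lrNumber μ ν κ : ℤ)) fun _ h =>
    lrNumber_eq_zero (by exact_mod_cast h)

theorem isSchurProductExpansion_lrExpansion (μ ν : YoungDiagram) :
    IsSchurProductExpansion μ ν (lrExpansion μ ν) := by
  intro m
  rw [schur_mul_schur, lrExpansion, Finsupp.onFinset_sum (g := fun κ a => a • schur ℤ m κ) _
    (fun _ => zero_smul ℤ _)]
  refine Finset.sum_congr rfl fun κ _ => ?_
  rw [zsmul_eq_mul]
  push_cast
  rfl

theorem existsUnique_expansion (μ ν : YoungDiagram) :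
    ∃! c : YoungDiagram →₀ ℤ, IsSchurProductExpansion μ ν c :=
  ⟨lrExpansion μ ν, isSchurProductExpansion_lrExpansion μ ν, fun c hc =>
    schur_injective fun m => by rw [← hc m, ← isSchurProductExpansion_lrExpansion μ ν m]⟩

theorem lrCoeff_eq (μ ν κ : YoungDiagram) : lrCoeff μ ν κ = lrNumber μ ν κ := by
  have h := (existsUnique_expansion μ ν).exists
  rw [lrCoeff, dif_pos h,
    (existsUnique_expansion μ ν).unique h.choose_spec (isSchurProductExpansion_lrExpansion μ ν)]
  rfl

end

section

/-! ### The columns and the reading word of a tableau are equivalent -/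

/-- No letter lies below `z`, so the condition on the left is trivial, and the condition on the
right is the dominance of columns. -/
theorem canRaise_insert {U V : Finset ℕ} {z : ℕ} (hU : ∀ a ∈ U, z < a) (hV : ∀ a ∈ V, z < a)
    (h : ∀ j, (V ∩ Finset.range j).card ≤ (U ∩ Finset.range j).card) :
    CanRaise U (insert z V) z where
  mem := Finset.mem_insert_self _ _
  notMem hz := lt_irrefl _ (hU z hz)
  left i hi := by
    have h1 : U ∩ Finset.Icc i z = ∅ := by
      rw [Finset.eq_empty_iff_forall_notMem]
      intro a ha
      obtain ⟨ha1, ha2⟩ := Finset.mem_inter.mp ha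
      exact absurd (hU a ha1) (not_lt.mpr (Finset.mem_Icc.mp ha2).2)
    rw [h1, Finset.card_empty]
    exact Finset.card_pos.mpr ⟨z, by simp [hi]⟩
  right j hj := by
    have h1 : insert z V ∩ Finset.Ioc z j = V ∩ Finset.range (j + 1) := by
      ext a
      have := hV a
      simp only [Finset.mem_inter, Finset.mem_insert, Finset.mem_Ioc, Finset.mem_range]
      constructor
      · rintro ⟨h1 | h1, h2⟩
        · omega
        · exact ⟨h1, by omega⟩
      · rintro ⟨h1, h2⟩
        exact ⟨Or.inr h1, this h1, by omega⟩
    have h2 : U ∩ Finset.Ioc z j = U ∩ Finset.range (j + 1) := by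
      ext a
      have := hU a
      simp only [Finset.mem_inter, Finset.mem_Ioc, Finset.mem_range]
      constructor
      · rintro ⟨h1, h2⟩
        exact ⟨h1, by omega⟩
      · rintro ⟨h1, h2⟩
        exact ⟨h1, this h1, by omega⟩
    rw [h1, h2]
    exact h (j + 1)

/-- The blocks `U` and `V` can be consecutive columns of a semistandard tableau. -/
def Dominates (U V : Finset ℕ) : Prop :=
  ∀ j, (V ∩ Finset.range j).card ≤ (U ∩ Finset.range j).card

theorem Dominates.lt {U V : Finset ℕ} (h : Dominates U V) {z : ℕ} (hU : ∀ a ∈ U, z < a) :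
    ∀ a ∈ V, z < a := by
  intro a ha
  have h1 : 0 < (U ∩ Finset.range (a + 1)).card :=
    lt_of_lt_of_le (Finset.card_pos.mpr ⟨a, by simp [ha]⟩) (h (a + 1))
  obtain ⟨b, hb⟩ := Finset.card_pos.mp h1
  obtain ⟨hb1, hb2⟩ := Finset.mem_inter.mp hb
  have := hU b hb1
  rw [Finset.mem_range] at hb2
  omega

theorem BlockEquiv.raise_insert {U V : Finset ℕ} {z : ℕ} (hU : ∀ a ∈ U, z < a)
    (h : Dominates U V) (Z : List (Finset ℕ)) :
    BlockEquiv (U :: insert z V :: Z) (insert z U :: V :: Z) := by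
  have hV := h.lt hU
  have h1 := BlockStep.raise [] Z U (insert z V) z (canRaise_insert hU hV h)
  rw [Finset.erase_insert fun hz => lt_irrefl _ (hV z hz)] at h1
  exact BlockEquiv.of_step h1

/-- A letter smaller than all entries slides to the left through the columns, one raising move at a
time, until it sits on top of the first column. -/
theorem BlockEquiv.merge_letter {z : ℕ} (Z : List (Finset ℕ)) (k : ℕ) (f : ℕ → Finset ℕ)
    (hf : ∀ c, Dominates (f c) (f (c + 1))) (hz : ∀ a ∈ f 0, z < a) :
    BlockEquiv ((List.range (k + 1)).map f ++ {z} :: Z)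
      (insert z (f 0) :: (List.range k).map (fun c => f (c + 1)) ++ Z) := by
  induction k generalizing f with
  | zero =>
    have h1 := BlockEquiv.raise_insert (V := ∅) hz (fun j => by simp) Z
    exact h1.trans (BlockEquiv.of_step (BlockStep.dropEmpty [insert z (f 0)] Z))
  | succ k ih =>
    have h1 := (ih (fun c => f (c + 1)) (fun c => hf (c + 1)) ((hf 0).lt hz)).cons (f 0)
    rw [List.range_succ_eq_map, List.map_cons, List.map_map]
    refine h1.trans ?_
    rw [List.range_succ_eq_map, List.map_cons, List.map_map]
    exact BlockEquiv.raise_insert hz (hf 0) _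

/-- The first letter of the row slides to the first column, the second one to the second column, and
so on. Letters beyond the last column become new columns. -/
theorem BlockEquiv.merge_row {k l : ℕ} (hkl : k ≤ l) (f : ℕ → Finset ℕ) (g : ℕ → ℕ)
    (hf : ∀ c, Dominates (f c) (f (c + 1))) (h0 : ∀ c, k ≤ c → f c = ∅)
    (hg : ∀ c < k, ∀ a ∈ f c, g c < a) :
    BlockEquiv ((List.range k).map f ++ singles ((List.range l).map g))
      ((List.range l).map fun c => insert (g c) (f c)) := by
  induction l generalizing k f g with
  | zero =>
    obtain rfl : k = 0 := by omega
    exact BlockEquiv.refl _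
  | succ l ih =>
    rcases k with _ | k
    · have : (fun c => insert (g c) (f c)) = fun c => ({g c} : Finset ℕ) := by
        funext c
        rw [h0 c (Nat.zero_le _)]
        rfl
      rw [this]
      simp only [List.range_zero, List.map_nil, List.nil_append, singles, List.map_map]
      exact BlockEquiv.refl _
    · have h1 := ih (k := k) (by omega) (fun c => f (c + 1)) (fun c => g (c + 1))
        (fun c => hf (c + 1)) (fun c hc => h0 _ (by omega)) fun c hc => hg _ (by omega)
      have h2 := BlockEquiv.merge_letter (z := g 0)
        (singles ((List.range l).map fun c => g (c + 1))) k f hf (hg 0 (by omega))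
      rw [List.range_succ_eq_map (n := l), List.map_cons, List.map_cons, List.map_map,
        List.map_map]
      exact h2.trans (h1.cons _)

variable {ν : YoungDiagram}

/-- The entries of column `c` of `T` in the rows from `i` on. -/
def lowerCol (T : SemistandardYoungTableau ν) (i c : ℕ) : Finset ℕ :=
  (Finset.Ico i (ν.colLen c)).image fun r => T r c

theorem lowerCol_zero (T : SemistandardYoungTableau ν) (c : ℕ) : lowerCol T 0 c = colSet T c := by
  rw [lowerCol, colSet, Finset.range_eq_Ico]

theorem lowerCol_eq_empty (T : SemistandardYoungTableau ν) {i c : ℕ} (h : ν.rowLen i ≤ c) :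
    lowerCol T i c = ∅ := by
  rw [lowerCol, Finset.Ico_eq_empty, Finset.image_empty]
  intro h1
  have := YoungDiagram.mem_iff_lt_rowLen.mp (YoungDiagram.mem_iff_lt_colLen.mpr h1)
  omega

theorem lowerCol_succ (T : SemistandardYoungTableau ν) {i c : ℕ} (h : c < ν.rowLen i) :
    lowerCol T i c = insert (T i c) (lowerCol T (i + 1) c) := by
  have h1 := YoungDiagram.mem_iff_lt_colLen.mp (YoungDiagram.mem_iff_lt_rowLen.mpr h)
  rw [lowerCol, lowerCol, ← Finset.insert_Ico_add_one_left_eq_Ico h1, Finset.image_insert]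

theorem lowerCol_dominates (T : SemistandardYoungTableau ν) (i c : ℕ) :
    Dominates (lowerCol T i c) (lowerCol T i (c + 1)) := by
  intro j
  have key : ∀ c, (lowerCol T i c ∩ Finset.range j).card =
      ((Finset.Ico i (ν.colLen c)).filter fun r => T r c < j).card := by
    intro c
    rw [← Finset.card_image_of_injOn (s := (Finset.Ico i (ν.colLen c)).filter fun r => T r c < j)
      (f := fun r => T r c)]
    · congr 1
      ext a
      simp only [lowerCol, Finset.mem_inter, Finset.mem_image, Finset.mem_range, Finset.mem_filter]
      constructor
      · rintro ⟨⟨r, h1, rfl⟩, h2⟩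
        exact ⟨r, ⟨h1, h2⟩, rfl⟩
      · rintro ⟨r, ⟨h1, h2⟩, rfl⟩
        exact ⟨⟨r, h1, rfl⟩, h2⟩
    · refine (col_injOn T c).mono fun r hr => ?_
      have h1 := (Finset.mem_filter.mp (Finset.mem_coe.mp hr)).1
      simpa using (Finset.mem_Ico.mp h1).2
  rw [key, key]
  refine Finset.card_le_card fun r hr => ?_
  obtain ⟨h1, h2⟩ := Finset.mem_filter.mp hr
  rw [Finset.mem_Ico] at h1
  have h3 := ν.colLen_anti c (c + 1) (Nat.le_succ c)
  refine Finset.mem_filter.mpr ⟨Finset.mem_Ico.mpr ⟨h1.1, by omega⟩, ?_⟩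
  exact lt_of_le_of_lt (T.row_weak (Nat.lt_succ_self c)
    (YoungDiagram.mem_iff_lt_colLen.mpr h1.2)) h2

theorem singles_append (v w : List ℕ) : singles (v ++ w) = singles v ++ singles w := List.map_append

/-- The reading word of the rows from `i` on. -/
theorem lowerCols_equiv (T : SemistandardYoungTableau ν) (d : ℕ) :
    ∀ i, i + d = ν.colLen 0 →
    BlockEquiv ((List.range (ν.rowLen i)).map (lowerCol T i))
      (singles ((List.range' i d).reverse.flatMap fun r =>
        (List.range (ν.rowLen r)).map fun j => T r j)) := by
  induction d with
  | zero =>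
    intro i hi
    rw [rowLen_eq_zero_iff.mpr (by omega)]
    exact BlockEquiv.refl _
  | succ d ih =>
    intro i hi
    have h1 := ih (i + 1) (by omega)
    rw [List.range'_succ, List.reverse_cons, List.flatMap_append, singles_append,
      List.flatMap_singleton]
    -- Row `i` is put on top of the columns formed by the rows below it.
    have h2 := BlockEquiv.merge_row (ν.rowLen_anti i (i + 1) (Nat.le_succ i)) (lowerCol T (i + 1))
      (fun j => T i j) (lowerCol_dominates T (i + 1)) (fun c hc => lowerCol_eq_empty T hc)
      fun c hc a ha => by
        obtain ⟨r, hr, rfl⟩ := Finset.mem_image.mp ha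
        rw [Finset.mem_Ico] at hr
        exact T.col_strict (by omega) (YoungDiagram.mem_iff_lt_colLen.mpr hr.2)
    have h3 : (List.range (ν.rowLen i)).map (lowerCol T i) =
        (List.range (ν.rowLen i)).map fun c => insert (T i c) (lowerCol T (i + 1) c) :=
      List.map_congr_left fun c hc => lowerCol_succ T (List.mem_range.mp hc)
    rw [h3]
    exact h2.symm.trans (h1.append_right _)

theorem colList_equiv_readingWord (T : SemistandardYoungTableau ν) :
    BlockEquiv (colList T) (singles (readingWord T)) := by
  have h := lowerCols_equiv T (ν.colLen 0) 0 (Nat.zero_add _)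
  rw [← List.range_eq_range'] at h
  rw [readingWord]
  have h1 : colList T = (List.range (ν.rowLen 0)).map (lowerCol T 0) :=
    List.map_congr_left fun c _ => (lowerCol_zero T c).symm
  rw [h1]
  exact h

end

section

/-! ### Existence and uniqueness of row systems -/

/-- The first row takes the largest element of `C` not exceeding `a 0`, or the maximum of `C` if
there is none; the other rows continue with what is left. -/
theorem exists_greedy (n : ℕ) (a : ℕ → ℕ) (C : Finset ℕ) (hC : C.card = n) :
    ∃ b : ℕ → ℕ, (∀ i < n, b i ∈ C) ∧
      ∀ i i', i < i' → i' < n → IsInversionTriple (a i) (b i) (b i') := by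
  induction n generalizing a C with
  | zero => exact ⟨fun _ => 0, fun i hi => by omega, fun i i' _ h => by omega⟩
  | succ n ih =>
    have hne : C.Nonempty := Finset.card_pos.mp (by omega)
    obtain ⟨b₀, hb₀, h₀⟩ : ∃ b₀ ∈ C, ∀ c ∈ C, c ≠ b₀ → IsInversionTriple (a 0) b₀ c := by
      unfold IsInversionTriple
      by_cases h : (C.filter (· ≤ a 0)).Nonempty
      · obtain ⟨h1, h2⟩ := Finset.mem_filter.mp (Finset.max'_mem _ h)
        refine ⟨_, h1, fun c hc hne => ?_⟩
        have h3 := fun h' : c ≤ a 0 =>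
          Finset.le_max' (C.filter (· ≤ a 0)) c (Finset.mem_filter.mpr ⟨hc, h'⟩)
        by_cases h4 : c ≤ a 0
        · have := h3 h4
          omega
        · omega
      · refine ⟨_, C.max'_mem hne, fun c hc hne' => ?_⟩
        have h1 := C.le_max' c hc
        have h2 : ¬ c ≤ a 0 := fun h2 => h ⟨c, Finset.mem_filter.mpr ⟨hc, h2⟩⟩
        omega
    obtain ⟨b, hb1, hb2⟩ := ih (fun i => a (i + 1)) (C.erase b₀)
      (by rw [Finset.card_erase_of_mem hb₀, hC]; rfl)
    refine ⟨fun i => if i = 0 then b₀ else b (i - 1), fun i hi => ?_, fun i i' h h' => ?_⟩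
    · simp only
      split_ifs with h
      · exact hb₀
      · exact Finset.mem_of_mem_erase (hb1 _ (by omega))
    · simp only
      rw [if_neg (show i' ≠ 0 by omega)]
      have h1 := Finset.mem_erase.mp (hb1 (i' - 1) (by omega))
      split_ifs with h2
      · rw [h2]
        exact h₀ _ h1.2 h1.1
      · have := hb2 (i - 1) (i' - 1) (by omega) (by omega)
        rwa [Nat.sub_add_cancel (by omega)] at this

theorem exists_rowSystem (C : ℕ → Finset ℕ) (hC : ∀ j, (C (j + 1)).card ≤ (C j).card) :
    ∃ pos, RowSystem C pos := by
  choose g hg1 hg2 using fun (a : ℕ → ℕ) (S : Finset ℕ) => exists_greedy S.card a S rfl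
  let P : ℕ → ℕ → ℕ := fun j =>
    -- Starting every row at the maximum excludes wraparound on the level `0`, so the greedy choice
    -- there is decreasing.
    Nat.rec (g (fun _ => (C 0).sup id) (C 0)) (fun k p => g p (C (k + 1))) j
  refine ⟨fun i j => P j i, ?_, hC, ?_, ?_⟩
  · intro i j hi
    cases j with
    | zero => exact hg1 _ _ i hi
    | succ j => exact hg1 _ _ i hi
  · intro i i' h h'
    have h1 := hg2 (fun _ => (C 0).sup id) (C 0) i i' h h'
    have h2 : P 0 i' ≤ (C 0).sup id := Finset.le_sup (f := id) (hg1 _ _ i' h')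
    change IsInversionTriple _ (P 0 i) (P 0 i') at h1
    unfold IsInversionTriple at h1
    change P 0 i' < P 0 i
    omega
  · intro j i i' h h'
    exact hg2 _ _ i i' h h'

/-- At the first row where two systems differ on a level, each chosen position is taken by a later
row of the other system. Each of the two positions would then cyclically precede the other, as seen
from the same starting point. -/
theorem RowSystem.unique {C : ℕ → Finset ℕ} {pos pos' : ℕ → ℕ → ℕ} (h : RowSystem C pos)
    (h' : RowSystem C pos') (j i : ℕ) (hi : i < (C j).card) : pos i j = pos' i j := by
  have key : ∀ pos pos' : ℕ → ℕ → ℕ, RowSystem C pos → RowSystem C pos' → ∀ j i, i < (C j).card →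
      (∀ k < i, pos k j = pos' k j) → pos i j ≠ pos' i j →
      ∃ k, i < k ∧ k < (C j).card ∧ pos k j = pos' i j := by
    intro pos pos' h h' j i hi hk hne
    have h1 := h'.mem i j hi
    rw [h.eq_image j] at h1
    obtain ⟨k, hk1, hk2⟩ := Finset.mem_image.mp h1
    rw [Finset.mem_range] at hk1
    refine ⟨k, ?_, hk1, hk2⟩
    rcases lt_trichotomy i k with h2 | h2 | h2
    · exact h2
    · subst h2
      exact absurd hk2 hne
    · have h3 := hk k h2
      rw [hk2] at h3
      have := h'.injOn j (Finset.mem_coe.mpr (Finset.mem_range.mpr hi))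
        (Finset.mem_coe.mpr (Finset.mem_range.mpr hk1)) h3
      omega
  induction j generalizing i with
  | zero =>
    induction i using Nat.strong_induction_on with
    | _ i ih =>
      by_contra hne
      obtain ⟨k, h1, h2, h3⟩ := key pos pos' h h' 0 i hi (fun k hk => ih k hk (by omega)) hne
      obtain ⟨l, h4, h5, h6⟩ := key pos' pos h' h 0 i hi
        (fun k hk => (ih k hk (by omega)).symm) (Ne.symm hne)
      have h7 := h.first i k h1 h2
      have h8 := h'.first i l h4 h5
      omega
  | succ j ihj =>
    induction i using Nat.strong_induction_on with
    | _ i ih =>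
      by_contra hne
      obtain ⟨k, h1, h2, h3⟩ := key pos pos' h h' (j + 1) i hi (fun k hk => ih k hk (by omega)) hne
      obtain ⟨l, h4, h5, h6⟩ := key pos' pos h' h (j + 1) i hi
        (fun k hk => (ih k hk (by omega)).symm) (Ne.symm hne)
      have h7 := h.triple j i k h1 h2
      have h8 := h'.triple j i l h4 h5
      have h9 := ihj i (hi.trans_le (h.anti j))
      unfold IsInversionTriple at h7 h8
      omega

/-! ### Coinversion-free fillings -/

variable {lam : YoungDiagram} {m : ℕ}

theorem mem_levelSet_ofFn {B : Fin m → Finset ℕ} {j x : ℕ} :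
    x ∈ levelSet (List.ofFn B) j ↔ ∃ h : x < m, j ∈ B ⟨x, h⟩ := by
  rw [levelSet_ofFn, Finset.mem_image]
  constructor
  · rintro ⟨y, hy, rfl⟩
    exact ⟨y.isLt, (Finset.mem_filter.mp hy).2⟩
  · rintro ⟨h, hx⟩
    exact ⟨⟨x, h⟩, Finset.mem_filter.mpr ⟨Finset.mem_univ _, hx⟩, rfl⟩

/-- The entry of `F` in row `i` and column `j`. -/
def entry (F : lam.cells → Fin m) (i j : ℕ) : ℕ :=
  if h : (i, j) ∈ lam.cells then F ⟨(i, j), h⟩ else 0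

theorem entry_cell (F : lam.cells → Fin m) (b : lam.cells) : entry F b.1.1 b.1.2 = F b :=
  dif_pos b.2

/-- The columns in which each entry occurs. -/
def entryCols (F : lam.cells → Fin m) (x : Fin m) : Finset ℕ :=
  (Finset.univ.filter fun b => F b = x).image fun b => b.1.2

theorem mem_entryCols {F : lam.cells → Fin m} {x : Fin m} {j : ℕ} :
    j ∈ entryCols F x ↔ ∃ b : lam.cells, F b = x ∧ b.1.2 = j := by
  simp [entryCols]

/-- The triple conditions force the entries within a column to be distinct, so recording the columns
of each entry loses no multiplicity. -/
theorem IsCOF.injOn {F : lam.cells → Fin m} (hF : IsCOF F) {b b' : lam.cells}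
    (hb : b.1.2 = b'.1.2) (h : F b = F b') : b = b' := by
  have key : ∀ b b' : lam.cells, b.1.2 = b'.1.2 → b.1.1 < b'.1.1 → F b ≠ F b' := by
    intro b b' h1 h2 e
    rcases Nat.eq_zero_or_pos b.1.2 with h3 | h3
    · have := hF.2 b b' h3 (by omega) h2
      rw [e] at this
      exact lt_irrefl _ this
    · have ha : (b.1.1, b.1.2 - 1) ∈ lam.cells :=
        lam.up_left_mem le_rfl (Nat.sub_le _ _) b.2
      have := hF.1 ⟨_, ha⟩ b b' rfl (Nat.sub_add_cancel h3) h1.symm h2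
      unfold IsInversionTriple at this
      rw [e] at this
      omega
  rcases lt_trichotomy b.1.1 b'.1.1 with h1 | h1 | h1
  · exact absurd h (key _ _ hb h1)
  · exact Subtype.ext (Prod.ext h1 hb)
  · exact absurd h.symm (key _ _ hb.symm h1)

theorem levelCard_entryCols {F : lam.cells → Fin m} (hF : IsCOF F) (j : ℕ) :
    levelCard (entryCols F) j = lam.colLen j := by
  have h1 : (Finset.univ.filter fun x => j ∈ entryCols F x) =
      (Finset.univ.filter fun b : lam.cells => b.1.2 = j).image F := by
    ext x
    simp only [mem_entryCols, Finset.mem_filter, Finset.mem_univ, true_and, Finset.mem_image]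
    exact ⟨fun ⟨b, h, h'⟩ => ⟨b, h', h⟩, fun ⟨b, h, h'⟩ => ⟨b, h', h⟩⟩
  rw [levelCard, h1, Finset.card_image_of_injOn]
  · rw [YoungDiagram.colLen_eq_card, YoungDiagram.col]
    refine Finset.card_bij (fun b _ => b.1) ?_ ?_ ?_
    · intro b hb
      exact Finset.mem_filter.mpr ⟨b.2, (Finset.mem_filter.mp hb).2⟩
    · intro b _ b' _ h
      exact Subtype.ext h
    · intro c hc
      obtain ⟨hc1, hc2⟩ := Finset.mem_filter.mp hc
      exact ⟨⟨c, hc1⟩, Finset.mem_filter.mpr ⟨Finset.mem_univ _, hc2⟩, rfl⟩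
  · intro b hb b' hb' e
    have h2 := (Finset.mem_filter.mp (Finset.mem_coe.mp hb)).2
    have h3 := (Finset.mem_filter.mp (Finset.mem_coe.mp hb')).2
    exact hF.injOn (h2.trans h3.symm) e

theorem card_levelSet_ofFn (B : Fin m → Finset ℕ) (j : ℕ) :
    (levelSet (List.ofFn B) j).card = levelCard B j := by
  rw [← cnt_eq_card, cnt_ofFn]

theorem IsCOF.rowSystem {F : lam.cells → Fin m} (hF : IsCOF F) :
    RowSystem (levelSet (List.ofFn (entryCols F))) (entry F) where
  mem i j hi := by
    rw [card_levelSet_ofFn, levelCard_entryCols hF] at hi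
    have hc : (i, j) ∈ lam.cells := YoungDiagram.mem_iff_lt_colLen.mpr hi
    rw [mem_levelSet_ofFn, entry, dif_pos hc]
    exact ⟨(F ⟨_, hc⟩).isLt, mem_entryCols.mpr ⟨⟨_, hc⟩, rfl, rfl⟩⟩
  anti j := by
    rw [card_levelSet_ofFn, card_levelSet_ofFn, levelCard_entryCols hF, levelCard_entryCols hF]
    exact lam.colLen_anti _ _ (Nat.le_succ j)
  first i i' h h' := by
    rw [card_levelSet_ofFn, levelCard_entryCols hF] at h'
    have hc' : (i', 0) ∈ lam.cells := YoungDiagram.mem_iff_lt_colLen.mpr h'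
    have hc : (i, 0) ∈ lam.cells := YoungDiagram.mem_iff_lt_colLen.mpr (h.trans h')
    rw [entry, entry, dif_pos hc, dif_pos hc']
    exact hF.2 ⟨_, hc⟩ ⟨_, hc'⟩ rfl rfl h
  triple j i i' h h' := by
    rw [card_levelSet_ofFn, levelCard_entryCols hF] at h'
    have hc' : (i', j + 1) ∈ lam.cells := YoungDiagram.mem_iff_lt_colLen.mpr h'
    have hc : (i, j + 1) ∈ lam.cells := YoungDiagram.mem_iff_lt_colLen.mpr (h.trans h')
    have ha : (i, j) ∈ lam.cells := lam.up_left_mem le_rfl (Nat.le_succ j) hc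
    rw [entry, entry, entry, dif_pos hc, dif_pos hc', dif_pos ha]
    exact hF.1 ⟨_, ha⟩ ⟨_, hc⟩ ⟨_, hc'⟩ rfl rfl rfl h

theorem entryCols_mem_fillings {F : lam.cells → Fin m} (hF : IsCOF F) :
    entryCols F ∈ fillings m (lam.rowLen 0) lam.colLen := by
  refine mem_fillings.mpr ⟨fun y j hj => ?_, levelCard_entryCols hF⟩
  obtain ⟨b, -, rfl⟩ := mem_entryCols.mp hj
  rw [Finset.mem_range]
  exact YoungDiagram.mem_iff_lt_rowLen.mp (lam.up_left_mem (Nat.zero_le _) le_rfl b.2)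

theorem exists_isCOF {B : Fin m → Finset ℕ} (hB : B ∈ fillings m (lam.rowLen 0) lam.colLen) :
    ∃ F : lam.cells → Fin m, IsCOF F ∧ entryCols F = B := by
  obtain ⟨-, hB2⟩ := mem_fillings.mp hB
  obtain ⟨pos, hpos⟩ := exists_rowSystem (levelSet (List.ofFn B)) fun j => by
    rw [card_levelSet_ofFn, card_levelSet_ofFn, hB2, hB2]
    exact lam.colLen_anti _ _ (Nat.le_succ j)
  have hmem : ∀ b : lam.cells, ∃ h : pos b.1.1 b.1.2 < m, b.1.2 ∈ B ⟨pos b.1.1 b.1.2, h⟩ := by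
    intro b
    apply mem_levelSet_ofFn.mp
    apply hpos.mem
    rw [card_levelSet_ofFn, hB2]
    exact YoungDiagram.mem_iff_lt_colLen.mp b.2
  refine ⟨fun b => ⟨pos b.1.1 b.1.2, (hmem b).choose⟩, ⟨?_, ?_⟩, ?_⟩
  · rintro ⟨⟨i, j⟩, ha⟩ ⟨⟨i₁, j₁⟩, hb⟩ ⟨⟨i', j'⟩, hc⟩ h1 h2 h3 h4
    simp only at h1 h2 h3 h4
    subst h1 h2 h3
    apply hpos.triple j i i' h4
    rw [card_levelSet_ofFn, hB2]
    exact YoungDiagram.mem_iff_lt_colLen.mp hc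
  · rintro ⟨⟨i, j⟩, ha⟩ ⟨⟨i', j'⟩, hc⟩ h1 h2 h3
    simp only at h1 h2 h3
    subst h1 h2
    apply hpos.first i i' h3
    rw [card_levelSet_ofFn, hB2]
    exact YoungDiagram.mem_iff_lt_colLen.mp hc
  · funext x
    ext j
    rw [mem_entryCols]
    constructor
    · rintro ⟨b, rfl, rfl⟩
      exact (hmem b).choose_spec
    · intro hj
      have h1 : (x : ℕ) ∈ levelSet (List.ofFn B) j := mem_levelSet_ofFn.mpr ⟨x.isLt, hj⟩
      rw [hpos.eq_image] at h1
      obtain ⟨i, hi, e⟩ := Finset.mem_image.mp h1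
      rw [Finset.mem_range, card_levelSet_ofFn, hB2] at hi
      exact ⟨⟨(i, j), YoungDiagram.mem_iff_lt_colLen.mpr hi⟩, Fin.ext e, rfl⟩

open Classical in
-- A coinversion-free filling is a row system on the position sets of its family of blocks.
-- Existence and uniqueness of row systems make the passage to the family bijective.
theorem sum_isCOF {M : Type*} [AddCommMonoid M] (f : (Fin m → Finset ℕ) → M) :
    ∑ F ∈ Finset.univ.filter (fun F : lam.cells → Fin m => IsCOF F), f (entryCols F) =
      ∑ B ∈ fillings m (lam.rowLen 0) lam.colLen, f B := by
  refine Finset.sum_bij (fun F _ => entryCols F) ?_ ?_ ?_ fun _ _ => rfl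
  · intro F hF
    exact entryCols_mem_fillings (Finset.mem_filter.mp hF).2
  · intro F hF F' hF' e
    replace hF := (Finset.mem_filter.mp hF).2
    replace hF' := (Finset.mem_filter.mp hF').2
    funext b
    have h1 := hF.rowSystem
    rw [e] at h1
    have h2 := h1.unique hF'.rowSystem b.1.2 b.1.1 (by
      rw [card_levelSet_ofFn, levelCard_entryCols hF']
      exact YoungDiagram.mem_iff_lt_colLen.mp b.2)
    rw [entry_cell, entry_cell] at h2
    exact Fin.ext h2
  · intro B hB
    obtain ⟨F, h1, h2⟩ := exists_isCOF hB
    exact ⟨F, Finset.mem_filter.mpr ⟨Finset.mem_univ _, h1⟩, h2⟩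

theorem prod_X_eq_mono {R : Type*} [CommRing R] {F : lam.cells → Fin m} (hF : IsCOF F) :
    ∏ b : lam.cells, (MvPolynomial.X (F b) : MvPolynomial (Fin m) R) =
      mono R (weight (entryCols F)) := by
  classical
  rw [Finset.prod_comp (fun x => (MvPolynomial.X x : MvPolynomial (Fin m) R)) F, mono]
  rw [Finset.prod_subset (Finset.subset_univ _)]
  · refine Finset.prod_congr rfl fun x _ => ?_
    congr 1
    rw [weight, entryCols, Finset.card_image_of_injOn]
    intro b hb b' hb' e
    have h2 := (Finset.mem_filter.mp (Finset.mem_coe.mp hb)).2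
    have h3 := (Finset.mem_filter.mp (Finset.mem_coe.mp hb')).2
    exact hF.injOn e (h2.trans h3.symm)
  · intro x _ hx
    rw [Finset.card_eq_zero.mpr, pow_zero]
    rw [Finset.filter_eq_empty_iff]
    intro b _ e
    exact hx (Finset.mem_image.mpr ⟨b, Finset.mem_univ _, e⟩)

theorem isDescent_iff (F : lam.cells → Fin m) (b : lam.cells) :
    IsDescent F b ↔ 0 < b.1.2 ∧ entry F b.1.1 (b.1.2 - 1) < entry F b.1.1 b.1.2 := by
  constructor
  · rintro ⟨a, h1, h2, h3⟩
    refine ⟨by omega, ?_⟩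
    have h4 : b.1.2 - 1 = a.1.2 := by omega
    rw [h4, ← h1, entry_cell, h1, entry_cell]
    exact h3
  · rintro ⟨h1, h2⟩
    have ha : (b.1.1, b.1.2 - 1) ∈ lam.cells := lam.up_left_mem le_rfl (Nat.sub_le _ _) b.2
    refine ⟨⟨_, ha⟩, rfl, Nat.sub_add_cancel h1, ?_⟩
    rw [entry_cell, entry, dif_pos ha] at h2
    exact h2

theorem sum_cells {M : Type*} [AddCommMonoid M] (g : ℕ → ℕ → M) :
    ∑ b : lam.cells, g b.1.1 b.1.2 =
      ∑ i ∈ Finset.range (lam.colLen 0), ∑ j ∈ Finset.range (lam.rowLen i), g i j := by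
  rw [Finset.sum_coe_sort lam.cells fun b => g b.1 b.2, Finset.sum_sigma']
  refine Finset.sum_bij' (fun b _ => ⟨b.1, b.2⟩) (fun x _ => (x.1, x.2)) ?_ ?_ ?_ ?_ ?_
  · intro b hb
    refine Finset.mem_sigma.mpr ⟨Finset.mem_range.mpr ?_, Finset.mem_range.mpr ?_⟩
    · exact YoungDiagram.mem_iff_lt_colLen.mp (lam.up_left_mem le_rfl (Nat.zero_le _) hb)
    · exact YoungDiagram.mem_iff_lt_rowLen.mp hb
  · rintro ⟨i, j⟩ hx
    exact YoungDiagram.mem_iff_lt_rowLen.mpr (Finset.mem_range.mp (Finset.mem_sigma.mp hx).2)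
  · intro b _; rfl
  · intro x _; rfl
  · intro b _; rfl

/-- The descent at the box `(i, j + 1)` contributes its leg plus one, which is `λ_i - (j + 1)` and
is thus the weight of a winding from `j` to `j + 1`. -/
theorem maj_eq (F : lam.cells → Fin m) :
    maj F = ∑ i ∈ Finset.range (lam.colLen 0), rowCharge (lam.rowLen i) (entry F i) := by
  classical
  rw [maj, Finset.sum_filter]
  simp only [isDescent_iff, leg]
  rw [sum_cells fun i j =>
    if 0 < j ∧ entry F i (j - 1) < entry F i j then lam.rowLen i - (j + 1) + 1 else 0]
  refine Finset.sum_congr rfl fun i _ => ?_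
  rw [rowCharge, Finset.sum_filter]
  rcases h : lam.rowLen i with _ | k
  · rfl
  · rw [Finset.sum_range_succ', if_neg (by omega), add_zero, Nat.add_sub_cancel]
    refine Finset.sum_congr rfl fun j hj => ?_
    rw [Finset.mem_range] at hj
    rw [Nat.add_sub_cancel]
    have : (0 < j + 1 ∧ entry F i j < entry F i (j + 1)) ↔ entry F i j < entry F i (j + 1) := by
      simp
    simp only [this]
    split_ifs
    · omega
    · rfl

end

section

/-! ### Stacking two row systems on top of a rectangular block of letters -/

section stack

variable {A B : ℕ → Finset ℕ} {pA pB : ℕ → ℕ → ℕ} {c r m : ℕ}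

/-- The levels of `B` together with `c` intervals of length `r`, followed by the levels of `A`. -/
def stackLevel (A B : ℕ → Finset ℕ) (c r m j : ℕ) : Finset ℕ :=
  if j < c then B j ∪ Finset.Ico (m + (c - 1 - j) * r) (m + (c - 1 - j) * r + r) else A (j - c)

/-- The rows of `A`, prolonged to the left through the intervals, followed by the rows of `B`. -/
def stackPos (pA pB : ℕ → ℕ → ℕ) (c r m i j : ℕ) : ℕ :=
  if i < r then if j < c then m + (c - 1 - j) * r + (r - 1 - i) else pA i (j - c)
  else pB (i - r) j

theorem card_stackLevel (hB : ∀ j, B j ⊆ Finset.range m) (j : ℕ) :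
    (stackLevel A B c r m j).card = if j < c then r + (B j).card else (A (j - c)).card := by
  unfold stackLevel
  split_ifs
  · rw [Finset.card_union_of_disjoint, Nat.card_Ico]
    · omega
    · rw [Finset.disjoint_left]
      intro x hx hx'
      have h1 := Finset.mem_range.mp (hB j hx)
      have h2 := (Finset.mem_Ico.mp hx').1
      omega
  · rfl

/-- The intervals lie to the right of all other positions and move left from level to level, so the
first `r` rows greedily run through them without winding, leaving the positions in `B` to the other
rows. At the level `c` these `r` rows enter `A`, which they exhaust. -/
theorem RowSystem.stack (hA : RowSystem A pA) (hB : RowSystem B pB) (hAr : (A 0).card = r)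
    (hAm : ∀ j, A j ⊆ Finset.range m) (hBm : ∀ j, B j ⊆ Finset.range m)
    (hBc : ∀ j, c ≤ j → B j = ∅) :
    RowSystem (stackLevel A B c r m) (stackPos pA pB c r m) := by
  have hAcard : ∀ j, (A j).card ≤ r := fun j => hAr ▸ hA.antitone (Nat.zero_le j)
  have hpA : ∀ i j, i < (A j).card → pA i j < m := fun i j h =>
    Finset.mem_range.mp (hAm j (hA.mem i j h))
  have hpB : ∀ i j, i < (B j).card → pB i j < m := fun i j h =>
    Finset.mem_range.mp (hBm j (hB.mem i j h))
  constructor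
  · intro i j hi
    rw [card_stackLevel hBm] at hi
    unfold stackLevel stackPos
    by_cases hj : j < c
    · rw [if_pos hj] at hi ⊢
      rw [if_pos hj, Finset.mem_union, Finset.mem_Ico]
      by_cases hir : i < r
      · rw [if_pos hir]
        right
        omega
      · rw [if_neg hir]
        exact Or.inl (hB.mem _ _ (by omega))
    · rw [if_neg hj] at hi ⊢
      rw [if_pos (hi.trans_le (hAcard _)), if_neg hj]
      exact hA.mem _ _ hi
  · intro j
    rw [card_stackLevel hBm, card_stackLevel hBm]
    have h1 := hB.anti j
    split_ifs with h2 h3 h3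
    · omega
    · omega
    · have := hAcard (j + 1 - c)
      omega
    · have := hA.anti (j - c)
      rwa [← Nat.sub_add_comm (by omega)] at this
  · intro i i' h h'
    rw [card_stackLevel hBm] at h'
    unfold stackPos
    by_cases hc : 0 < c
    · rw [if_pos hc] at h' ⊢
      split_ifs with h1 h2 h2
      · omega
      · omega
      · have := hpB (i' - r) 0 (by omega)
        omega
      · exact hB.first _ _ (by omega) (by omega)
    · rw [if_neg hc, Nat.zero_sub] at h'
      rw [if_neg hc, if_neg hc, Nat.zero_sub, if_pos (by omega), if_pos (by omega)]
      exact hA.first _ _ h h'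
  · intro j i i' h h'
    rw [card_stackLevel hBm] at h'
    unfold stackPos
    by_cases hj : j + 1 < c
    · rw [if_pos hj] at h'
      rw [if_pos hj, if_pos (show j < c by omega)]
      have e : (c - 1 - j) * r = (c - 1 - (j + 1)) * r + r := by
        rw [← Nat.succ_mul]
        congr 1
        omega
      by_cases hi : i < r
      · rw [if_pos hi, if_pos hi]
        refine Or.inr (Or.inl ⟨?_, by omega⟩)
        split_ifs with hi'
        · omega
        · have := hpB (i' - r) (j + 1) (by omega)
          omega
      · rw [if_neg hi, if_neg hi, if_neg (by omega)]
        exact hB.triple j _ _ (by omega) (by omega)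
    · rw [if_neg hj] at h'
      have hi' := h'.trans_le (hAcard _)
      rw [if_pos (h.trans hi'), if_pos (h.trans hi'), if_pos hi', if_neg hj, if_neg hj]
      -- When the rows leave the last interval, all of `A 0` is to their left; they take its
      -- elements in decreasing order, as `hA.first` requires.
      by_cases hj' : j < c
      · rw [if_pos hj']
        obtain rfl : j + 1 = c := by omega
        rw [Nat.sub_self] at h' ⊢
        have h1 := hA.first i i' h h'
        have h2 := hpA i 0 (by omega)
        exact Or.inr (Or.inl ⟨h1, by omega⟩)
      · rw [if_neg hj', Nat.sub_add_comm (by omega)]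
        rw [Nat.sub_add_comm (by omega)] at h'
        exact hA.triple _ _ _ h h'

/-- The first `c` steps go to the left and contribute nothing; at a later step the number of levels
that remain is the same in the prolonged row as in the row of `A`. -/
theorem rowCharge_stackPos_left {i k : ℕ} (hi : i < r) (hk : 0 < k → pA i 0 < m) :
    rowCharge (c + k) (stackPos pA pB c r m i) = rowCharge k (pA i) := by
  unfold rowCharge
  symm
  refine Finset.sum_bij (fun j _ => c + j) ?_ ?_ ?_ ?_
  · intro j hj
    obtain ⟨h1, h2⟩ := Finset.mem_filter.mp hj
    rw [Finset.mem_range] at h1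
    refine Finset.mem_filter.mpr ⟨Finset.mem_range.mpr (by omega), ?_⟩
    unfold stackPos
    rw [if_pos hi, if_pos hi, if_neg (by omega), if_neg (by omega), Nat.add_sub_cancel_left,
      Nat.add_assoc, Nat.add_sub_cancel_left]
    exact h2
  · intro j _ j' _ e
    omega
  · intro j hj
    obtain ⟨h1, h2⟩ := Finset.mem_filter.mp hj
    rw [Finset.mem_range] at h1
    unfold stackPos at h2
    rw [if_pos hi, if_pos hi] at h2
    by_cases hj : j < c
    · exfalso
      rw [if_pos hj] at h2
      split_ifs at h2 with h3
      · have e : (c - 1 - j) * r = (c - 1 - (j + 1)) * r + r := by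
          rw [← Nat.succ_mul]
          congr 1
          omega
        omega
      · obtain rfl : j + 1 = c := by omega
        rw [Nat.sub_self] at h2
        have := hk (by omega)
        omega
    · rw [if_neg hj, if_neg (by omega), Nat.sub_add_comm (by omega)] at h2
      exact ⟨j - c, Finset.mem_filter.mpr ⟨Finset.mem_range.mpr (by omega), h2⟩, by omega⟩
  · intro j _
    omega

end stack

/-! ### The postfix word -/

theorem count_postfixWord (ρ : YoungDiagram) (j : ℕ) : (postfixWord ρ).count j = ρ.rowLen j := by
  unfold postfixWord
  rw [List.count_flatMap, List.map_reverse, List.sum_reverse]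
  have h1 : (List.count j ∘ fun i => List.replicate (ρ.rowLen i) i) =
      fun i => if i = j then ρ.rowLen i else 0 := by
    funext i
    simp only [Function.comp, List.count_replicate, beq_iff_eq]
  rw [h1]
  change (∑ i ∈ Finset.range (ρ.colLen 0), if i = j then ρ.rowLen i else 0) = _
  rw [Finset.sum_ite_eq']
  split_ifs with h
  · rfl
  · rw [Finset.mem_range, not_lt] at h
    exact (rowLen_eq_zero_iff.mpr h).symm

/-- The word `c^r ⋯ 2^r 1^r`. -/
def rectWord (c r : ℕ) : List ℕ := (List.range c).reverse.flatMap fun i => List.replicate r i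

theorem rectWord_succ (c r : ℕ) : rectWord (c + 1) r = List.replicate r c ++ rectWord c r := by
  rw [rectWord, List.range_succ, List.reverse_append, List.reverse_singleton, List.flatMap_append,
    List.flatMap_singleton, rectWord]

/-- The word starts with its largest letter, so the letter `j` comes after `c - 1 - j` groups of
length `r`. -/
theorem mem_wordSet_rectWord {c r j p : ℕ} :
    p ∈ wordSet (rectWord c r) j ↔ j < c ∧ (c - 1 - j) * r ≤ p ∧ p < (c - 1 - j) * r + r := by
  rw [mem_wordSet]
  induction c generalizing p with
  | zero => simp [rectWord]
  | succ c ih =>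
    rw [rectWord_succ, Nat.add_sub_cancel]
    by_cases hp : p < r
    · rw [List.getElem?_append_left (by simpa using hp), List.getElem?_replicate, if_pos hp,
        Option.some_inj]
      constructor
      · rintro rfl
        simp [hp]
      · rintro ⟨h1, h2, h3⟩
        rcases h : c - j with _ | e
        · omega
        · rw [h, Nat.succ_mul] at h2
          omega
    · rw [List.getElem?_append_right (by simpa using hp), List.length_replicate, ih]
      rcases h : c - j with _ | e
      · simp only [Nat.zero_mul]
        omega
      · rw [show c - 1 - j = e by omega, Nat.succ_mul]
        omega

theorem mem_rect {c r i j : ℕ} : (i, j) ∈ rect c r ↔ i < r ∧ j < c := by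
  unfold rect
  rw [YoungDiagram.mem_ofRowLens]
  simp

theorem rect_colLen (c r j : ℕ) : (rect c r).colLen j = if j < c then r else 0 := by
  refine eq_of_forall_lt_iff fun i => ?_
  rw [← YoungDiagram.mem_iff_lt_colLen, mem_rect]
  split_ifs with h <;> simp [h]

theorem rect_rowLen (c r i : ℕ) : (rect c r).rowLen i = if i < r then c else 0 := by
  refine eq_of_forall_lt_iff fun j => ?_
  rw [← YoungDiagram.mem_iff_lt_rowLen, mem_rect]
  split_ifs with h <;> simp [h]

theorem postfixWord_rect (c r : ℕ) : postfixWord (rect c r).transpose = rectWord c r := by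
  unfold postfixWord
  simp only [YoungDiagram.colLen_transpose, YoungDiagram.rowLen_transpose, rect_rowLen, rect_colLen]
  -- For `r = 0` the rectangle is empty whatever `c` is, while `rectWord` still runs through `c`
  -- empty groups.
  rcases Nat.eq_zero_or_pos r with rfl | hr
  · rw [if_neg (lt_irrefl 0)]
    symm
    rw [List.range_zero]
    simp [rectWord]
  · rw [if_pos hr, rectWord, List.flatMap_congr]
    intro i hi
    rw [List.mem_reverse, List.mem_range] at hi
    rw [if_pos hi]

theorem mem_kappa {lam μ : YoungDiagram} {i j : ℕ} : (i, j) ∈ kappa lam μ ↔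
    if i < lam.colLen 0 then j < μ.rowLen 0 + lam.rowLen i else j < μ.rowLen (i - lam.colLen 0) := by
  unfold kappa
  rw [YoungDiagram.mem_ofRowLens]
  simp only [List.length_append, List.length_map, YoungDiagram.length_rowLens]
  by_cases h : i < lam.colLen 0
  · rw [if_pos h]
    constructor
    · rintro ⟨h1, h2⟩
      rw [List.getElem_append_left (by simpa using h)] at h2
      simpa [YoungDiagram.rowLens] using h2
    · intro h2
      refine ⟨by omega, ?_⟩
      rw [List.getElem_append_left (by simpa using h)]
      simpa [YoungDiagram.rowLens] using h2
  · rw [if_neg h]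
    constructor
    · rintro ⟨h1, h2⟩
      rw [List.getElem_append_right (by simpa using h)] at h2
      simpa [YoungDiagram.rowLens] using h2
    · intro h2
      have h3 : i - lam.colLen 0 < μ.colLen 0 := by
        by_contra h3
        rw [rowLen_eq_zero_iff.mpr (not_lt.mp h3)] at h2
        omega
      refine ⟨by omega, ?_⟩
      rw [List.getElem_append_right (by simpa using h)]
      simpa [YoungDiagram.rowLens] using h2

theorem kappa_colLen (lam μ : YoungDiagram) (j : ℕ) : (kappa lam μ).colLen j =
    if j < μ.rowLen 0 then lam.colLen 0 + μ.colLen j else lam.colLen (j - μ.rowLen 0) := by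
  refine eq_of_forall_lt_iff fun i => ?_
  rw [← YoungDiagram.mem_iff_lt_colLen, mem_kappa]
  split_ifs with h1 h2 h2
  · omega
  · rw [← YoungDiagram.mem_iff_lt_colLen, YoungDiagram.mem_iff_lt_rowLen]
    omega
  · have : j < μ.rowLen (i - lam.colLen 0) ↔ i - lam.colLen 0 < μ.colLen j := by
      rw [← YoungDiagram.mem_iff_lt_colLen, YoungDiagram.mem_iff_lt_rowLen]
    rw [this]
    omega
  · have h3 := lam.colLen_anti 0 (j - μ.rowLen 0) (Nat.zero_le _)
    have h4 := μ.rowLen_anti 0 (i - lam.colLen 0) (Nat.zero_le _)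
    omega

theorem skewCols_kappa (lam μ : YoungDiagram) :
    skewCols (kappa lam μ) (rect (μ.rowLen 0) (lam.colLen 0)) =
      concat (μ.rowLen 0) μ.colLen lam.colLen := by
  funext j
  rw [skewCols, kappa_colLen, rect_colLen, concat]
  split_ifs
  · omega
  · rfl

/-! ### The postfix charge of a tableau -/

theorem cnt_colList {ν : YoungDiagram} (T : SemistandardYoungTableau ν) (j : ℕ) :
    cnt (colList T) j = content T j := by
  rw [← (colList_equiv T le_rfl).cnt_eq, cnt_ofFn, levelCard_colSet T le_rfl]

theorem count_readingWord {ν : YoungDiagram} (T : SemistandardYoungTableau ν) (j : ℕ) :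
    (readingWord T).count j = content T j := by
  rw [← cnt_singles, ← (colList_equiv_readingWord T).cnt_eq, cnt_colList]

theorem count_readingWord_postfixWord {lam μ ν : YoungDiagram} (h : μ ≤ lam)
    {T : SemistandardYoungTableau ν} (hT : T ∈ ssyt ν (skewCols lam μ)) (j : ℕ) :
    (readingWord T ++ postfixWord μ.transpose).count j = lam.colLen j := by
  rw [List.count_append, count_readingWord, mem_ssyt.mp hT, count_postfixWord,
    YoungDiagram.rowLen_transpose, skewCols, Nat.sub_add_cancel]
  by_contra hlt
  have h1 := YoungDiagram.mem_iff_lt_colLen.mpr (not_le.mp hlt)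
  exact lt_irrefl _ (YoungDiagram.mem_iff_lt_colLen.mp (h h1))

/-- Since `T` has content `λ' - μ'` and the postfix word has content `μ'`, the whole word has the
partition content `λ'`, as required for reading its charge as a sum of winding numbers. -/
theorem postfixCharge_eq_chargeSum {lam μ ν : YoungDiagram} (h : μ ≤ lam)
    {T : SemistandardYoungTableau ν} (hT : T ∈ ssyt ν (skewCols lam μ)) :
    postfixCharge μ.transpose (readingWord T) =
      chargeSum (lam.rowLen 0) (singles (readingWord T ++ postfixWord μ.transpose)) := by
  have hc := count_readingWord_postfixWord h hT
  refine charge_eq_chargeSum (fun a ha => ?_) fun a => ?_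
  · have h1 := List.count_pos_iff.mpr ha
    rw [hc] at h1
    by_contra h2
    rw [colLen_eq_zero_iff.mpr (not_lt.mp h2)] at h1
    omega
  · rw [hc, hc]
    exact lam.colLen_anti _ _ (Nat.le_succ a)

/-! ### The charge of a pair of coinversion-free fillings -/

theorem mem_levelSet_append {L Z : List (Finset ℕ)} {x j : ℕ} : x ∈ levelSet (L ++ Z) j ↔
    if x < L.length then x ∈ levelSet L j else x - L.length ∈ levelSet Z j := by
  simp only [mem_levelSet]
  split_ifs with h
  · rw [List.getD_append _ _ _ _ h]
  · rw [List.getD_append_right _ _ _ _ (not_lt.mp h)]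

variable {lam μ : YoungDiagram} {m : ℕ}

theorem levelSet_join_rectWord {c r : ℕ} {B B' : Fin m → Finset ℕ}
    (hB : ∀ y, B y ⊆ Finset.range c) :
    levelSet (List.ofFn (join c B B') ++ singles (rectWord c r)) =
      stackLevel (levelSet (List.ofFn B')) (levelSet (List.ofFn B)) c r m := by
  funext j
  ext x
  rw [mem_levelSet_append, List.length_ofFn, levelSet_singles, mem_wordSet_rectWord, stackLevel,
    mem_levelSet_ofFn]
  simp only [mem_join hB]
  by_cases hj : j < c
  · rw [if_pos hj, Finset.mem_union, Finset.mem_Ico, mem_levelSet_ofFn]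
    simp only [if_pos hj]
    by_cases hx : x < m
    · rw [if_pos hx]
      constructor
      · exact Or.inl
      · rintro (h | h)
        · exact h
        · omega
    · rw [if_neg hx]
      constructor
      · rintro ⟨-, h⟩
        right
        omega
      · rintro (⟨h, -⟩ | h)
        · exact absurd h hx
        · exact ⟨hj, by omega⟩
  · rw [if_neg hj, mem_levelSet_ofFn]
    simp only [if_neg hj]
    by_cases hx : x < m
    · rw [if_pos hx]
    · rw [if_neg hx]
      exact ⟨fun h => absurd h.1 hj, fun h => absurd h.1 hx⟩

/-- Stacking the row system of `F` behind the rectangle, and that of `F'` beside it, yields a row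
system for the joined block word. Its rows have the lengths of the rows of `kappa`: the upper ones
carry the major index of `F`, the lower ones that of `F'`. -/
theorem chargeSum_join {F : lam.cells → Fin m} {F' : μ.cells → Fin m} (hF : IsCOF F)
    (hF' : IsCOF F') :
    chargeSum (kappa lam μ |>.rowLen 0) (List.ofFn (join (μ.rowLen 0) (entryCols F') (entryCols F)) ++
      singles (rectWord (μ.rowLen 0) (lam.colLen 0))) = maj F + maj F' := by
  have hB := (mem_fillings.mp (entryCols_mem_fillings hF')).1
  set L := List.ofFn (join (μ.rowLen 0) (entryCols F') (entryCols F)) ++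
    singles (rectWord (μ.rowLen 0) (lam.colLen 0)) with hL
  have hsub : ∀ (B : Fin m → Finset ℕ) j, levelSet (List.ofFn B) j ⊆ Finset.range m := by
    intro B j x hx
    obtain ⟨h, -⟩ := mem_levelSet_ofFn.mp hx
    exact Finset.mem_range.mpr h
  have hcF : ∀ j, (levelSet (List.ofFn (entryCols F)) j).card = lam.colLen j := fun j => by
    rw [card_levelSet_ofFn, levelCard_entryCols hF]
  have hcF' : ∀ j, (levelSet (List.ofFn (entryCols F')) j).card = μ.colLen j := fun j => by
    rw [card_levelSet_ofFn, levelCard_entryCols hF']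
  have hsys := hF.rowSystem.stack hF'.rowSystem (c := μ.rowLen 0) (hcF 0) (hsub _) (hsub _)
    fun j hj => by rw [← Finset.card_eq_zero, hcF', colLen_eq_zero_iff]; exact hj
  have hcard : cnt L = (kappa lam μ).colLen := by
    funext j
    rw [cnt_eq_card, hL, levelSet_join_rectWord hB, card_stackLevel (hsub _), kappa_colLen]
    simp only [hcF, hcF']
  rw [← levelSet_join_rectWord hB, ← hL] at hsys
  have hlen : rowLength ((kappa lam μ).rowLen 0) (kappa lam μ).colLen = (kappa lam μ).rowLen := by
    funext i
    refine eq_of_forall_lt_iff fun t => ?_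
    rw [lt_rowLength fun a b hab => (kappa lam μ).colLen_anti a b hab,
      ← YoungDiagram.mem_iff_lt_colLen, ← YoungDiagram.mem_iff_lt_rowLen,
      ← YoungDiagram.mem_iff_lt_rowLen]
    exact ⟨fun h => h.2, fun h => ⟨(kappa lam μ).up_left_mem (Nat.zero_le _) le_rfl h, h⟩⟩
  have hcol0 : (kappa lam μ).colLen 0 = lam.colLen 0 + μ.colLen 0 := by
    rw [kappa_colLen]
    split_ifs with h
    · rfl
    · rw [colLen_eq_zero_iff.mpr (not_lt.mp h), Nat.zero_sub, Nat.add_zero]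
  have hrow : ∀ i, (kappa lam μ).rowLen i =
      if i < lam.colLen 0 then μ.rowLen 0 + lam.rowLen i else μ.rowLen (i - lam.colLen 0) := by
    intro i
    refine eq_of_forall_lt_iff fun j => ?_
    rw [← YoungDiagram.mem_iff_lt_rowLen, mem_kappa]
    split_ifs <;> rfl
  rw [hsys.chargeSum_eq, hcard, hlen, hcol0, Finset.sum_range_add, maj_eq, maj_eq]
  congr 1
  · refine Finset.sum_congr rfl fun i hi => ?_
    rw [Finset.mem_range] at hi
    rw [hrow, if_pos hi, rowCharge_stackPos_left hi]
    intro _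
    exact Finset.mem_range.mp (hsub _ 0 (hF.rowSystem.mem i 0 (by rw [hcF]; exact hi)))
  · refine Finset.sum_congr rfl fun i _ => ?_
    rw [hrow, if_neg (by omega), Nat.add_sub_cancel_left]
    congr 1
    funext j
    rw [stackPos, if_neg (by omega), Nat.add_sub_cancel_left]

/-- The major indices of a pair of fillings add up to an invariant of the joined family. The product
is therefore a generating function to which `genFun_eq_sum_schur` applies, and on a tableau the
invariant is its postfix charge. -/
theorem macdonaldE_mul (lam μ : YoungDiagram) (m : ℕ) :
    macdonaldE m lam * macdonaldE m μ = ∑ ν ∈ partitionsOf (lam.card + μ.card),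
      MvPolynomial.C (skewK (kappa lam μ) (rect (μ.rowLen 0) (lam.colLen 0)) ν) *
        schur (Polynomial ℤ) m ν.transpose := by
  classical
  set G : List (Finset ℕ) → ℤ[X] := fun L => X ^ chargeSum ((kappa lam μ).rowLen 0)
    (L ++ singles (rectWord (μ.rowLen 0) (lam.colLen 0))) with hG
  -- Equivalence of block words is compatible with appending the fixed rectangle word.
  have hinv : ∀ L L', BlockEquiv L L' → G L = G L' := fun L L' h => by
    simp only [hG]
    rw [(h.append_right _).chargeSum_eq]
  have h := genFun_eq_sum_schur (m := m) (b := μ.rowLen 0 + lam.rowLen 0)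
    (n := lam.card + μ.card) (α := concat (μ.rowLen 0) μ.colLen lam.colLen)
    (fun j => concat_eq_zero) (by rw [sum_concat, card_eq_sum_colLen, card_eq_sum_colLen, add_comm])
    hinv
  have hR : ∀ ν ∈ partitionsOf (lam.card + μ.card),
      MvPolynomial.C (skewK (kappa lam μ) (rect (μ.rowLen 0) (lam.colLen 0)) ν) *
        schur (Polynomial ℤ) m ν.transpose =
      ∑ T ∈ ssyt ν (concat (μ.rowLen 0) μ.colLen lam.colLen),
        MvPolynomial.C (G (colList T)) * schur (Polynomial ℤ) m ν.transpose := by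
    intro ν _
    rw [← Finset.sum_mul, skewK, map_sum]
    congr 1
    rw [← skewCols_kappa]
    refine Finset.sum_congr rfl fun T hT => ?_
    rw [hinv _ _ (colList_equiv_readingWord T), postfixCharge_eq_chargeSum (rect_le_kappa lam μ) hT,
      hG, postfixWord_rect, singles_append]
  rw [Finset.sum_congr rfl hR, ← h, genFun, ← sum_fillings_join fun j hj => colLen_eq_zero_iff.mpr hj,
    Finset.sum_product, ← sum_isCOF, macdonaldE, macdonaldE, mul_comm, Finset.sum_mul_sum]
  refine Finset.sum_congr rfl fun F' hF' => ?_
  rw [← sum_isCOF]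
  refine Finset.sum_congr rfl fun F hF => ?_
  replace hF := (Finset.mem_filter.mp hF).2
  replace hF' := (Finset.mem_filter.mp hF').2
  simp only [hG]
  rw [chargeSum_join hF hF', prod_X_eq_mono hF, prod_X_eq_mono hF',
    weight_join (mem_fillings.mp (entryCols_mem_fillings hF')).1, mono_add, add_comm, pow_add, map_mul]
  ring

end

section

/-! ### Row counts of tableaux -/

variable {ν : YoungDiagram}

/-- The number of entries equal to `k` in row `i` of `T`. -/
def rowCount (T : SemistandardYoungTableau ν) (i k : ℕ) : ℕ :=
  ((Finset.range (ν.rowLen i)).filter fun j => T i j = k).card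

/-- The number of entries less than `k` in row `i` of `T`. -/
def rowCountLT (T : SemistandardYoungTableau ν) (i k : ℕ) : ℕ :=
  ((Finset.range (ν.rowLen i)).filter fun j => T i j < k).card

theorem sum_rowCount (T : SemistandardYoungTableau ν) (i k : ℕ) :
    ∑ k' ∈ Finset.range k, rowCount T i k' = rowCountLT T i k := by
  unfold rowCount rowCountLT
  rw [Finset.card_eq_sum_card_fiberwise (f := fun j => T i j) (t := Finset.range k)
    fun j hj => by simpa using (Finset.mem_filter.mp (Finset.mem_coe.mp hj)).2]
  refine Finset.sum_congr rfl fun k' hk' => ?_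
  rw [Finset.mem_range] at hk'
  rw [Finset.filter_filter]
  congr 1
  refine Finset.filter_congr fun j _ => ?_
  omega

theorem row_le (T : SemistandardYoungTableau ν) {i j j' : ℕ} (h : j ≤ j') (h' : j' < ν.rowLen i) :
    T i j ≤ T i j' := by
  rcases h.eq_or_lt with rfl | h
  · exact le_rfl
  · exact T.row_weak h (YoungDiagram.mem_iff_lt_rowLen.mpr h')

theorem lt_iff_lt_rowCountLT (T : SemistandardYoungTableau ν) {i j k : ℕ} (hj : j < ν.rowLen i) :
    T i j < k ↔ j < rowCountLT T i k := by
  unfold rowCountLT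
  constructor
  · intro h
    have h1 : Finset.range (j + 1) ⊆ (Finset.range (ν.rowLen i)).filter fun j => T i j < k := by
      intro j' hj'
      rw [Finset.mem_range] at hj'
      exact Finset.mem_filter.mpr ⟨Finset.mem_range.mpr (by omega),
        lt_of_le_of_lt (row_le T (by omega) hj) h⟩
    have h2 := Finset.card_le_card h1
    rw [Finset.card_range] at h2
    omega
  · intro h
    by_contra hk
    have h1 : (Finset.range (ν.rowLen i)).filter (fun j => T i j < k) ⊆ Finset.range j := by
      intro j' hj'
      obtain ⟨h2, h3⟩ := Finset.mem_filter.mp hj'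
      rw [Finset.mem_range] at h2 ⊢
      by_contra h4
      have := row_le T (not_lt.mp h4) h2
      omega
    have h2 := Finset.card_le_card h1
    rw [Finset.card_range] at h2
    omega

theorem rowCountLT_le (T : SemistandardYoungTableau ν) (i k : ℕ) : rowCountLT T i k ≤ ν.rowLen i :=
  (Finset.card_filter_le _ _).trans (Finset.card_range _).le

/-- Column strictness, expressed by row counts: above an entry at most `k` stands an entry less than
`k`. -/
theorem rowCountLT_succ_le (T : SemistandardYoungTableau ν) (i k : ℕ) :
    rowCountLT T (i + 1) (k + 1) ≤ rowCountLT T i k := by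
  refine Finset.card_le_card fun j hj => ?_
  obtain ⟨h1, h2⟩ := Finset.mem_filter.mp hj
  rw [Finset.mem_range] at h1
  have h3 := T.col_strict (Nat.lt_add_one i) (YoungDiagram.mem_iff_lt_rowLen.mpr h1)
  have h4 := ν.rowLen_anti i (i + 1) (Nat.le_succ i)
  exact Finset.mem_filter.mpr ⟨Finset.mem_range.mpr (by omega), by omega⟩

theorem rowCount_eq_zero_of_rowLen (T : SemistandardYoungTableau ν) {i k : ℕ} (h : ν.rowLen i = 0) :
    rowCount T i k = 0 := by
  rw [rowCount, h]
  rfl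

theorem le_entry (T : SemistandardYoungTableau ν) {i j : ℕ} (h : (i, j) ∈ ν) : i ≤ T i j := by
  induction i with
  | zero => exact Nat.zero_le _
  | succ i ih =>
    have h1 := ih (ν.up_left_mem (Nat.le_succ i) le_rfl h)
    have h2 := T.col_strict (Nat.lt_add_one i) h
    omega

theorem rowCount_eq_zero_of_lt (T : SemistandardYoungTableau ν) {i k : ℕ} (h : k < i) :
    rowCount T i k = 0 := by
  rw [rowCount, Finset.card_eq_zero, Finset.filter_eq_empty_iff]
  intro j hj e
  have := le_entry T (YoungDiagram.mem_iff_lt_rowLen.mpr (Finset.mem_range.mp hj))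
  omega

theorem content_eq_sum_rowCount (T : SemistandardYoungTableau ν) {n : ℕ} (hn : ν.colLen 0 ≤ n)
    (k : ℕ) : content T k = ∑ i ∈ Finset.range n, rowCount T i k := by
  unfold content rowCount
  rw [Finset.card_eq_sum_card_fiberwise (f := Prod.fst) (t := Finset.range n) fun c hc => by
    have h1 := (Finset.mem_filter.mp (Finset.mem_coe.mp hc)).1
    have h2 := YoungDiagram.mem_iff_lt_colLen.mp (ν.up_left_mem le_rfl (Nat.zero_le c.2) h1)
    simp only [Finset.coe_range, Set.mem_Iio]
    omega]
  refine Finset.sum_congr rfl fun i _ => ?_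
  refine Finset.card_bij (fun c _ => c.2) ?_ ?_ ?_
  · rintro ⟨i', j⟩ hc
    obtain ⟨h1, h2⟩ := Finset.mem_filter.mp hc
    obtain ⟨h3, h4⟩ := Finset.mem_filter.mp h1
    simp only at h2 h4
    subst h2
    exact Finset.mem_filter.mpr ⟨Finset.mem_range.mpr (YoungDiagram.mem_iff_lt_rowLen.mp h3), h4⟩
  · rintro ⟨i', j⟩ hc ⟨i'', j'⟩ hc' e
    have h1 := (Finset.mem_filter.mp hc).2
    have h2 := (Finset.mem_filter.mp hc').2
    simp only at h1 h2 e
    rw [h1, h2, e]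
  · intro j hj
    obtain ⟨h1, h2⟩ := Finset.mem_filter.mp hj
    exact ⟨(i, j), Finset.mem_filter.mpr ⟨Finset.mem_filter.mpr
      ⟨YoungDiagram.mem_iff_lt_rowLen.mpr (Finset.mem_range.mp h1), h2⟩, rfl⟩, rfl⟩

theorem rowCount_le_content (T : SemistandardYoungTableau ν) (i k : ℕ) :
    rowCount T i k ≤ content T k := by
  rw [content_eq_sum_rowCount T (n := max (ν.colLen 0) (i + 1)) (le_max_left _ _)]
  exact Finset.single_le_sum (f := fun i => rowCount T i k) (fun _ _ => Nat.zero_le _)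
    (Finset.mem_range.mpr (by omega))

theorem sum_rowCount_eq_rowLen (T : SemistandardYoungTableau ν) {n : ℕ}
    (hn : ∀ k, n ≤ k → content T k = 0) (i : ℕ) :
    ∑ k ∈ Finset.range n, rowCount T i k = ν.rowLen i := by
  rw [sum_rowCount, rowCountLT, Finset.filter_true_of_mem, Finset.card_range]
  intro j hj
  by_contra h
  have h1 := hn _ (not_lt.mp h)
  rw [content, Finset.card_eq_zero, Finset.filter_eq_empty_iff] at h1
  exact h1 (x := (i, j)) (YoungDiagram.mem_iff_lt_rowLen.mpr (Finset.mem_range.mp hj)) rfl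

theorem ssyt_ext_rowCount {T T' : SemistandardYoungTableau ν}
    (h : ∀ i k, rowCount T i k = rowCount T' i k) : T = T' := by
  have h1 : ∀ i k, rowCountLT T i k = rowCountLT T' i k := fun i k => by
    rw [← sum_rowCount, ← sum_rowCount]
    exact Finset.sum_congr rfl fun k' _ => h i k'
  ext i j
  by_cases hc : (i, j) ∈ ν
  · have hj := YoungDiagram.mem_iff_lt_rowLen.mp hc
    refine eq_of_forall_gt_iff fun k => ?_
    rw [lt_iff_lt_rowCountLT T hj, lt_iff_lt_rowCountLT T' hj, h1]
  · rw [T.zeros hc, T'.zeros hc]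

/-- Multiplicities determine weakly increasing rows, and `hint` is precisely column strictness of
these rows. -/
theorem exists_ssyt_rowCount {R : ℕ → ℕ → ℕ} {b : ℕ} (h0 : ∀ i k, b ≤ k → R i k = 0)
    (hsum : ∀ i, ∑ k ∈ Finset.range b, R i k = ν.rowLen i)
    (hint : ∀ i k, ∑ k' ∈ Finset.range (k + 1), R (i + 1) k' ≤ ∑ k' ∈ Finset.range k, R i k') :
    ∃ T : SemistandardYoungTableau ν, ∀ i k, rowCount T i k = R i k := by
  classical
  set f : ℕ → ℕ → ℕ := fun i k => ∑ k' ∈ Finset.range k, R i k' with hf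
  have hmono : ∀ i, Monotone (f i) := fun i k k' h =>
    Finset.sum_le_sum_of_subset (Finset.range_subset_range.mpr h)
  have hle : ∀ i k, f i k ≤ ν.rowLen i := by
    intro i k
    rcases le_total k b with h | h
    · exact (hmono i h).trans (hsum i).le
    · rw [← hsum i]
      simp only [hf]
      rw [Finset.sum_subset (Finset.range_subset_range.mpr h)]
      intro k' _ hk'
      exact h0 _ _ (by simpa using hk')
  have hex : ∀ i j, (i, j) ∈ ν → ∃ k, j < f i (k + 1) := fun i j h => by
    refine ⟨b, lt_of_lt_of_le ?_ (hmono i (Nat.le_succ b))⟩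
    simp only [hf, hsum]
    exact YoungDiagram.mem_iff_lt_rowLen.mp h
  -- The least letter `k` such that more than `j` boxes of row `i` are to be filled with letters at
  -- most `k`.
  let E : ℕ → ℕ → ℕ := fun i j => if h : (i, j) ∈ ν then Nat.find (hex i j h) else 0
  have hE : ∀ i j k, (i, j) ∈ ν → (E i j < k ↔ j < f i k) := by
    intro i j k h
    simp only [E, dif_pos h, Nat.find_lt_iff]
    constructor
    · rintro ⟨k', h1, h2⟩
      exact h2.trans_le (hmono i h1)
    · intro h1
      rcases k with _ | k
      · simp [hf] at h1
      · exact ⟨k, Nat.lt_succ_self k, h1⟩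
  have hEcol : ∀ i j, (i + 1, j) ∈ ν → E i j < E (i + 1) j := by
    intro i j h
    have h1 := (hE _ _ _ h).mp (Nat.lt_succ_self _)
    exact (hE _ _ _ (ν.up_left_mem (Nat.le_succ i) le_rfl h)).mpr (h1.trans_le (hint i _))
  let T : SemistandardYoungTableau ν :=
    { entry := E
      row_weak' := by
        intro i j j' hj hc
        have h1 := (hE _ _ _ hc).mp (Nat.lt_succ_self _)
        exact Nat.le_of_lt_succ ((hE _ _ _ (ν.up_left_mem le_rfl hj.le hc)).mpr (hj.trans h1))
      col_strict' := by
        intro i i' j hi hc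
        induction i', hi using Nat.le_induction with
        | base => exact hEcol i j hc
        | succ i' hi ih =>
          exact (ih (ν.up_left_mem (Nat.le_succ i') le_rfl hc)).trans (hEcol i' j hc)
      zeros' := fun h => dif_neg h }
  have hT : ∀ i j k, j < ν.rowLen i → (T i j < k ↔ j < f i k) := fun i j k h =>
    hE i j k (YoungDiagram.mem_iff_lt_rowLen.mpr h)
  refine ⟨T, fun i k => ?_⟩
  have hlt : ∀ k, rowCountLT T i k = f i k := by
    intro k
    refine eq_of_forall_lt_iff fun j => ?_
    constructor
    · intro h
      have hj := h.trans_le (rowCountLT_le T i k)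
      rwa [← hT i j k hj, lt_iff_lt_rowCountLT T hj]
    · intro h
      have hj := h.trans_le (hle i k)
      rwa [← lt_iff_lt_rowCountLT T hj, hT i j k hj]
  have h1 := hlt (k + 1)
  rw [← sum_rowCount, Finset.sum_range_succ, sum_rowCount, hlt k] at h1
  simp only [hf] at h1
  rw [Finset.sum_range_succ] at h1
  omega

/-! ### The lattice condition for reading words -/

/-- The reading word of the rows before row `n`. -/
def rowsWord (T : SemistandardYoungTableau ν) (n : ℕ) : List ℕ :=
  (List.range n).reverse.flatMap fun i => (List.range (ν.rowLen i)).map fun j => T i j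

theorem rowsWord_succ (T : SemistandardYoungTableau ν) (n : ℕ) :
    rowsWord T (n + 1) = ((List.range (ν.rowLen n)).map fun j => T n j) ++ rowsWord T n := by
  rw [rowsWord, List.range_succ, List.reverse_append, List.reverse_singleton, List.flatMap_append,
    List.flatMap_singleton, rowsWord]

theorem rowsWord_eq_readingWord (T : SemistandardYoungTableau ν) {n : ℕ} (hn : ν.colLen 0 ≤ n) :
    rowsWord T n = readingWord T := by
  induction n, hn using Nat.le_induction with
  | base => rfl
  | succ n hn ih =>
    rw [rowsWord_succ, ih, rowLen_eq_zero_iff.mpr hn]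
    rfl

theorem count_row (T : SemistandardYoungTableau ν) (i k : ℕ) :
    ((List.range (ν.rowLen i)).map fun j => T i j).count k = rowCount T i k := by
  rw [List.count, List.countP_map, rowCount, Finset.card_def, Finset.filter_val,
    ← Multiset.countP_eq_card_filter]
  change _ = Multiset.countP (fun j => T i j = k) (List.range (ν.rowLen i) : Multiset ℕ)
  rw [Multiset.coe_countP]
  congr 1

theorem cnt_append_row (T : SemistandardYoungTableau ν) (Z : List (Finset ℕ)) (n k : ℕ) :
    cnt (singles (rowsWord T n) ++ Z) k = cnt Z k + ∑ i ∈ Finset.range n, rowCount T i k := by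
  induction n with
  | zero => rw [Finset.sum_range_zero, Nat.add_zero]; rfl
  | succ n ih =>
    rw [rowsWord_succ, singles_append, List.append_assoc, cnt_append, ih, Finset.sum_range_succ,
      cnt_singles, count_row]
    omega

/-- A row increases weakly, so its worst suffix is the one that contains all letters `j + 1` and
none of the letters `j`. -/
theorem latticeAt_row_append (T : SemistandardYoungTableau ν) {i j : ℕ} {Z : List (Finset ℕ)}
    (hZ : LatticeAt j Z) :
    LatticeAt j (singles ((List.range (ν.rowLen i)).map fun j => T i j) ++ Z) ↔
      cnt Z (j + 1) + rowCount T i (j + 1) ≤ cnt Z j := by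
  constructor
  · intro h
    -- The cut behind the last letter `j` of the row.
    set k := rowCountLT T i (j + 1) with hk
    obtain ⟨l, hl⟩ := Nat.exists_eq_add_of_le (rowCountLT_le T i (j + 1))
    rw [← hk] at hl
    set s := (List.range l).map fun x => T i (k + x) with hs
    have hsplit : ((List.range (ν.rowLen i)).map fun j => T i j) =
        ((List.range k).map fun j => T i j) ++ s := by
      rw [hl, List.range_add, List.map_append, List.map_map]
      rfl
    have h1 := h (singles s ++ Z) ⟨singles ((List.range k).map fun j => T i j), by
      rw [hsplit, singles_append, List.append_assoc]⟩
    rw [cnt_append, cnt_append, cnt_singles, cnt_singles] at h1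
    have h2 : s.count j = 0 := by
      rw [List.count_eq_zero, hs]
      intro hm
      obtain ⟨x, hx, e⟩ := List.mem_map.mp hm
      rw [List.mem_range] at hx
      have := (lt_iff_lt_rowCountLT T (i := i) (j := k + x) (k := j + 1) (by omega)).mp (by omega)
      omega
    have h3 : ((List.range k).map fun j => T i j).count (j + 1) = 0 := by
      rw [List.count_eq_zero]
      intro hm
      obtain ⟨x, hx, e⟩ := List.mem_map.mp hm
      rw [List.mem_range] at hx
      have := (lt_iff_lt_rowCountLT T (i := i) (j := x) (k := j + 1) (by omega)).mpr (by omega)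
      omega
    have h4 := count_row T i (j + 1)
    rw [hsplit, List.count_append, h3] at h4
    omega
  · intro h D hD
    rcases suffix_append_iff'.mp hD with hD | ⟨A', ⟨B', hA⟩, rfl⟩
    · exact hZ D hD
    · rw [cnt_append, cnt_append]
      have h1 : cnt (singles ((List.range (ν.rowLen i)).map fun j => T i j)) (j + 1) =
          rowCount T i (j + 1) := by rw [cnt_singles, count_row]
      rw [← hA, cnt_append] at h1
      omega

theorem latticeAt_rowsWord_append (T : SemistandardYoungTableau ν) {j : ℕ} {Z : List (Finset ℕ)}
    (hZ : LatticeAt j Z) (n : ℕ) :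
    LatticeAt j (singles (rowsWord T n) ++ Z) ↔
      ∀ i < n, cnt Z (j + 1) + ∑ i' ∈ Finset.range (i + 1), rowCount T i' (j + 1) ≤
        cnt Z j + ∑ i' ∈ Finset.range i, rowCount T i' j := by
  induction n with
  | zero => exact ⟨fun _ i hi => absurd hi (Nat.not_lt_zero i), fun _ => hZ⟩
  | succ n ih =>
    rw [rowsWord_succ, singles_append, List.append_assoc]
    have hstep := fun h => latticeAt_row_append T (i := n) (j := j) (Z := singles (rowsWord T n) ++ Z) h
    rw [cnt_append_row, cnt_append_row, Nat.add_assoc, ← Finset.sum_range_succ] at hstep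
    constructor
    · intro h
      have h1 : LatticeAt j (singles (rowsWord T n) ++ Z) := fun D hD =>
        h D (hD.trans (List.suffix_append _ _))
      intro i hi
      rcases Nat.lt_succ_iff_lt_or_eq.mp hi with h2 | rfl
      · exact ih.mp h1 i h2
      · exact (hstep h1).mp h
    · intro h
      have h1 := ih.mpr fun i hi => h i (by omega)
      exact (hstep h1).mpr (h n (Nat.lt_succ_self n))

theorem latticeAt_readingWord_append (T : SemistandardYoungTableau ν) {j : ℕ}
    {Z : List (Finset ℕ)} (hZ : LatticeAt j Z) :
    LatticeAt j (singles (readingWord T) ++ Z) ↔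
      ∀ i, cnt Z (j + 1) + ∑ i' ∈ Finset.range (i + 1), rowCount T i' (j + 1) ≤
        cnt Z j + ∑ i' ∈ Finset.range i, rowCount T i' j := by
  constructor
  · intro h i
    rw [← rowsWord_eq_readingWord T (le_max_left (ν.colLen 0) (i + 1)),
      latticeAt_rowsWord_append T hZ] at h
    exact h i (by omega)
  · intro h
    exact (latticeAt_rowsWord_append T hZ (ν.colLen 0)).mpr fun i _ => h i

theorem latticeAt_colList (T : SemistandardYoungTableau ν) {j : ℕ} :
    LatticeAt j (colList T) ↔ ∀ i, ∑ i' ∈ Finset.range (i + 1), rowCount T i' (j + 1) ≤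
        ∑ i' ∈ Finset.range i, rowCount T i' j := by
  have h0 : LatticeAt j [] := fun D hD => by
    rw [List.suffix_nil.mp hD]
    simp
  rw [(colList_equiv_readingWord T).latticeAt_iff]
  have h := latticeAt_readingWord_append T h0
  rw [List.append_nil] at h
  simpa using h

theorem rowCount_highestWeight (ρ : YoungDiagram) (i k : ℕ) :
    rowCount (SemistandardYoungTableau.highestWeight ρ) i k = if i = k then ρ.rowLen i else 0 := by
  have h : ∀ j ∈ Finset.range (ρ.rowLen i), SemistandardYoungTableau.highestWeight ρ i j = i :=
    fun j hj => if_pos (YoungDiagram.mem_iff_lt_rowLen.mpr (Finset.mem_range.mp hj))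
  rw [rowCount]
  split_ifs with hik
  · rw [Finset.filter_true_of_mem fun j hj => (h j hj).trans hik, Finset.card_range]
  · rw [Finset.filter_false_of_mem fun j hj => by rw [h j hj]; exact hik, Finset.card_empty]

/-- This makes the lattice criterion for tableaux available for the postfix word. -/
theorem postfixWord_eq_readingWord (ρ : YoungDiagram) :
    postfixWord ρ = readingWord (SemistandardYoungTableau.highestWeight ρ) := by
  unfold postfixWord readingWord
  refine List.flatMap_congr fun i _ => ?_
  symm
  rw [List.eq_replicate_iff]
  refine ⟨by simp, fun x hx => ?_⟩
  obtain ⟨j, hj, rfl⟩ := List.mem_map.mp hx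
  exact if_pos (YoungDiagram.mem_iff_lt_rowLen.mpr (List.mem_range.mp hj))

theorem latticeAt_postfixWord (ρ : YoungDiagram) (j : ℕ) : LatticeAt j (singles (postfixWord ρ)) := by
  rw [postfixWord_eq_readingWord, ← (colList_equiv_readingWord _).latticeAt_iff, latticeAt_colList]
  intro i
  simp only [rowCount_highestWeight, Finset.sum_ite_eq', Finset.mem_range]
  have := ρ.rowLen_anti j (j + 1) (Nat.le_succ j)
  split_ifs <;> omega

/-! ### Tableaux of charge zero -/

/-- All winding numbers vanish exactly if for every `t` there is a chain without windings which uses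
all letters `t`. The last step of such a chain gives the lattice inequality, and trimming produces
it from the lattice inequalities. -/
theorem chargeSum_eq_zero_iff {N : ℕ} {L : List (Finset ℕ)} (hL : ∀ j, cnt L (j + 1) ≤ cnt L j)
    (hN : ∀ j, N ≤ j → cnt L j = 0) : chargeSum N L = 0 ↔ ∀ j, LatticeAt j L := by
  obtain ⟨pos, hpos⟩ := exists_rowSystem (levelSet L) fun j => by
    rw [← cnt_eq_card, ← cnt_eq_card]
    exact hL j
  unfold chargeSum
  rw [Finset.sum_eq_zero_iff]
  constructor
  · intro h j
    by_cases hj : j + 1 < N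
    · have h1 := h (j + 1) (Finset.mem_range.mpr hj)
      rw [hpos.winding_eq] at h1
      apply latticeAt_of_hasChain_zero
      rw [hpos.hasChain_iff, h1]
      rfl
    -- From `N - 1` on the lattice inequality is trivial, as the larger letter does not occur.
    · intro D hD
      have h1 : cnt D (j + 1) ≤ cnt L (j + 1) := List.Sublist.countP_le hD.sublist
      rw [hN (j + 1) (by omega)] at h1
      omega
  · intro h t _
    have h1 := hasChain_zero_of_latticeAt (t := t) fun j _ => h j
    rw [hpos.hasChain_iff] at h1
    rw [hpos.winding_eq]
    omega

open Classical in
-- At `q = 0` only charge zero survives, that is, the lattice property of the reading word followed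
-- by the postfix word, rewritten through row counts.
theorem eval_zero_skewK {lam μ : YoungDiagram} (h : μ ≤ lam) (ν : YoungDiagram) :
    (skewK lam μ ν).eval 0 = (((ssyt ν (skewCols lam μ)).filter fun T =>
      ∀ i j, μ.colLen (j + 1) + ∑ i' ∈ Finset.range (i + 1), rowCount T i' (j + 1) ≤
        μ.colLen j + ∑ i' ∈ Finset.range i, rowCount T i' j).card : ℤ) := by
  rw [skewK, Polynomial.eval_finsetSum, Finset.card_filter]
  push_cast
  refine Finset.sum_congr rfl fun T hT => ?_
  have hc := count_readingWord_postfixWord h hT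
  have h1 : postfixCharge μ.transpose (readingWord T) = 0 ↔
      ∀ i j, μ.colLen (j + 1) + ∑ i' ∈ Finset.range (i + 1), rowCount T i' (j + 1) ≤
        μ.colLen j + ∑ i' ∈ Finset.range i, rowCount T i' j := by
    rw [postfixCharge_eq_chargeSum h hT, chargeSum_eq_zero_iff, forall_comm]
    · refine forall_congr' fun j => ?_
      rw [singles_append, latticeAt_readingWord_append T (latticeAt_postfixWord _ j)]
      simp only [cnt_singles, count_postfixWord, YoungDiagram.rowLen_transpose]
    · intro j
      rw [cnt_singles, cnt_singles, hc, hc]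
      exact lam.colLen_anti _ _ (Nat.le_succ j)
    · intro j hj
      rw [cnt_singles, hc]
      exact colLen_eq_zero_iff.mpr hj
  rw [Polynomial.eval_pow, Polynomial.eval_X]
  split_ifs with h2
  · rw [h1.mpr h2, pow_zero]
  · rw [zero_pow fun h3 => h2 (h1.mp h3)]

/-! ### Companion tableaux -/

theorem sum_range_concat (b k : ℕ) (α β : ℕ → ℕ) : ∑ j ∈ Finset.range k, concat b α β j =
    ∑ j ∈ Finset.range (min k b), α j + ∑ j ∈ Finset.range (k - b), β j := by
  rcases le_total k b with h | h
  · rw [min_eq_left h, Nat.sub_eq_zero_of_le h, Finset.sum_range_zero, Nat.add_zero]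
    exact Finset.sum_congr rfl fun j hj => if_pos ((Finset.mem_range.mp hj).trans_le h)
  · rw [min_eq_right h]
    obtain ⟨l, rfl⟩ := Nat.exists_eq_add_of_le h
    rw [sum_concat, Nat.add_sub_cancel_left]

/-- The tableaux `T'` and `T` are companions with respect to the letters of `T'` from `c` on. -/
def Companion {κ : YoungDiagram} (c : ℕ) (T : SemistandardYoungTableau ν)
    (T' : SemistandardYoungTableau κ) : Prop :=
  ∀ i j, rowCount T' j (c + i) = rowCount T i j

variable {lam μ : YoungDiagram}

/-- By induction on `k`, the letter `k + 1` cannot occur in a row `i ≤ k`, because no letter `k`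
occurs in the rows before row `i`; in the rows below row `k + 1` it is too small. -/
theorem rowCount_eq_of_lattice {κ : YoungDiagram} {c : ℕ} {T : SemistandardYoungTableau κ}
    (h : ∀ j, j + 1 < c → LatticeAt j (colList T)) {k : ℕ} (hk : k < c) (i : ℕ) :
    rowCount T i k = if i = k then content T k else 0 := by
  have key : ∀ k < c, ∀ i, i ≠ k → rowCount T i k = 0 := by
    intro k
    induction k with
    | zero => exact fun _ i hi => rowCount_eq_zero_of_lt T (by omega)
    | succ k ih =>
      intro hk i hi
      rcases Nat.lt_or_ge (k + 1) i with h1 | h1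
      · exact rowCount_eq_zero_of_lt T h1
      · have h2 := (latticeAt_colList T).mp (h k hk) i
        rw [Finset.sum_eq_zero fun i' hi' => ih (by omega) i' (by
          have := Finset.mem_range.mp hi'
          omega), Finset.sum_range_succ] at h2
        omega
  split_ifs with h1
  · subst h1
    rw [content_eq_sum_rowCount T (n := max (κ.colLen 0) (i + 1)) (le_max_left _ _),
      Finset.sum_eq_single i fun i' _ hi' => key i hk i' hi']
    intro h2
    exact absurd (Finset.mem_range.mpr (by omega)) h2
  · exact key k hk i h1

/-- Row `j` of the companion consists of `μ'_j` letters `j`, followed by one letter `c + i` for each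
`j` in row `i` of `T`. This transposition of the row counts turns the lattice condition for `T` into
column strictness of the companion, and column strictness of `T` into its lattice condition. -/
theorem exists_companion (hμ : μ ≤ lam) {T : SemistandardYoungTableau ν}
    (hT : T ∈ ssyt ν (skewCols lam μ))
    (hlat : ∀ i j, μ.colLen (j + 1) + ∑ i' ∈ Finset.range (i + 1), rowCount T i' (j + 1) ≤
        μ.colLen j + ∑ i' ∈ Finset.range i, rowCount T i' j) :
    ∃ T' ∈ ssyt lam.transpose (concat (μ.rowLen 0) μ.colLen ν.rowLen),
      DoubleLattice (μ.rowLen 0) (ν.colLen 0) (colList T') ∧ Companion (μ.rowLen 0) T T' := by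
  rw [mem_ssyt] at hT
  set c := μ.rowLen 0 with hc
  have hcol : ∀ j, c ≤ j → μ.colLen j = 0 := fun j hj => colLen_eq_zero_iff.mpr hj
  have hle : ∀ j, μ.colLen j ≤ lam.colLen j := by
    intro j
    by_contra hlt
    have h1 := YoungDiagram.mem_iff_lt_colLen.mpr (not_le.mp hlt)
    exact lt_irrefl _ (YoungDiagram.mem_iff_lt_colLen.mp (hμ h1))
  have hsumR : ∀ j k, ∑ k' ∈ Finset.range k,
      concat c (fun k => if k = j then μ.colLen j else 0) (fun i => rowCount T i j) k' =
      (if j < k then μ.colLen j else 0) + ∑ i ∈ Finset.range (k - c), rowCount T i j := by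
    intro j k
    rw [sum_range_concat, Finset.sum_ite_eq']
    congr 1
    simp only [Finset.mem_range, lt_min_iff]
    by_cases hj : j < c
    · simp only [hj, and_true]
    · rw [hcol j (not_lt.mp hj), ite_self, ite_self]
  obtain ⟨T', hT'⟩ := exists_ssyt_rowCount (ν := lam.transpose) (b := c + ν.colLen 0)
    (R := fun j k => concat c (fun k => if k = j then μ.colLen j else 0)
      (fun i => rowCount T i j) k)
    (by
      intro j k hk
      rw [concat, if_neg (by omega)]
      exact rowCount_eq_zero_of_rowLen T (rowLen_eq_zero_iff.mpr (by omega)))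
    (by
      intro j
      rw [hsumR, Nat.add_sub_cancel_left, ← content_eq_sum_rowCount T le_rfl, hT,
        YoungDiagram.rowLen_transpose, skewCols]
      have := hle j
      have := hcol j
      split_ifs <;> omega)
    (by
      intro j k
      rw [hsumR, hsumR]
      have h1 := μ.colLen_anti j (j + 1) (Nat.le_succ j)
      -- Below `c` only the letters of `μ` are compared; from `c` on the required inequality is
      -- `hlat` with the row index shifted by `c`.
      rcases Nat.lt_or_ge k c with hk | hk
      · rw [Nat.sub_eq_zero_of_le (by omega), Nat.sub_eq_zero_of_le (by omega),
          Finset.sum_range_zero, Finset.sum_range_zero]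
        split_ifs <;> omega
      · have h2 := hlat (k - c) j
        rw [← Nat.sub_add_comm hk] at h2
        have h3 := hcol j
        have h4 := hcol (j + 1)
        split_ifs <;> omega)
  have hlow : ∀ j k, k < c → rowCount T' j k = if k = j then μ.colLen j else 0 := fun j k hk => by
    rw [hT', concat, if_pos hk]
  have hhigh : ∀ j i, rowCount T' j (c + i) = rowCount T i j := fun j i => by
    rw [hT', concat, if_neg (by omega), Nat.add_sub_cancel_left]
  refine ⟨T', mem_ssyt.mpr fun k => ?_, ⟨fun k hk => ?_, fun i _ => ?_⟩, fun i j => hhigh j i⟩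
  · by_cases hk : k < c
    · rw [content_eq_sum_rowCount T' (le_max_left _ (k + 1)), concat, if_pos hk]
      simp only [hlow _ k hk, Finset.sum_ite_eq, Finset.mem_range]
      rw [if_pos (by omega)]
    · obtain ⟨i, rfl⟩ := Nat.exists_eq_add_of_le (not_lt.mp hk)
      rw [content_eq_sum_rowCount T' (le_max_left _ (lam.rowLen 0)), concat, if_neg hk,
        Nat.add_sub_cancel_left]
      simp only [hhigh]
      refine sum_rowCount_eq_rowLen T (fun j hj => ?_) i
      rw [hT, skewCols, colLen_eq_zero_iff.mpr (by omega), Nat.zero_sub]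
  · rw [latticeAt_colList]
    intro i
    simp only [hlow _ k (by omega), hlow _ (k + 1) hk, Finset.sum_ite_eq, Finset.mem_range]
    have h1 := μ.colLen_anti k (k + 1) (Nat.le_succ k)
    split_ifs <;> omega
  · rw [latticeAt_colList]
    intro j
    simp only [Nat.add_assoc, hhigh]
    rw [sum_rowCount, sum_rowCount]
    exact rowCountLT_succ_le T i j

/-- The reverse construction. The lattice condition on the first `c` letters fixes their places, so
the other row counts carry all the information. -/
theorem exists_companion_symm {T' : SemistandardYoungTableau lam.transpose}
    (hT' : T' ∈ ssyt lam.transpose (concat (μ.rowLen 0) μ.colLen ν.rowLen))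
    (hlat : DoubleLattice (μ.rowLen 0) (ν.colLen 0) (colList T')) :
    ∃ T ∈ ssyt ν (skewCols lam μ),
      (∀ i j, μ.colLen (j + 1) + ∑ i' ∈ Finset.range (i + 1), rowCount T i' (j + 1) ≤
        μ.colLen j + ∑ i' ∈ Finset.range i, rowCount T i' j) ∧ Companion (μ.rowLen 0) T T' := by
  rw [mem_ssyt] at hT'
  set c := μ.rowLen 0 with hc
  have hcol : ∀ j, c ≤ j → μ.colLen j = 0 := fun j hj => colLen_eq_zero_iff.mpr hj
  have hcont : ∀ i, content T' (c + i) = ν.rowLen i := fun i => by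
    rw [hT', concat, if_neg (by omega), Nat.add_sub_cancel_left]
  have hlow : ∀ j, ∀ k < c, rowCount T' j k = if j = k then μ.colLen k else 0 := fun j k hk => by
    rw [rowCount_eq_of_lattice hlat.1 hk, hT', concat, if_pos hk]
  have hsum : ∀ j i, ∑ k ∈ Finset.range (c + i), rowCount T' j k =
      μ.colLen j + ∑ i' ∈ Finset.range i, rowCount T' j (c + i') := by
    intro j i
    rw [Finset.sum_range_add]
    congr 1
    rw [Finset.sum_congr rfl fun k hk => hlow j k (Finset.mem_range.mp hk), Finset.sum_ite_eq]
    split_ifs with h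
    · rfl
    · exact (hcol j (by simpa using h)).symm
  obtain ⟨T, hT⟩ := exists_ssyt_rowCount (ν := ν) (b := lam.rowLen 0)
    (R := fun i j => rowCount T' j (c + i))
    (fun i j hj => rowCount_eq_zero_of_rowLen T' (by
      rw [YoungDiagram.rowLen_transpose]; exact colLen_eq_zero_iff.mpr hj))
    (fun i => by
      rw [← hcont, content_eq_sum_rowCount T' (by rw [YoungDiagram.colLen_transpose])])
    (fun i j => by
      by_cases hi : i + 1 < ν.colLen 0
      · exact (latticeAt_colList T').mp (hlat.2 i hi) j
      · rw [Finset.sum_eq_zero]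
        · exact Nat.zero_le _
        · intro j' _
          have h1 := rowCount_le_content T' j' (c + (i + 1))
          rw [hcont, rowLen_eq_zero_iff.mpr (by omega)] at h1
          omega)
  refine ⟨T, mem_ssyt.mpr fun j => ?_, fun i j => ?_, fun i j => (hT i j).symm⟩
  · rw [content_eq_sum_rowCount T le_rfl]
    simp only [hT]
    have h1 := hsum j (ν.colLen 0)
    rw [sum_rowCount_eq_rowLen T' (fun k hk => by
      obtain ⟨i, rfl⟩ := Nat.exists_eq_add_of_le ((Nat.le_add_right _ _).trans hk)
      rw [hcont, rowLen_eq_zero_iff.mpr (by omega)]), YoungDiagram.rowLen_transpose] at h1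
    rw [skewCols]
    omega
  · simp only [hT]
    rw [← hsum, ← hsum, sum_rowCount, sum_rowCount, ← Nat.add_assoc]
    exact rowCountLT_succ_le T' j (c + i)

/-! ### The values at `q = 0` and `q = 1` -/

/-- Each side of the companion relation determines the other, and companions exist in both
directions; so the two sets of tableaux have the same size. -/
theorem eval_zero_skewK_eq_lrCoeff (h : μ ≤ lam) (ν : YoungDiagram) :
    (skewK lam μ ν).eval 0 = lrCoeff μ ν.transpose lam := by
  classical
  rw [eval_zero_skewK h, lrCoeff_eq, lrNumber]
  have hcol : ν.transpose.colLen = ν.rowLen := funext fun i => ν.colLen_transpose i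
  rw [hcol, YoungDiagram.rowLen_transpose]
  norm_cast
  apply le_antisymm
  · refine Finset.card_le_card_of_forall_subsingleton
      (fun T T' => Companion (μ.rowLen 0) T T') ?_ ?_
    · intro T hT
      obtain ⟨h1, h2⟩ := Finset.mem_filter.mp hT
      obtain ⟨T', h3, h4, h5⟩ := exists_companion h h1 h2
      exact ⟨T', Finset.mem_filter.mpr ⟨h3, h4⟩, h5⟩
    · rintro T' _ T₁ ⟨-, h1⟩ T₂ ⟨-, h2⟩
      exact ssyt_ext_rowCount fun i j => (h1 i j).symm.trans (h2 i j)
  · refine Finset.card_le_card_of_forall_subsingleton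
      (fun T' T => Companion (μ.rowLen 0) T T') ?_ ?_
    · intro T' hT'
      obtain ⟨h1, h2⟩ := Finset.mem_filter.mp hT'
      obtain ⟨T, h3, h4, h5⟩ := exists_companion_symm h1 h2
      exact ⟨T, Finset.mem_filter.mpr ⟨h3, h4⟩, h5⟩
    · rintro T _ T₁ ⟨m1, h1⟩ T₂ ⟨m2, h2⟩
      obtain ⟨h3, h4⟩ := Finset.mem_filter.mp m1
      obtain ⟨h5, h6⟩ := Finset.mem_filter.mp m2
      refine ssyt_ext_rowCount fun j k => ?_
      -- Letters below `μ.rowLen 0` are forced by the lattice condition and the content, the others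
      -- by the companion.
      by_cases hk : k < μ.rowLen 0
      · rw [rowCount_eq_of_lattice h4.1 hk, rowCount_eq_of_lattice h6.1 hk, mem_ssyt.mp h3,
          mem_ssyt.mp h5]
      · obtain ⟨i, rfl⟩ := Nat.exists_eq_add_of_le (not_lt.mp hk)
        exact (h1 i j).trans (h2 i j).symm

theorem eval_one_skewK (lam μ ν : YoungDiagram) :
    (skewK lam μ ν).eval 1 = (kostka ν (skewCols lam μ) : ℤ) := by
  rw [skewK, Polynomial.eval_finsetSum, kostka]
  simp

end

end LRCharge

end

theorem mainTheorem11 :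
    -- the defining relation determines the Littlewood–Richardson coefficients
    (∀ μ ν : YoungDiagram, ∃! c : YoungDiagram →₀ ℤ,
      LRCharge.IsSchurProductExpansion μ ν c) ∧
    -- (a)
    (∀ lam μ ν : YoungDiagram, μ ≤ lam →
      (LRCharge.skewK lam μ ν).eval 0 = LRCharge.lrCoeff μ ν.transpose lam) ∧
    -- (b)
    (∀ lam μ ν : YoungDiagram, μ ≤ lam →
      (LRCharge.skewK lam μ ν).eval 1 = (LRCharge.kostka ν (LRCharge.skewCols lam μ) : ℤ)) ∧
    -- (c)
    (∀ (lam μ : YoungDiagram) (m : ℕ),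
      LRCharge.macdonaldE m lam * LRCharge.macdonaldE m μ =
        ∑ ν ∈ LRCharge.partitionsOf (lam.card + μ.card),
          MvPolynomial.C (LRCharge.skewK (LRCharge.kappa lam μ)
              (LRCharge.rect (μ.rowLen 0) (lam.colLen 0)) ν) *
            LRCharge.schur (Polynomial ℤ) m ν.transpose) := by
  exact ⟨LRCharge.existsUnique_expansion,
    fun _ _ ν h => LRCharge.eval_zero_skewK_eq_lrCoeff h ν,
    fun lam μ ν _ => LRCharge.eval_one_skewK lam μ ν, LRCharge.macdonaldE_mul⟩
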